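/- Let $G$ be a complex semisimple algebraic group of adjoint type, realised as the adjoint group (the group of inner automorphisms) of its semisimple Lie algebra. Let $T$ be a maximal torus, $B\supseteq T$ a Borel subgroup, $B^-$ the opposite Borel subgroup (so $B\cap B^-=T$), $w_\circ$ the longest element of the Weyl group (represented in $N(T)$, $B^-=w_\circ Bw_\circ^{-1}$), and $P\supseteq B$ a parabolic subgroup. For a simple reflection $s_i$ let $P_i$ be the minimal parabolic subgroup generated by $B$ and $s_i$, and $P_i^-$ the one generated by $B^-$ and $s_i$. For a (not necessarily reduced) word $\underline w=(s_{i_1},\dots,s_{i_q})$ in the simple reflections let $(P_{i_1}\times\cdots\times P_{i_q})/B^q$ be the Bott–Samelson variety, the quotient by the action $(b_1,\dots,b_q)\cdot(p_1,\dots,p_q)=(p_1b_1^{-1},b_1p_2b_2^{-1},\dots,b_{q-1}p_qb_q^{-1})$, and let the opposite Bott–Samelson variety $\widetilde X^{\underline w}=(P^-_{i_1}\times\cdots\times P^-_{i_q})/(B^-)^q$ be defined in the same way; it has the left action of $B^-$ and the $B^-$-equivariant map $[p_1,\dots,p_q]\mapsto p_1\cdots p_q w_\circ P$ to $X=G/P$.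 A morphism of nonsingular complex varieties is called smooth if its differential is surjective at every point. (1) The morphism $B^-\times(P_{i_1}\times\cdots\times P_{i_q})/B^q\to G/P$, $(b,[p_1,\dots,p_q])\mapsto bp_1\cdots p_qP$, is smooth. (2) Let $S\subseteq T$ be a subtorus of dimension $r$ and let $\beta_1,\dots,\beta_r$ be a positive basis of its weight lattice: the restriction to $S$ of every simple root is a combination of the $\beta_i$ with nonnegative integer coefficients. Let $m\ge 0$, let $E=(\mathbb C^{m+1}\smallsetminus 0)^r$, on which $s\in S$ acts by scaling the $i$-th factor by $\beta_i(s)$, and let $\mathbb P=E/S=(\mathbb P^m)^r$. For a variety $Y$ with a left action of $S$ let its mixing space be the bundle $(E\times Y)/S$ over $\mathbb P$, the quotient by the diagonal action; let $\mathcal X$ and $\widetilde{\mathcal X}^{\underline w}$ be the mixing spaces of $X=G/P$ and of $\widetilde X^{\underline w}$, and let $\widetilde{\mathcal X}^{\underline w}_J$ be the restriction of $\widetilde{\mathcal X}^{\underline w}$ to a product $\mathbb P_J\subseteq\mathbb P$ of nonempty projective linear subspaces of the factors. Let $\Gamma_0$ be the algebraic group of $S$-equivariant morphisms $f\colon E\to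 B$, where $S$ acts on $B$ by conjugation, $f(se)=sf(e)s^{-1}$ (equivalently, of the global sections of the group scheme $(E\times B)/S$ over $\mathbb P$). The group $GL_{m+1}(\mathbb C)^r$ acts on $E$ and on $\Gamma_0$, by $(\varphi\cdot f)(e)=f(\varphi^{-1}e)$, and $\Gamma_0\rtimes GL_{m+1}(\mathbb C)^r$ acts on $\mathcal X$ by $(f,\varphi)\cdot[e,x]=[\varphi e,f(\varphi e)x]$. The mixing group $\Gamma$ is the quotient of $\Gamma_0\rtimes GL_{m+1}(\mathbb C)^r$ by the central subgroup $S$, embedded by sending $s$ to the constant map $s$ together with the scalars $\beta_i(s)$; this subgroup acts trivially on $\mathcal X$, and $1\to\Gamma_0\to\Gamma\to PGL_{m+1}(\mathbb C)^r\to 1$ is exact. Then the action of $\Gamma$ on $\mathcal X$, composed with the map $\widetilde{\mathcal X}^{\underline w}_J\to\mathcal X$, gives a smooth morphism $\Gamma\times\widetilde{\mathcal X}^{\underline w}_J\to\mathcal X$, and the same holds with $\Gamma$ replaced by $\Gamma_0\rtimes GL_{m+1}(\mathbb C)^r$. -/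

import Mathlib

noncomputable section

namespace MixingSpace

open Filter Topology LieAlgebra.IsKilling

universe u v w

/-! ## Spaces with functions over the complex numbers -/

/-- The structure of a (locally ringed) space with functions over `ℂ` on the set `X`, the classical
language for complex varieties: a topology and a sheaf of `ℂ`-valued functions. `reg x` is the
algebra of functions that are regular in some neighbourhood of `x` (only the germ at `x` matters);
the regular functions on an open set `U` are the functions that lie in `reg x` for all `x ∈ U`. -/
structure FunStr (X : Type u) where
  top : TopologicalSpace X
  reg : X → Subalgebra ℂ (X → ℂ)
  congr_mem : ∀ {x f g}, f ∈ reg x → f =ᶠ[@nhds _ top x] g → g ∈ reg x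
  eventually_mem : ∀ {x f}, f ∈ reg x → ∀ᶠ y in @nhds _ top x, f ∈ reg y
  eventually_ne : ∀ {x f}, f ∈ reg x → f x ≠ 0 → ∀ᶠ y in @nhds _ top x, f y ≠ 0
  inv_mem : ∀ {x f}, f ∈ reg x → f x ≠ 0 → (fun y => (f y)⁻¹) ∈ reg x

namespace FunStr

variable {X : Type u} {Y : Type v} {Z : Type w}

/-- Morphisms: continuous maps that pull regular functions back to regular functions. -/
structure IsMorphism (a : FunStr X) (b : FunStr Y) (φ : X → Y) : Prop where
  continuous : Continuous[a.top, b.top] φ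
  comp_mem : ∀ x, ∀ f ∈ b.reg (φ x), f ∘ φ ∈ a.reg x

/-- The tangent space at `x`: the point derivations at `x` of the algebra of functions that are
regular near `x`. (A point derivation only depends on germs, because the indicator function of an
open neighbourhood of `x` is an idempotent of this algebra.) -/
def TangentSpace (a : FunStr X) (x : X) : Submodule ℂ (Module.Dual ℂ (a.reg x)) where
  carrier := {D | ∀ f g : a.reg x, D (f * g) = (f : X → ℂ) x * D g + (g : X → ℂ) x * D f}
  add_mem' {D E} hD hE f g := by
    simp only [LinearMap.add_apply, hD f g, hE f g]; ring
  zero_mem' f g := by simp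
  smul_mem' c D hD f g := by
    simp only [LinearMap.smul_apply, hD f g, smul_eq_mul]; ring

/-- Pull-back of functions along a morphism. -/
def IsMorphism.pullback {a : FunStr X} {b : FunStr Y} {φ : X → Y} (h : IsMorphism a b φ) (x : X) :
    b.reg (φ x) →ₗ[ℂ] a.reg x where
  toFun f := ⟨(f : Y → ℂ) ∘ φ, h.comp_mem x f f.2⟩
  map_add' _ _ := rfl
  map_smul' _ _ := rfl

/-- The differential of a morphism at a point. -/
def IsMorphism.differential {a : FunStr X} {b : FunStr Y} {φ : X → Y} (h : IsMorphism a b φ)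
    (x : X) : a.TangentSpace x →ₗ[ℂ] b.TangentSpace (φ x) :=
  LinearMap.codRestrict _ ((h.pullback x).dualMap ∘ₗ (a.TangentSpace x).subtype)
    (fun D f g => D.2 (h.pullback x f) (h.pullback x g))

/-- A map is smooth if it is a morphism whose differential is surjective at every point. -/
def IsSmooth (a : FunStr X) (b : FunStr Y) (φ : X → Y) : Prop :=
  ∃ h : IsMorphism a b φ, ∀ x, Function.Surjective (h.differential x)

/-- The pairs `(U, f)` generated, under the operations of a sheaf of local rings, by a family of
pairs that declares the set `U` to be open and the function `f` to be regular on `U`. -/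
inductive Gen (F : Set (Set Z × (Z → ℂ))) : Set Z → (Z → ℂ) → Prop
  | base {U f} : (U, f) ∈ F → Gen F U f
  | const (c : ℂ) : Gen F Set.univ (fun _ => c)
  | add {U V f g} : Gen F U f → Gen F V g → Gen F (U ∩ V) (f + g)
  | mul {U V f g} : Gen F U f → Gen F V g → Gen F (U ∩ V) (f * g)
  | inv {U f} : Gen F U f → Gen F (U ∩ {z | f z ≠ 0}) (fun z => (f z)⁻¹)

theorem Gen.inter {F : Set (Set Z × (Z → ℂ))} {U V f g} (h : Gen F U f) (h' : Gen F V g) :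
    Gen F (U ∩ V) f := by
  have := h.add ((Gen.const 0).mul h')
  rw [Set.univ_inter] at this
  convert this using 1
  ext z; simp

/-- The topology with basis the sets `U` of the generated pairs. -/
@[reducible] def genTop (F : Set (Set Z × (Z → ℂ))) : TopologicalSpace Z where
  IsOpen W := ∀ z ∈ W, ∃ U f, Gen F U f ∧ z ∈ U ∧ U ⊆ W
  isOpen_univ z _ := ⟨_, _, Gen.const 0, trivial, Set.subset_univ _⟩
  isOpen_inter W W' h h' z hz := by
    obtain ⟨U, f, hU, hzU, hUW⟩ := h z hz.1
    obtain ⟨V, g, hV, hzV, hVW⟩ := h' z hz.2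
    exact ⟨_, _, hU.add hV, ⟨hzU, hzV⟩, Set.inter_subset_inter hUW hVW⟩
  isOpen_sUnion S h z := by
    rintro ⟨W, hW, hz⟩
    obtain ⟨U, f, hU, hzU, hUW⟩ := h W hW z hz
    exact ⟨U, f, hU, hzU, hUW.trans (Set.subset_sUnion_of_mem hW)⟩

theorem Gen.mem_nhds {F : Set (Set Z × (Z → ℂ))} {U f} (h : Gen F U f) {z : Z} (hz : z ∈ U) :
    U ∈ @nhds _ (genTop F) z := by
  let _ := genTop F
  have hU : IsOpen U := fun _ hz => ⟨U, f, h, hz, subset_rfl⟩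
  exact hU.mem_nhds hz

theorem exists_gen_of_mem_nhds {F : Set (Set Z × (Z → ℂ))} {z : Z} {W : Set Z}
    (h : W ∈ @nhds _ (genTop F) z) : ∃ U f, Gen F U f ∧ z ∈ U ∧ U ⊆ W := by
  let _ := genTop F
  obtain ⟨V, hVW, hV, hz⟩ := _root_.mem_nhds_iff.1 h
  obtain ⟨U, f, hU, hzU, hUV⟩ := hV z hz
  exact ⟨U, f, hU, hzU, hUV.trans hVW⟩

/-- The coarsest structure of a space with functions on `Z` in which, for every pair `(U, f)` of
the family `F`, the set `U` is open and the function `f` is regular on `U`. -/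
def generate (F : Set (Set Z × (Z → ℂ))) : FunStr Z where
  top := genTop F
  reg z :=
    { carrier := {f | ∃ U g, Gen F U g ∧ z ∈ U ∧ Set.EqOn f g U}
      mul_mem' := by
        rintro a b ⟨U, f, hU, hz, hf⟩ ⟨V, g, hV, hz', hg⟩
        exact ⟨_, _, hU.mul hV, ⟨hz, hz'⟩, fun y hy => by simp [hf hy.1, hg hy.2]⟩
      add_mem' := by
        rintro a b ⟨U, f, hU, hz, hf⟩ ⟨V, g, hV, hz', hg⟩
        exact ⟨_, _, hU.add hV, ⟨hz, hz'⟩, fun y hy => by simp [hf hy.1, hg hy.2]⟩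
      algebraMap_mem' := fun c => ⟨_, _, Gen.const c, trivial, fun _ _ => rfl⟩ }
  congr_mem := by
    rintro z f g ⟨U, a, hU, hz, hf⟩ hfg
    obtain ⟨V, b, hV, hzV, hVW⟩ := exists_gen_of_mem_nhds hfg
    exact ⟨_, _, hU.inter hV, ⟨hz, hzV⟩, fun y hy => (hVW hy.2).symm.trans (hf hy.1)⟩
  eventually_mem := by
    rintro z f ⟨U, a, hU, hz, hf⟩
    exact Filter.mem_of_superset (hU.mem_nhds hz) fun y hy => ⟨U, a, hU, hy, hf⟩
  eventually_ne := by
    rintro z f ⟨U, a, hU, hz, hf⟩ h0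
    have hz' : z ∈ U ∩ {z | a z ≠ 0} := ⟨hz, by simpa [hf hz] using h0⟩
    exact Filter.mem_of_superset (hU.inv.mem_nhds hz') fun y hy => by
      simpa [hf hy.1] using hy.2
  inv_mem := by
    rintro z f ⟨U, a, hU, hz, hf⟩ h0
    exact ⟨_, _, hU.inv, ⟨hz, by simpa [hf hz] using h0⟩, fun y hy => by simp [hf hy.1]⟩

/-- A map into a generated structure is a morphism as soon as the generators pull back to regular
functions on open sets. -/
theorem isMorphism_generate {a : FunStr X} {F : Set (Set Z × (Z → ℂ))} {φ : X → Z}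
    (h : ∀ U f, (U, f) ∈ F → ∀ x, φ x ∈ U → φ ⁻¹' U ∈ @nhds _ a.top x ∧ f ∘ φ ∈ a.reg x) :
    IsMorphism a (generate F) φ := by
  have key : ∀ U f, Gen F U f → ∀ x, φ x ∈ U → φ ⁻¹' U ∈ @nhds _ a.top x ∧ f ∘ φ ∈ a.reg x := by
    intro U f hU
    induction hU with
    | base hF => exact h _ _ hF
    | const c => exact fun x _ => ⟨by simp, (a.reg x).algebraMap_mem c⟩
    | add _ _ ih ih' =>
      exact fun x hx => ⟨Filter.inter_mem (ih x hx.1).1 (ih' x hx.2).1,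
        (a.reg x).add_mem (ih x hx.1).2 (ih' x hx.2).2⟩
    | mul _ _ ih ih' =>
      exact fun x hx => ⟨Filter.inter_mem (ih x hx.1).1 (ih' x hx.2).1,
        (a.reg x).mul_mem (ih x hx.1).2 (ih' x hx.2).2⟩
    | inv _ ih =>
      exact fun x hx => ⟨Filter.inter_mem (ih x hx.1).1 (a.eventually_ne (ih x hx.1).2 hx.2),
        a.inv_mem (ih x hx.1).2 hx.2⟩
  refine ⟨?_, ?_⟩
  · let _ := a.top
    let _ := (generate F).top
    refine continuous_def.2 fun W hW => isOpen_iff_mem_nhds.2 fun x hx => ?_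
    obtain ⟨U, f, hU, hxU, hUW⟩ := hW (φ x) hx
    exact Filter.mem_of_superset (key U f hU x hxU).1 (Set.preimage_mono hUW)
  · rintro x f ⟨U, g, hU, hxU, hfg⟩
    refine a.congr_mem (key U g hU x hxU).2 ?_
    exact Filter.mem_of_superset (key U g hU x hxU).1 fun y hy => (hfg hy).symm

theorem IsMorphism.comp {a : FunStr X} {b : FunStr Y} {c : FunStr Z} {ψ : Y → Z} {φ : X → Y}
    (hψ : IsMorphism b c ψ) (hφ : IsMorphism a b φ) : IsMorphism a c (ψ ∘ φ) :=
  ⟨@Continuous.comp _ _ _ a.top b.top c.top _ _ hψ.continuous hφ.continuous,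
    fun x f hf => hφ.comp_mem x _ (hψ.comp_mem (φ x) f hf)⟩

/-- The structure on a set `Z` generated by globally defined functions: the Zariski topology and
the functions that are locally quotients of polynomials in the given functions. -/
def ofFunctions (F : Set (Z → ℂ)) : FunStr Z :=
  generate ((fun f => (Set.univ, f)) '' F)

theorem isMorphism_ofFunctions {a : FunStr X} {F : Set (Z → ℂ)} {φ : X → Z}
    (h : ∀ f ∈ F, ∀ x, f ∘ φ ∈ a.reg x) : IsMorphism a (ofFunctions F) φ := by
  refine isMorphism_generate ?_
  rintro U f ⟨f, hf, hUf⟩ x -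
  cases hUf
  exact ⟨by simp, h f hf x⟩

theorem mem_reg_ofFunctions {F : Set (Z → ℂ)} {f : Z → ℂ} (hf : f ∈ F) (z : Z) :
    f ∈ (ofFunctions F).reg z :=
  ⟨_, _, Gen.base ⟨f, hf, rfl⟩, trivial, fun _ _ => rfl⟩

/-- The pairs on `Z` obtained by pulling back along `φ` all open sets and regular functions. -/
def pull (a : FunStr X) (φ : Z → X) : Set (Set Z × (Z → ℂ)) :=
  {p | ∃ (U : Set X) (f : X → ℂ), IsOpen[a.top] U ∧ (∀ x ∈ U, f ∈ a.reg x) ∧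
    p = (φ ⁻¹' U, f ∘ φ)}

/-- The coarsest structure on `Z` for which all maps of a given family are morphisms. -/
def induced {κ : Type u} {X : κ → Type v} (a : ∀ k, FunStr (X k)) (φ : ∀ k, Z → X k) : FunStr Z :=
  generate (⋃ k, pull (a k) (φ k))

/-- The reduced structure on a subset (subvariety). -/
def sub (a : FunStr X) (s : Set X) : FunStr s :=
  generate (pull a Subtype.val)

/-- The product of two spaces with functions. -/
def prod (a : FunStr X) (b : FunStr Y) : FunStr (X × Y) :=
  generate (pull a Prod.fst ∪ pull b Prod.snd)

/-- The product of a family of spaces with functions. -/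
def pi {κ : Type u} {X : κ → Type v} (a : ∀ k, FunStr (X k)) : FunStr (∀ k, X k) :=
  induced a (fun k x => x k)

/-- The quotient by an equivalence relation: the quotient topology, with the functions whose
pull-back is regular. -/
def quot (a : FunStr X) (r : Setoid X) : FunStr (Quotient r) :=
  let _ := a.top
  { top := inferInstance
    reg := fun y =>
      { carrier := {f | ∀ᶠ z in 𝓝 y, ∀ x : X, Quotient.mk r x = z → f ∘ Quotient.mk r ∈ a.reg x}
        mul_mem' := fun ha hb => by
          filter_upwards [ha, hb] with z h h' x hx using (a.reg x).mul_mem (h x hx) (h' x hx)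
        add_mem' := fun ha hb => by
          filter_upwards [ha, hb] with z h h' x hx using (a.reg x).add_mem (h x hx) (h' x hx)
        algebraMap_mem' := fun c => Filter.Eventually.of_forall fun z x _ =>
          (a.reg x).algebraMap_mem c }
    congr_mem := by
      intro y f g hf hfg
      filter_upwards [hf, eventually_eventually_nhds.2 hfg] with z h h' x hx
      subst hx
      exact a.congr_mem (h x rfl) ((continuous_quotient_mk'.tendsto x).eventually h')
    eventually_mem := fun hf => eventually_eventually_nhds.2 hf
    eventually_ne := by
      intro y f hf h0
      obtain ⟨U, hU, hUo, hy⟩ := eventually_nhds_iff.1 hf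
      have : IsOpen (U ∩ {z | f z ≠ 0}) := by
        rw [← isQuotientMap_quotient_mk'.isOpen_preimage, isOpen_iff_mem_nhds]
        intro x hx
        exact Filter.inter_mem ((hUo.preimage continuous_quotient_mk').mem_nhds hx.1)
          (a.eventually_ne (hU _ hx.1 x rfl) hx.2)
      exact Filter.mem_of_superset (this.mem_nhds ⟨hy, h0⟩) fun z hz => hz.2
    inv_mem := by
      intro y f hf h0
      obtain ⟨U, hU, hUo, hy⟩ := eventually_nhds_iff.1 hf
      have : IsOpen (U ∩ {z | f z ≠ 0}) := by
        rw [← isQuotientMap_quotient_mk'.isOpen_preimage, isOpen_iff_mem_nhds]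
        intro x hx
        exact Filter.inter_mem ((hUo.preimage continuous_quotient_mk').mem_nhds hx.1)
          (a.eventually_ne (hU _ hx.1 x rfl) hx.2)
      filter_upwards [this.mem_nhds ⟨hy, h0⟩] with z hz x hx
      subst hx
      exact a.inv_mem (hU _ hz.1 x rfl) hz.2 }

end FunStr

open FunStr

/-! ## The semisimple group of adjoint type, its Borel subgroups and flag varieties -/

section LieTheory

variable (L : Type u) [LieRing L] [LieAlgebra ℂ L]

/-- The group of inner automorphisms of `L`, generated by the `exp (ad x)` with `ad x` nilpotent.
For semisimple `L` this is the identity component of the automorphism group of `L`, that is, the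
complex semisimple algebraic group of adjoint type with Lie algebra `L`. -/
def innerAut : Subgroup (L ≃ₗ[ℂ] L) :=
  Subgroup.closure {g | ∃ (x : L) (n : ℕ), LieAlgebra.ad ℂ L x ^ n = 0 ∧
    (g : L →ₗ[ℂ] L) = ∑ k ∈ Finset.range n, (k.factorial : ℂ)⁻¹ • LieAlgebra.ad ℂ L x ^ k}

variable {L} in
theorem innerAut_lie {g : L ≃ₗ[ℂ] L} (hg : g ∈ innerAut L) (x y : L) : g ⁅x, y⁆ = ⁅g x, g y⁆ := by
  induction hg using Subgroup.closure_induction generalizing x y with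
  | mem g hg =>
    obtain ⟨a, n, hn, hg⟩ := hg
    let _ : Module ℚ L := Module.compHom L (algebraMap ℚ ℂ)
    have hsmul : ∀ (c : ℚ) (z : L), c • z = (c : ℂ) • z := fun c z => rfl
    let _ : LieAlgebra ℚ L := ⟨fun c z w => by rw [hsmul, hsmul, lie_smul]⟩
    have h : IsNilpotent (LieDerivation.ad ℂ L a).toLinearMap := ⟨n, by
      rw [LieDerivation.coe_ad_apply_eq_ad_apply]; exact hn⟩
    have e : ∀ z, g z = LieDerivation.exp _ h z := fun z => by
      rw [LieDerivation.exp_map_apply]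
      have : (LieDerivation.ad ℂ L a).toLinearMap = LieAlgebra.ad ℂ L a :=
        LieDerivation.coe_ad_apply_eq_ad_apply a
      rw [this, IsNilpotent.exp_eq_sum hn]
      have hz : g z = (g : L →ₗ[ℂ] L) z := rfl
      rw [hz, hg, LinearMap.sum_apply, LinearMap.sum_apply]
      refine Finset.sum_congr rfl fun k _ => ?_
      rw [LinearMap.smul_apply, LinearMap.smul_apply, hsmul]
      simp
    rw [e, e, e, LieEquiv.map_lie]
  | one => rfl
  | mul g g' _ _ ih ih' =>
    change g (g' _) = ⁅g (g' _), g (g' _)⁆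
    rw [ih', ih]
  | inv g _ ih =>
    refine g.injective ?_
    have e : ∀ z, g (g⁻¹ z) = z := g.apply_symm_apply
    rw [ih, e, e, e]

/-- The adjoint group of `L`. -/
abbrev AdjointGroup : Type u := innerAut L

variable {L}

/-- The matrix coefficients of `g` and of `g⁻¹`. -/
def matrixCoeffs : Set (AdjointGroup L → ℂ) :=
  {f | ∃ (ξ : Module.Dual ℂ L) (x : L), f = fun g => ξ (g.1 x)} ∪
  {f | ∃ (ξ : Module.Dual ℂ L) (x : L), f = fun g => ξ ((g⁻¹).1 x)}

variable (L) in
/-- The adjoint group as a linear algebraic variety in `GL(L)`. -/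
def groupStr : FunStr (AdjointGroup L) := ofFunctions matrixCoeffs

/-- A subgroup of the adjoint group, as a subvariety. -/
def subgroupStr (K : Subgroup (AdjointGroup L)) : FunStr K :=
  (groupStr L).sub (K : Set (AdjointGroup L))

/-- The homogeneous space `G/P`. -/
def flagStr (P : Subgroup (AdjointGroup L)) : FunStr (AdjointGroup L ⧸ P) :=
  (groupStr L).quot (QuotientGroup.leftRel P)

/-- The stabilizer in the adjoint group of a subspace of `L`. -/
def stabilizer (V : Submodule ℂ L) : Subgroup (AdjointGroup L) where
  carrier := {g | ∀ x, g.1 x ∈ V ↔ x ∈ V}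
  mul_mem' {a b} ha hb x := (ha (b.1 x)).trans (hb x)
  one_mem' _ := Iff.rfl
  inv_mem' {a} ha x := by
    have e : a.1 ((a⁻¹).1 x) = x := by
      change (a * a⁻¹).1 x = x
      simp
    have := ha ((a⁻¹).1 x)
    rw [e] at this
    exact this.symm

variable (H : LieSubalgebra ℂ L)

/-- The maximal torus with Lie algebra the Cartan subalgebra `H`: the centralizer of `H`. -/
def torus : Subgroup (AdjointGroup L) where
  carrier := {g | ∀ h ∈ H, g.1 h = h}
  mul_mem' {a b} ha hb x hx := by
    change a.1 (b.1 x) = x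
    rw [hb x hx, ha x hx]
  one_mem' _ _ := rfl
  inv_mem' {a} ha x hx := by
    have e : (a⁻¹).1 (a.1 x) = x := by
      change (a⁻¹ * a).1 x = x
      simp
    rwa [ha x hx] at e

variable {H} [FiniteDimensional ℂ L] [LieAlgebra.IsKilling ℂ L] [H.IsCartanSubalgebra]
  (b : (rootSystem H).Base)

/-- The sum of `H` and of the root spaces of a set of roots. -/
def rootSum (s : Set H.root) : Submodule ℂ L :=
  H.toSubmodule ⊔ ⨆ α : H.root, ⨆ _ : α ∈ s,
    (LieAlgebra.rootSpace H (α : LieModule.Weight ℂ H L)).toSubmodule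

theorem torus_le_stabilizer (s : Set H.root) : torus H ≤ stabilizer (rootSum s) := by
  have key : ∀ g ∈ torus H, ∀ x ∈ rootSum s, g.1 x ∈ rootSum s := by
    intro g hg
    suffices h : rootSum s ≤ Submodule.comap (g.1 : L →ₗ[ℂ] L) (rootSum s) from fun x hx => h hx
    refine sup_le (fun x hx => ?_) (iSup₂_le fun α hα x hx => ?_)
    · refine Submodule.mem_sup_left ?_
      change g.1 x ∈ H
      rwa [hg x hx]
    · refine Submodule.mem_sup_right (Submodule.mem_iSup_of_mem α (Submodule.mem_iSup_of_mem hα ?_))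
      refine LieModule.weightSpace_le_genWeightSpace L _
        ((LieModule.mem_weightSpace _ _).2 fun h => ?_)
      have e : ⁅(h : L), x⁆ = (α : LieModule.Weight ℂ H L) h • x :=
        lie_eq_smul_of_mem_rootSpace hx h
      have e' := innerAut_lie g.2 (h : L) x
      rw [e, hg _ h.2, map_smul] at e'
      exact e'.symm
  refine fun g hg x => ⟨fun hx => ?_, key g hg x⟩
  have := key g⁻¹ ((torus H).inv_mem hg) _ hx
  have e : (g⁻¹).1 (g.1 x) = x := by
    change (g⁻¹ * g).1 x = x
    simp
  rwa [e] at this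

/-- The Borel subgroup `B`: the stabilizer of the Borel subalgebra, the sum of the Cartan subalgebra
and the positive root spaces. -/
def borelSubgroup : Subgroup (AdjointGroup L) := stabilizer (rootSum {α | b.IsPos α})

/-- The opposite Borel subgroup `B⁻`: the stabilizer of the sum of the Cartan subalgebra and the
negative root spaces. -/
def oppBorel : Subgroup (AdjointGroup L) := stabilizer (rootSum {α | ¬ b.IsPos α})

theorem torus_le_borel : torus H ≤ borelSubgroup b := torus_le_stabilizer {α | b.IsPos α}

theorem torus_le_oppBorel : torus H ≤ oppBorel b := torus_le_stabilizer {α | ¬ b.IsPos α}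

/-- A standard parabolic subgroup: a Zariski closed subgroup of `G` that contains `B`. -/
def IsParabolic (P : Subgroup (AdjointGroup L)) : Prop :=
  borelSubgroup b ≤ P ∧ IsClosed[(groupStr L).top] (P : Set (AdjointGroup L))

/-- `n` represents the longest element `w₀` of the Weyl group: it normalizes the torus, and
`B⁻ = n B n⁻¹`. -/
def IsLongest (n : AdjointGroup L) : Prop :=
  n ∈ Subgroup.normalizer (torus H : Set (AdjointGroup L)) ∧ ∀ k, k ∈ oppBorel b ↔ n⁻¹ * k * n ∈ borelSubgroup b

/-- The subgroup generated by `K` and the simple reflection `s_i` (that is, by `K` and the elements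
of the group that act on the Cartan subalgebra as `s_i`). For `K = B` and `K = B⁻` this is a minimal
parabolic subgroup. -/
def minParabolic (K : Subgroup (AdjointGroup L)) (i : b.support) : Subgroup (AdjointGroup L) :=
  K ⊔ Subgroup.closure {n | ∀ h : H, n.1 (h : L) = ((rootSystem H).coreflection i.1 h : H)}

end LieTheory

/-! ## Bott–Samelson varieties -/

section BottSamelson

variable {L : Type u} [LieRing L] [LieAlgebra ℂ L] {q : ℕ}
  (K : Subgroup (AdjointGroup L)) (Q : Fin q → Subgroup (AdjointGroup L))

/-- The equivalence relation on `Q 0 × ⋯ × Q (q-1)` given by the action of `K^q`,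
`(p 0, p 1, …) ∼ (p 0 * (k 1)⁻¹, k 1 * p 1 * (k 2)⁻¹, …)`. -/
def bsSetoid : Setoid (∀ j, Q j) where
  r p p' := ∃ k : Fin (q + 1) → AdjointGroup L, k 0 = 1 ∧ (∀ j, k j ∈ K) ∧
    ∀ j, (p' j : AdjointGroup L) = k j.castSucc * p j * (k j.succ)⁻¹
  iseqv :=
    { refl := fun p => ⟨fun _ => 1, rfl, fun _ => K.one_mem, fun j => by simp⟩
      symm := by
        rintro p p' ⟨k, h0, hk, h⟩
        refine ⟨fun j => (k j)⁻¹, by simp [h0], fun j => K.inv_mem (hk j), fun j => ?_⟩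
        rw [h j]; group
      trans := by
        rintro p p' p'' ⟨k, h0, hk, h⟩ ⟨k', h0', hk', h'⟩
        refine ⟨fun j => k' j * k j, by simp [h0, h0'], fun j => K.mul_mem (hk' j) (hk j),
          fun j => ?_⟩
        rw [h' j, h j]; group }

/-- The Bott–Samelson variety `(Q 0 × ⋯ × Q (q-1)) / K^q`. -/
def BottSamelson : Type u := Quotient (bsSetoid K Q)

/-- The Bott–Samelson variety as a space with functions. -/
def bsStr : FunStr (BottSamelson K Q) :=
  (FunStr.pi fun j => subgroupStr (Q j)).quot (bsSetoid K Q)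

/-- The product `p 0 * ⋯ * p (q-1)`. -/
def bsProd {Q : Fin q → Subgroup (AdjointGroup L)} (p : ∀ j, Q j) : AdjointGroup L :=
  (List.ofFn fun j => (p j : AdjointGroup L)).prod

theorem prod_ofFn_telescope {G : Type u} [Group G] : ∀ {q : ℕ} (k : Fin (q + 1) → G)
    (p : Fin q → G), (List.ofFn fun j => k j.castSucc * p j * (k j.succ)⁻¹).prod =
      k 0 * (List.ofFn p).prod * (k (Fin.last q))⁻¹
  | 0, k, p => by simp
  | q + 1, k, p => by
    have ih := prod_ofFn_telescope (fun j => k j.succ) (fun j => p j.succ)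
    rw [List.ofFn_succ, List.prod_cons, List.ofFn_succ, List.prod_cons]
    refine (congrArg _ ih).trans ?_
    simp [mul_assoc]

variable {K Q}

/-- The map `[p 0, …, p (q-1)] ↦ p 0 ⋯ p (q-1) n P` to `G/P`, for `n⁻¹ K n ⊆ P`. -/
def bsToFlag (n : AdjointGroup L) (P : Subgroup (AdjointGroup L))
    (hn : ∀ k ∈ K, n⁻¹ * k * n ∈ P) : BottSamelson K Q → AdjointGroup L ⧸ P :=
  Quotient.lift (fun p => ((bsProd p * n : AdjointGroup L) : AdjointGroup L ⧸ P)) (by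
    rintro p p' ⟨k, h0, hk, h⟩
    have e : bsProd p' = bsProd p * (k (Fin.last q))⁻¹ := by
      have := prod_ofFn_telescope k fun j => (p j : AdjointGroup L)
      rw [h0, one_mul] at this
      rw [bsProd, bsProd, ← this]
      exact congrArg List.prod (congrArg List.ofFn (funext h))
    refine QuotientGroup.eq.2 ?_
    have := hn _ (K.inv_mem (hk (Fin.last q)))
    rw [e]
    convert this using 1
    group)

/-- Left multiplication by an element of `K` on the product: it only changes the first factor. -/
def bsMul (hQ : ∀ j, K ≤ Q j) (a : K) (p : ∀ j, Q j) : ∀ j, Q j :=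
  fun j => (if j.val = 0 then ⟨a, hQ j a.2⟩ else 1) * p j

/-- The left action of `K` on the Bott–Samelson variety. -/
@[reducible] def bsAction (hQ : ∀ j, K ≤ Q j) : MulAction K (BottSamelson K Q) where
  smul a := Quotient.map (bsMul hQ a) (by
    rintro p p' ⟨k, h0, hk, h⟩
    refine ⟨k, h0, hk, fun j => ?_⟩
    by_cases hj : j.val = 0
    · have : j.castSucc = 0 := Fin.ext hj
      simp [bsMul, h j, hj, this, h0, mul_assoc]
    · simp [bsMul, h j, hj])
  one_smul y := by
    induction y using Quotient.inductionOn with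
    | h p =>
      refine congrArg (Quotient.mk _) (funext fun j => Subtype.ext ?_)
      by_cases hj : j.val = 0 <;> simp [bsMul, hj]
  mul_smul a c y := by
    induction y using Quotient.inductionOn with
    | h p =>
      refine congrArg (Quotient.mk _) (funext fun j => Subtype.ext ?_)
      by_cases hj : j.val = 0 <;> simp [bsMul, hj, mul_assoc]

theorem bsToFlag_smul (hQ : ∀ j, K ≤ Q j) (n : AdjointGroup L) (P : Subgroup (AdjointGroup L))
    (hn : ∀ k ∈ K, n⁻¹ * k * n ∈ P) (a : K) (y : BottSamelson K Q) :
    bsToFlag n P hn ((bsAction hQ).smul a y) = (a : AdjointGroup L) • bsToFlag n P hn y := by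
  induction y using Quotient.inductionOn with
  | h p =>
    change ((bsProd (bsMul hQ a p) * n : AdjointGroup L) : AdjointGroup L ⧸ P) =
      ((a * (bsProd p * n) : AdjointGroup L) : AdjointGroup L ⧸ P)
    cases q with
    | zero =>
      refine QuotientGroup.eq.2 ?_
      convert hn _ a.2 using 1
      simp [bsProd, mul_assoc]
    | succ q => simp [bsProd, bsMul, List.ofFn_succ, mul_assoc]

end BottSamelson

/-! ## Subtori, approximate mixing spaces -/

/-- The variety `(ℂ^(m+1) ∖ 0)^r`, on which the torus `(ℂˣ)^r` acts by scaling. -/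
structure ETotal (r m : ℕ) : Type where
  vec : Fin r → Fin (m + 1) → ℂ
  vec_ne : ∀ i, vec i ≠ 0

/-- `(ℂ^(m+1) ∖ 0)^r` as a variety, with its coordinate functions. -/
def eStr (r m : ℕ) : FunStr (ETotal r m) :=
  ofFunctions {f | ∃ i k, f = fun e => e.vec i k}

/-- The torus `(ℂˣ)^r` as a variety, with its coordinate functions. -/
def torusStr (r : ℕ) : FunStr (Fin r → ℂˣ) :=
  ofFunctions {f | ∃ i, f = fun t => (t i : ℂ)}

/-- `GL_(m+1)(ℂ)^r`. -/
abbrev GLPow (r m : ℕ) : Type := Fin r → GL (Fin (m + 1)) ℂ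

/-- `GL_(m+1)(ℂ)^r` as a variety: the matrix entries and the entries of the inverses. -/
def glStr (r m : ℕ) : FunStr (GLPow r m) :=
  ofFunctions ({f | ∃ i k l, f = fun φ => (φ i).1 k l} ∪
    {f | ∃ i k l, f = fun φ => ((φ i)⁻¹).1 k l})

theorem ETotal.ext' {r m : ℕ} {e e' : ETotal r m} (h : ∀ i, e.vec i = e'.vec i) : e = e' := by
  cases e; cases e'
  congr 1
  exact funext h

instance (r m : ℕ) : MulAction (Fin r → ℂˣ) (ETotal r m) where
  smul t e := ⟨fun i => (t i : ℂ) • e.vec i, fun i => smul_ne_zero (t i).ne_zero (e.vec_ne i)⟩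
  one_smul e := ETotal.ext' fun i => by
    change ((1 : ℂˣ) : ℂ) • e.vec i = e.vec i
    simp
  mul_smul t t' e := ETotal.ext' fun i => by
    change ((t i * t' i : ℂˣ) : ℂ) • e.vec i = (t i : ℂ) • (t' i : ℂ) • e.vec i
    rw [Units.val_mul, mul_smul]

instance (r m : ℕ) : MulAction (GLPow r m) (ETotal r m) where
  smul φ e := ⟨fun i => (φ i).1.mulVec (e.vec i), fun i h => e.vec_ne i (by
    have h : (φ i).1.mulVec (e.vec i) = 0 := h
    have : ((φ i)⁻¹).1.mulVec ((φ i).1.mulVec (e.vec i)) = 0 := by rw [h, Matrix.mulVec_zero]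
    rwa [Matrix.mulVec_mulVec, ← Units.val_mul, inv_mul_cancel, Units.val_one,
      Matrix.one_mulVec] at this)⟩
  one_smul e := ETotal.ext' fun i => by
    change (1 : Matrix (Fin (m + 1)) (Fin (m + 1)) ℂ).mulVec (e.vec i) = e.vec i
    simp
  mul_smul φ φ' e := ETotal.ext' fun i => by
    change ((φ i).1 * (φ' i).1).mulVec (e.vec i) = (φ i).1.mulVec ((φ' i).1.mulVec (e.vec i))
    rw [Matrix.mulVec_mulVec]

theorem torus_smul_vec {r m : ℕ} (t : Fin r → ℂˣ) (e : ETotal r m) (i : Fin r) :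
    (t • e).vec i = (t i : ℂ) • e.vec i := rfl

theorem gl_smul_vec {r m : ℕ} (φ : GLPow r m) (e : ETotal r m) (i : Fin r) :
    (φ • e).vec i = (φ i).1.mulVec (e.vec i) := rfl

theorem gl_smul_torus_smul {r m : ℕ} (φ : GLPow r m) (t : Fin r → ℂˣ) (e : ETotal r m) :
    φ • t • e = t • φ • e :=
  ETotal.ext' fun i => by simp only [torus_smul_vec, gl_smul_vec, Matrix.mulVec_smul]

/-- The scalar matrices `(ℂˣ)^r → GL_(m+1)(ℂ)^r`. -/
def scalarGL (r m : ℕ) : (Fin r → ℂˣ) →* GLPow r m where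
  toFun t i := Units.map (Matrix.scalar (Fin (m + 1)) (α := ℂ)).toMonoidHom (t i)
  map_one' := by funext i; simp
  map_mul' t t' := by funext i; simp

theorem scalarGL_smul {r m : ℕ} (t : Fin r → ℂˣ) (e : ETotal r m) :
    scalarGL r m t • e = t • e :=
  ETotal.ext' fun i => by
    rw [gl_smul_vec, torus_smul_vec]
    change (Matrix.scalar (Fin (m + 1)) (t i : ℂ)).mulVec (e.vec i) = _
    ext k
    simp [Matrix.scalar_apply, Matrix.mulVec_diagonal]

section Mixing

variable {L : Type u} [LieRing L] [LieAlgebra ℂ L]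

/-- A subtorus `S` of the maximal torus with Lie algebra `H`, with a basis `β_1, …, β_r` of its
weight lattice: the coordinates of an isomorphism of algebraic groups of `S` with `(ℂˣ)^r`. -/
structure Subtorus (H : LieSubalgebra ℂ L) (r : ℕ) where
  S : Subgroup (AdjointGroup L)
  le_torus : S ≤ torus H
  β : S ≃* (Fin r → ℂˣ)
  isMorphism : IsMorphism (subgroupStr S) (torusStr r) β
  isMorphism_symm : IsMorphism (torusStr r) (subgroupStr S) β.symm

/-- The basis is positive: every simple root restricts on `S` to a combination of `β_1, …, β_r` with
nonnegative integer coefficients. -/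
def Subtorus.IsPositive {H : LieSubalgebra ℂ L} [FiniteDimensional ℂ L] [LieAlgebra.IsKilling ℂ L]
    [H.IsCartanSubalgebra] {r : ℕ} (σ : Subtorus H r) (b : (rootSystem H).Base) : Prop :=
  ∀ α ∈ b.support, ∃ k : Fin r → ℕ, ∀ s : σ.S,
    ∀ x ∈ LieAlgebra.rootSpace H (α : LieModule.Weight ℂ H L),
      s.1.1 x = (∏ i, (σ.β s i : ℂ) ^ k i) • x

variable {H : LieSubalgebra ℂ L} {r : ℕ} (σ : Subtorus H r) (m : ℕ)
  {Y : Type v} {Y' : Type w} (ρ : σ.S →* Equiv.Perm Y) (ρ' : σ.S →* Equiv.Perm Y')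

/-- The equivalence relation of the diagonal action of `S` on `(ℂ^(m+1) ∖ 0)^r × Y`. -/
def mixSetoid : Setoid (ETotal r m × Y) where
  r z z' := ∃ s : σ.S, z' = (σ.β s • z.1, ρ s z.2)
  iseqv :=
    { refl := fun z => ⟨1, by simp⟩
      symm := by
        rintro z _ ⟨s, rfl⟩
        refine ⟨s⁻¹, ?_⟩
        simp
      trans := by
        rintro z _ _ ⟨s, rfl⟩ ⟨t, rfl⟩
        exact ⟨t * s, by simp [mul_smul]⟩ }

/-- The (approximate) mixing space `𝓨 = (ℂ^(m+1) ∖ 0)^r ×^S Y` of a space `Y` with an action of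
the torus `S`. -/
def Mix : Type v := Quotient (mixSetoid σ m ρ)

/-- The mixing space as a space with functions. -/
def mixStr (a : FunStr Y) : FunStr (Mix σ m ρ) :=
  ((eStr r m).prod a).quot (mixSetoid σ m ρ)

/-- The class `[e, y]` in the mixing space. -/
def Mix.mk (e : ETotal r m) (y : Y) : Mix σ m ρ := Quotient.mk (mixSetoid σ m ρ) (e, y)

/-- The part of the mixing space over the product of projective spaces `∏ i, ℙ(V i)`. -/
def mixOver (V : Fin r → Submodule ℂ (Fin (m + 1) → ℂ)) : Set (Mix σ m ρ) :=
  {z | ∃ (e : ETotal r m) (y : Y), (∀ i, e.vec i ∈ V i) ∧ z = Mix.mk σ m ρ e y}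

variable {ρ ρ'}

/-- The map of mixing spaces given by an `S`-equivariant map. -/
def mixMap (ψ : Y → Y') (hψ : ∀ s y, ψ (ρ s y) = ρ' s (ψ y)) : Mix σ m ρ → Mix σ m ρ' :=
  Quotient.map (fun z : ETotal r m × Y => (z.1, ψ z.2)) (by
    rintro z _ ⟨s, rfl⟩
    exact ⟨s, by simp only [hψ]⟩)

/-- `S` acting on `G/P` by left multiplication. -/
def flagRep (P : Subgroup (AdjointGroup L)) : σ.S →* Equiv.Perm (AdjointGroup L ⧸ P) :=
  (MulAction.toPermHom (AdjointGroup L) (AdjointGroup L ⧸ P)).comp σ.S.subtype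

/-- `S ⊆ K` acting on a Bott–Samelson variety by left multiplication. -/
def bsRep {q : ℕ} {K : Subgroup (AdjointGroup L)} {Q : Fin q → Subgroup (AdjointGroup L)}
    (hQ : ∀ j, K ≤ Q j) (hS : σ.S ≤ K) : σ.S →* Equiv.Perm (BottSamelson K Q) :=
  (@MulAction.toPermHom K (BottSamelson K Q) _ (bsAction hQ)).comp (Subgroup.inclusion hS)

/-! ## The mixing group -/

theorem isMorphism_gl_smul {r m : ℕ} (φ : GLPow r m) :
    IsMorphism (eStr r m) (eStr r m) (fun e => φ • e) := by
  refine isMorphism_ofFunctions ?_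
  intro f hf e
  obtain ⟨i, k, rfl⟩ := hf
  have : ((fun e : ETotal r m => e.vec i k) ∘ fun e : ETotal r m => φ • e) =
      ∑ l, (φ i).1 k l • fun e : ETotal r m => e.vec i l := by
    funext e
    simp [gl_smul_vec, Matrix.mulVec, dotProduct]
  rw [this]
  refine Subalgebra.sum_mem _ fun l _ => Subalgebra.smul_mem _ ?_ _
  exact mem_reg_ofFunctions (F := {f | ∃ i k, f = fun e : ETotal r m => e.vec i k}) ⟨i, l, rfl⟩ e

theorem isMorphism_const {X : Type v} {a : FunStr X} (g : AdjointGroup L) :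
    IsMorphism a (groupStr L) (fun _ => g) :=
  isMorphism_ofFunctions fun f _ x => (a.reg x).algebraMap_mem (f g)

theorem IsMorphism.coeff_mem {X : Type v} {a : FunStr X} {f : X → AdjointGroup L}
    (hf : IsMorphism a (groupStr L) f) (ξ : Module.Dual ℂ L) (v : L) (x : X) :
    (fun y => ξ ((f y).1 v)) ∈ a.reg x :=
  hf.comp_mem x (fun g => ξ (g.1 v)) (mem_reg_ofFunctions (Or.inl ⟨ξ, v, rfl⟩) (f x))

theorem isMorphism_inv {X : Type v} {a : FunStr X} {f : X → AdjointGroup L}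
    (hf : IsMorphism a (groupStr L) f) : IsMorphism a (groupStr L) (fun x => (f x)⁻¹) := by
  refine isMorphism_ofFunctions ?_
  rintro _ (⟨ξ, v, rfl⟩ | ⟨ξ, v, rfl⟩) x
  · exact hf.comp_mem x (fun g => ξ ((g⁻¹).1 v)) (mem_reg_ofFunctions (Or.inr ⟨ξ, v, rfl⟩) (f x))
  · have := IsMorphism.coeff_mem hf ξ v x
    simpa only [Function.comp_def, inv_inv] using this

theorem isMorphism_mul [FiniteDimensional ℂ L] {X : Type v} {a : FunStr X}
    {f f' : X → AdjointGroup L} (hf : IsMorphism a (groupStr L) f)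
    (hf' : IsMorphism a (groupStr L) f') : IsMorphism a (groupStr L) (fun x => f x * f' x) := by
  let c := Module.finBasis ℂ L
  have h2 : ∀ {f f' : X → AdjointGroup L}, IsMorphism a (groupStr L) f →
      IsMorphism a (groupStr L) f' →
      ∀ (ξ : Module.Dual ℂ L) (v : L) x, (fun y => ξ ((f y * f' y).1 v)) ∈ a.reg x := by
    intro f f' hf hf' ξ v x
    have : (fun y => ξ ((f y * f' y).1 v)) =
        ∑ k, (fun y => ξ ((f y).1 (c k))) * fun y => c.coord k ((f' y).1 v) := by
      funext y
      change ξ ((f y).1 ((f' y).1 v)) = _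
      conv_lhs => rw [← c.sum_repr ((f' y).1 v)]
      simp only [map_sum, map_smul, smul_eq_mul, Finset.sum_apply, Pi.mul_apply,
        Module.Basis.coord_apply]
      exact Finset.sum_congr rfl fun k _ => mul_comm _ _
    rw [this]
    exact Subalgebra.sum_mem _ fun k _ => Subalgebra.mul_mem _ (IsMorphism.coeff_mem hf ξ _ x)
      (IsMorphism.coeff_mem hf' (c.coord k) v x)
  refine isMorphism_ofFunctions ?_
  rintro _ (⟨ξ, v, rfl⟩ | ⟨ξ, v, rfl⟩) x
  · exact h2 hf hf' ξ v x
  · have := h2 (isMorphism_inv hf') (isMorphism_inv hf) ξ v x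
    simpa only [Function.comp_def, mul_inv_rev] using this

variable [FiniteDimensional ℂ L]

/-- The group of global sections over `ℙ` of the group scheme `(ℂ^(m+1) ∖ 0)^r ×^S K`, where `S`
acts on `K` by conjugation: the `S`-equivariant morphisms `(ℂ^(m+1) ∖ 0)^r → K`. -/
def sectionGroup (K : Subgroup (AdjointGroup L)) : Subgroup (ETotal r m → AdjointGroup L) where
  carrier := {f | (∀ e, f e ∈ K) ∧
    (∀ (s : σ.S) (e : ETotal r m), f (σ.β s • e) = s * f e * (s : AdjointGroup L)⁻¹) ∧
    IsMorphism (eStr r m) (groupStr L) f}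
  mul_mem' := by
    rintro f f' ⟨h1, h2, h3⟩ ⟨h1', h2', h3'⟩
    exact ⟨fun e => K.mul_mem (h1 e) (h1' e), fun s e => by simp [h2, h2', mul_assoc],
      isMorphism_mul h3 h3'⟩
  one_mem' := ⟨fun _ => K.one_mem, fun s e => by simp, isMorphism_const 1⟩
  inv_mem' := by
    rintro f ⟨h1, h2, h3⟩
    exact ⟨fun e => K.inv_mem (h1 e), fun s e => by simp [h2, mul_assoc], isMorphism_inv h3⟩

/-- The group of sections as a variety: the coarsest structure for which all evaluation maps to `G`
are morphisms. -/
def sectionStr (K : Subgroup (AdjointGroup L)) : FunStr (sectionGroup σ m K) :=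
  induced (fun _ : ETotal r m => groupStr L) (fun e f => f.1 e)

/-- `GL_(m+1)(ℂ)^r` acts on the group of sections by precomposition with the inverse. -/
def glAut (K : Subgroup (AdjointGroup L)) : GLPow r m →* MulAut (sectionGroup σ m K) where
  toFun φ :=
    { toFun := fun f => ⟨fun e => f.1 (φ⁻¹ • e), fun e => f.2.1 _, fun s e => by
        simp only [gl_smul_torus_smul, f.2.2.1], f.2.2.2.comp (isMorphism_gl_smul φ⁻¹)⟩
      invFun := fun f => ⟨fun e => f.1 (φ • e), fun e => f.2.1 _, fun s e => by
        simp only [gl_smul_torus_smul, f.2.2.1], f.2.2.2.comp (isMorphism_gl_smul φ)⟩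
      left_inv := fun f => Subtype.ext (funext fun e => by simp)
      right_inv := fun f => Subtype.ext (funext fun e => by simp)
      map_mul' := fun f f' => rfl }
  map_one' := by
    ext f e
    simp
  map_mul' φ φ' := by
    ext f e
    simp [mul_smul]

/-- The semidirect product of the group of sections of `(ℂ^(m+1) ∖ 0)^r ×^S K` by the group
`GL_(m+1)(ℂ)^r`, which covers `Aut(ℙ) = PGL_(m+1)(ℂ)^r`. -/
abbrev LinMixGroup (K : Subgroup (AdjointGroup L)) : Type u :=
  sectionGroup σ m K ⋊[glAut σ m K] GLPow r m

/-- The semidirect product as a variety: the product of its two factors. -/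
def linMixStr (K : Subgroup (AdjointGroup L)) : FunStr (LinMixGroup σ m K) :=
  generate (pull (sectionStr σ m K) SemidirectProduct.left ∪
    pull (glStr r m) SemidirectProduct.right)

/-- The action on the mixing space of `G/P`, `(f, φ) • [e, x] = [φ e, f(φ e) x]`. -/
instance (K P : Subgroup (AdjointGroup L)) :
    MulAction (LinMixGroup σ m K) (Mix σ m (flagRep σ P)) where
  smul γ := Quotient.map
    (fun z : ETotal r m × (AdjointGroup L ⧸ P) =>
      (γ.right • z.1, γ.left.1 (γ.right • z.1) • z.2)) (by
    rintro z _ ⟨s, rfl⟩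
    refine ⟨s, Prod.ext (gl_smul_torus_smul _ _ _) ?_⟩
    change γ.left.1 (γ.right • σ.β s • z.1) • (s : AdjointGroup L) • z.2 =
      (s : AdjointGroup L) • γ.left.1 (γ.right • z.1) • z.2
    rw [gl_smul_torus_smul, γ.left.2.2.1, smul_smul, smul_smul]
    simp)
  one_smul z := by
    induction z using Quotient.inductionOn with
    | h z =>
      refine congrArg (Quotient.mk _) (Prod.ext ?_ ?_)
      · simp
      · simp
  mul_smul γ γ' z := by
    induction z using Quotient.inductionOn with
    | h z =>
      refine congrArg (Quotient.mk _) (Prod.ext ?_ ?_)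
      · simp [mul_smul]
      · change ((γ * γ').left.1 ((γ * γ').right • z.1)) • z.2 =
          γ.left.1 (γ.right • γ'.right • z.1) • γ'.left.1 (γ'.right • z.1) • z.2
        simp [glAut, mul_smul]

/-- For `S ⊆ K`: the torus `S` inside the semidirect product, an element `s` being sent to the
constant section `s` together with the scalar matrices given by `s`. -/
def centralTorus (K : Subgroup (AdjointGroup L)) (hS : σ.S ≤ K) : σ.S →* LinMixGroup σ m K where
  toFun s := ⟨⟨fun _ => s, fun _ => hS s.2, fun t _ => by
      have h : t * s = s * t := σ.β.injective (by simp [mul_comm])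
      have h : (t : AdjointGroup L) * s = s * t := congrArg Subtype.val h
      rw [h]; group, isMorphism_const _⟩, scalarGL r m (σ.β s)⟩
  map_one' := SemidirectProduct.ext (Subtype.ext rfl) (by simp)
  map_mul' s t := SemidirectProduct.ext (Subtype.ext rfl) (by simp)

instance (K : Subgroup (AdjointGroup L)) (hS : σ.S ≤ K) :
    (centralTorus σ m K hS).range.Normal where
  conj_mem := by
    rintro _ ⟨s, rfl⟩ γ
    have h : γ * centralTorus σ m K hS s = centralTorus σ m K hS s * γ := by
      refine SemidirectProduct.ext (Subtype.ext (funext fun e => ?_)) ?_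
      · change γ.left.1 e * (s : AdjointGroup L) =
          s * γ.left.1 ((scalarGL r m (σ.β s))⁻¹ • e)
        rw [← map_inv, scalarGL_smul, ← map_inv, γ.left.2.2.1]
        simp [mul_assoc]
      · funext i
        refine Units.ext ?_
        change (γ.right i).1 * Matrix.scalar (Fin (m + 1)) (σ.β s i : ℂ) =
          Matrix.scalar (Fin (m + 1)) (σ.β s i : ℂ) * (γ.right i).1
        exact (Matrix.scalar_commute _ (fun _ => Commute.all _ _) _).symm.eq
    rw [h, mul_inv_cancel_right]
    exact ⟨s, rfl⟩

/-- The mixing group `Γ`: an extension of `Aut(ℙ) = GL_(m+1)(ℂ)^r / (ℂˣ)^r` by the group of sections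
of `(ℂ^(m+1) ∖ 0)^r ×^S K`. -/
abbrev MixGroup (K : Subgroup (AdjointGroup L)) (hS : σ.S ≤ K) : Type u :=
  LinMixGroup σ m K ⧸ (centralTorus σ m K hS).range

/-- The mixing group as a variety. -/
def mixGroupStr (K : Subgroup (AdjointGroup L)) (hS : σ.S ≤ K) : FunStr (MixGroup σ m K hS) :=
  (linMixStr σ m K).quot (QuotientGroup.leftRel (centralTorus σ m K hS).range)

/-- The action of the mixing group on the mixing space of `G/P`, as a homomorphism. -/
def mixGroupAction (K : Subgroup (AdjointGroup L)) (hS : σ.S ≤ K) (P : Subgroup (AdjointGroup L)) :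
    MixGroup σ m K hS →* Equiv.Perm (Mix σ m (flagRep σ P)) :=
  QuotientGroup.lift _ (MulAction.toPermHom (LinMixGroup σ m K) (Mix σ m (flagRep σ P))) (by
    rintro _ ⟨s, rfl⟩
    ext z
    induction z using Quotient.inductionOn with
    | h z =>
      refine Quotient.sound ((mixSetoid σ m (flagRep σ P)).symm ?_)
      refine ⟨s, Prod.ext (scalarGL_smul _ _) rfl⟩)

/-! ## The two multiplication maps -/

variable [LieAlgebra.IsKilling ℂ L] [H.IsCartanSubalgebra] (b : (rootSystem H).Base) {q : ℕ}
  (w : Fin q → b.support)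

/-- The minimal parabolic subgroups `P_{i_1}, …, P_{i_q}` of a word in the simple reflections. -/
def wordParabolic (j : Fin q) : Subgroup (AdjointGroup L) := minParabolic b (borelSubgroup b) (w j)

/-- The opposite minimal parabolic subgroups of a word in the simple reflections. -/
def oppWordParabolic (j : Fin q) : Subgroup (AdjointGroup L) := minParabolic b (oppBorel b) (w j)

theorem borel_le_wordParabolic (j : Fin q) : borelSubgroup b ≤ wordParabolic b w j := le_sup_left

theorem oppBorel_le_oppWordParabolic (j : Fin q) : oppBorel b ≤ oppWordParabolic b w j :=
  le_sup_left

variable {P : Subgroup (AdjointGroup L)} (hP : IsParabolic b P)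

/-- The map `(g, [p_1, …, p_q]) ↦ g p_1 ⋯ p_q P` from `B⁻ × (P_{i_1} × ⋯ × P_{i_q}) / B^q`
to `G/P`. -/
def multMap (z : oppBorel b × BottSamelson (borelSubgroup b) (wordParabolic b w)) : AdjointGroup L ⧸ P :=
  (z.1 : AdjointGroup L) • bsToFlag 1 P (fun k hk => hP.1 (by simpa using hk)) z.2

variable {b} {n : AdjointGroup L} (hn : IsLongest b n)

/-- The map `[p_1, …, p_q] ↦ p_1 ⋯ p_q w₀ P` from the opposite Bott–Samelson variety to `G/P`. -/
def oppBsToFlag : BottSamelson (oppBorel b) (oppWordParabolic b w) → AdjointGroup L ⧸ P :=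
  bsToFlag n P (fun k hk => hP.1 ((hn.2 k).1 hk))

/-- The action of `S` on the opposite Bott–Samelson variety. -/
def oppBsRep : σ.S →* Equiv.Perm (BottSamelson (oppBorel b) (oppWordParabolic b w)) :=
  bsRep σ (oppBorel_le_oppWordParabolic b w) (σ.le_torus.trans (torus_le_oppBorel b))

/-- The induced map from the mixing space of the opposite Bott–Samelson variety to the mixing space
of `G/P`. -/
def oppBsMix : Mix σ m (oppBsRep σ w) → Mix σ m (flagRep σ P) :=
  mixMap σ m (oppBsToFlag w hP hn) (fun s y =>
    bsToFlag_smul (oppBorel_le_oppWordParabolic b w) n P _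
      (Subgroup.inclusion (σ.le_torus.trans (torus_le_oppBorel b)) s) y)

/-- The opposite Bott–Samelson bundle restricted to the product of projective spaces
`∏ i, ℙ(V i)`. -/
abbrev OppBsBundle (V : Fin r → Submodule ℂ (Fin (m + 1) → ℂ)) :=
  mixOver σ m (oppBsRep σ w) V

/-- The restricted opposite Bott–Samelson bundle as a subvariety of the whole bundle. -/
def oppBsBundleStr (V : Fin r → Submodule ℂ (Fin (m + 1) → ℂ)) :
    FunStr (OppBsBundle σ m w V) :=
  (mixStr σ m (oppBsRep σ w)
    (bsStr (oppBorel b) (oppWordParabolic b w))).sub (mixOver σ m (oppBsRep σ w) V)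

end Mixing

end MixingSpace

end

open MixingSpace LieAlgebra.IsKilling

/-! Tangent vectors are point derivations of germs, so smoothness asks that every point derivation
downstairs be the push-forward of one upstairs. Almost all of these are produced as velocities of
explicit algebraic curves. Two facts about tangent spaces carry the argument.

The tangent space of the adjoint group at `1` is `L`: differentiating the identity `h[v,w] =
[hv,hw]` gives a derivation of `L`, and derivations are inner (`PDOn.exists_eq_ad`). It is spanned
by the velocities of root subgroups and of curves in the torus (`pd_induction`). Positive root
subgroups lie in `B`; the other root subgroups and the torus lie in `B⁻` (`reach_of_curves`).

The tangent space of `G/P` at `x` is the image of `L` under the differential of `g ↦ g • x`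
(`FunStr.PD.exists_lieDer`). Since `G/P` carries the quotient structure, this needs a proof. A
tangent vector `D` gives a derivation `f ↦ (g ↦ D(f(g ·)))` from germs at `x` to germs on `G`. In
characteristic zero it extends to the function field of `G`. Clearing denominators gives a vector
field on `G` that represents `D` up to a factor `s`. If `s` vanishes at `1`, one restricts to a
polynomial curve through `1`, divides by the common power of the parameter and takes a limit.

For (1), at `(b₀, y)` the positive root directions come from the left action of `B` on the
Bott–Samelson variety, and the remaining ones from moving `b₀` inside `B⁻` (`isSmooth_multMap`).

For (2), a tangent vector of the mixing space at `[e, x]` splits into a base part and a fibre part,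
since the bundle has local sections. `GL_(m+1)^r` moves the base in all directions. In the fibre,
the directions of `B⁻` come from its action on the opposite Bott–Samelson variety. A positive root
`α` restricts to `S` as a nonnegative combination of the `β_i`, so some monomial `F` of that
multidegree does not vanish at `e`; then `e' ↦ exp(t F(e') x)`, for a root vector `x` of `α`, is a
section of the Borel group scheme, and it gives the direction of `α` (`exists_section_curve`,
`isSmooth_linMix_smul`). Tangent vectors are then pushed forward to the quotient group `Γ`.

It remains to see that the maps are morphisms. For the action of `G` on `G/P`, functions on the
quotient are obtained from linear systems that are equivariant under `P` (`solve_mem`,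
`isMorphism_flag_smul`). For the evaluation of sections, their matrix entries in an eigenbasis are
homogeneous of fixed multidegree, hence lie in finite-dimensional spaces and can be interpolated
(`homogeneous_fg`, `exists_section_interpolation`). -/

noncomputable section
namespace MixingSpace
open Filter Topology LieAlgebra.IsKilling
universe u v w

open FunStr

/-! ### Morphisms at a point, generated structures and point derivations. -/

namespace FunStr

variable {X : Type*} {Y : Type*} {Z : Type*} {W : Type*}

/-- The local version of `IsMorphism`: continuity at `x` and pull-back of germs at `φ x`. -/
structure MorphAt (a : FunStr X) (b : FunStr Y) (φ : X → Y) (x : X) : Prop where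
  tendsto : Tendsto φ (@nhds _ a.top x) (@nhds _ b.top (φ x))
  comp_mem : ∀ f ∈ b.reg (φ x), f ∘ φ ∈ a.reg x

variable {a : FunStr X} {b : FunStr Y} {c : FunStr Z} {d : FunStr W}

/-- The topology is a field of `FunStr` and not an instance, so basic facts on neighbourhoods are
restated for `a.top`. -/
theorem eq_of_eventuallyEq {T : Type*} {f g : X → T} {x : X} (e : f =ᶠ[@nhds _ a.top x] g) :
    f x = g x :=
  let _ := a.top
  e.eq_of_nhds

theorem mem_nhds_of_isOpen {U : Set X} {x : X} (h : IsOpen[a.top] U) (hx : x ∈ U) :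
    U ∈ @nhds _ a.top x :=
  let _ := a.top
  h.mem_nhds hx

theorem exists_isOpen {V : Set X} {x : X} (h : V ∈ @nhds _ a.top x) :
    ∃ U ⊆ V, IsOpen[a.top] U ∧ x ∈ U :=
  let _ := a.top
  _root_.mem_nhds_iff.1 h

theorem IsMorphism.morphAt {φ : X → Y} (h : IsMorphism a b φ) (x : X) : MorphAt a b φ x :=
  ⟨@Continuous.tendsto _ _ a.top b.top _ h.continuous x, h.comp_mem x⟩

theorem IsMorphism.of_morphAt {φ : X → Y} (h : ∀ x, MorphAt a b φ x) : IsMorphism a b φ :=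
  ⟨(@continuous_iff_continuousAt _ _ a.top b.top _).2 fun x => (h x).tendsto,
    fun x => (h x).comp_mem⟩

theorem MorphAt.comp {ψ : Y → Z} {φ : X → Y} {x : X} (hψ : MorphAt b c ψ (φ x))
    (hφ : MorphAt a b φ x) : MorphAt a c (fun x => ψ (φ x)) x :=
  ⟨hψ.tendsto.comp hφ.tendsto, fun f hf => hφ.comp_mem _ (hψ.comp_mem f hf)⟩

theorem MorphAt.congr {φ ψ : X → Y} {x : X} (h : MorphAt a b φ x)
    (e : φ =ᶠ[@nhds _ a.top x] ψ) : MorphAt a b ψ x := by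
  have e0 : φ x = ψ x := eq_of_eventuallyEq e
  refine ⟨e0 ▸ h.tendsto.congr' e, fun f hf => ?_⟩
  exact a.congr_mem (h.comp_mem f (e0 ▸ hf)) (e.mono fun y hy => congrArg f hy)

theorem IsMorphism.comp_at {ψ : Y → Z} {φ : X → Y} {x : X} (hψ : IsMorphism b c ψ)
    (hφ : MorphAt a b φ x) : MorphAt a c (fun x => ψ (φ x)) x :=
  (hψ.morphAt (φ x)).comp hφ

theorem morphAt_id (x : X) : MorphAt a a (fun x => x) x := ⟨tendsto_id, fun _ hf => hf⟩

theorem morphAt_const (y : Y) (x : X) : MorphAt a b (fun _ => y) x :=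
  ⟨let _ := b.top; tendsto_const_nhds, fun f _ => (a.reg x).algebraMap_mem (f y)⟩

theorem const_mem (x : X) (z : ℂ) : (fun _ => z) ∈ a.reg x := (a.reg x).algebraMap_mem z

theorem morphAt_generate {F : Set (Set Z × (Z → ℂ))} {φ : X → Z} {x : X}
    (h : ∀ U f, (U, f) ∈ F → φ x ∈ U → φ ⁻¹' U ∈ @nhds _ a.top x ∧ f ∘ φ ∈ a.reg x) :
    MorphAt a (generate F) φ x := by
  have key : ∀ U f, Gen F U f → φ x ∈ U → φ ⁻¹' U ∈ @nhds _ a.top x ∧ f ∘ φ ∈ a.reg x := by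
    intro U f hU
    induction hU with
    | base hF => exact h _ _ hF
    | const c => exact fun _ => ⟨by simp, const_mem x c⟩
    | add _ _ ih ih' =>
      exact fun hx => ⟨Filter.inter_mem (ih hx.1).1 (ih' hx.2).1,
        (a.reg x).add_mem (ih hx.1).2 (ih' hx.2).2⟩
    | mul _ _ ih ih' =>
      exact fun hx => ⟨Filter.inter_mem (ih hx.1).1 (ih' hx.2).1,
        (a.reg x).mul_mem (ih hx.1).2 (ih' hx.2).2⟩
    | inv _ ih =>
      exact fun hx => ⟨Filter.inter_mem (ih hx.1).1 (a.eventually_ne (ih hx.1).2 hx.2),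
        a.inv_mem (ih hx.1).2 hx.2⟩
  refine ⟨fun V hV => ?_, ?_⟩
  · obtain ⟨U, f, hU, hxU, hUV⟩ := exists_gen_of_mem_nhds hV
    exact Filter.mem_of_superset (key U f hU hxU).1 (Set.preimage_mono hUV)
  · rintro f ⟨U, g, hU, hxU, hfg⟩
    refine a.congr_mem (key U g hU hxU).2 ?_
    exact Filter.mem_of_superset (key U g hU hxU).1 fun y hy => (hfg hy).symm

theorem morphAt_ofFunctions {F : Set (Z → ℂ)} {φ : X → Z} {x : X}
    (h : ∀ f ∈ F, f ∘ φ ∈ a.reg x) : MorphAt a (ofFunctions F) φ x := by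
  refine morphAt_generate ?_
  rintro U f ⟨f, hf, hUf⟩ -
  cases hUf
  exact ⟨by simp, h f hf⟩

theorem isMorphism_of_pull_subset {F : Set (Set Z × (Z → ℂ))} {φ : Z → X}
    (h : pull a φ ⊆ F) : IsMorphism (generate F) a φ := by
  refine .of_morphAt fun z => ⟨fun V hV => ?_, fun f hf => ?_⟩
  · let _ := a.top
    obtain ⟨U, hUV, hU, hz⟩ := _root_.mem_nhds_iff.1 hV
    -- A generator couples an open set with a function; to see that the preimage is open, the zero
    -- function serves as the companion.
    have hg : Gen F (φ ⁻¹' U) ((fun _ => 0) ∘ φ) :=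
      .base (h ⟨U, _, hU, fun x _ => const_mem x 0, rfl⟩)
    exact Filter.mem_of_superset (hg.mem_nhds hz) (Set.preimage_mono hUV)
  · obtain ⟨U, hUf, hU, hz⟩ := exists_isOpen (a.eventually_mem hf)
    exact ⟨_, _, .base (h ⟨U, f, hU, hUf, rfl⟩), hz, fun _ _ => rfl⟩

theorem MorphAt.of_mem_pull {φ : Z → Y} {ψ : X → Z} {x : X} (h : MorphAt a b (fun x => φ (ψ x)) x)
    {U : Set Z} {f : Z → ℂ} (hU : (U, f) ∈ pull b φ) (hx : ψ x ∈ U) :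
    ψ ⁻¹' U ∈ @nhds _ a.top x ∧ f ∘ ψ ∈ a.reg x := by
  obtain ⟨V, g, hV, hg, e⟩ := hU
  cases e
  exact ⟨h.tendsto (mem_nhds_of_isOpen hV hx), h.comp_mem g (hg _ hx)⟩

theorem isMorphism_fst : IsMorphism (a.prod b) a Prod.fst :=
  isMorphism_of_pull_subset Set.subset_union_left

theorem isMorphism_snd : IsMorphism (a.prod b) b Prod.snd :=
  isMorphism_of_pull_subset Set.subset_union_right

theorem MorphAt.prodMk {φ : X → Y} {ψ : X → Z} {x : X} (h : MorphAt a b φ x)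
    (h' : MorphAt a c ψ x) : MorphAt a (b.prod c) (fun x => (φ x, ψ x)) x := by
  refine morphAt_generate ?_
  rintro U f (hU | hU) hx
  · exact MorphAt.of_mem_pull (φ := Prod.fst) (ψ := fun x => (φ x, ψ x)) h hU hx
  · exact MorphAt.of_mem_pull (φ := Prod.snd) (ψ := fun x => (φ x, ψ x)) h' hU hx

theorem isMorphism_induced {κ : Type u} {X : κ → Type v} (a : ∀ k, FunStr (X k))
    (φ : ∀ k, Z → X k) (k : κ) : IsMorphism (induced a φ) (a k) (φ k) :=
  isMorphism_of_pull_subset (Set.subset_iUnion (fun k => pull (a k) (φ k)) k)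

theorem morphAt_induced {κ : Type u} {X' : κ → Type v} {b : ∀ k, FunStr (X' k)}
    {φ : ∀ k, Z → X' k} {ψ : X → Z} {x : X} (h : ∀ k, MorphAt a (b k) (fun x => φ k (ψ x)) x) :
    MorphAt a (induced b φ) ψ x := by
  refine morphAt_generate ?_
  intro U f hU hx
  obtain ⟨k, hk⟩ := Set.mem_iUnion.1 hU
  exact MorphAt.of_mem_pull (h k) hk hx

theorem isMorphism_pi_apply {κ : Type u} {X : κ → Type v} (a : ∀ k, FunStr (X k)) (k : κ) :
    IsMorphism (FunStr.pi a) (a k) (fun x => x k) :=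
  isMorphism_induced a (fun k (x : ∀ k, X k) => x k) k

theorem morphAt_pi {κ : Type u} {X' : κ → Type v} {b : ∀ k, FunStr (X' k)}
    {ψ : X → ∀ k, X' k} {x : X} (h : ∀ k, MorphAt a (b k) (fun x => ψ x k) x) :
    MorphAt a (FunStr.pi b) ψ x :=
  morphAt_induced h

theorem isMorphism_subtype_val (s : Set X) : IsMorphism (a.sub s) a Subtype.val :=
  isMorphism_of_pull_subset subset_rfl

theorem MorphAt.codRestrict {s : Set Y} {φ : X → s} {x : X}
    (h : MorphAt a b (fun x => (φ x : Y)) x) : MorphAt a (b.sub s) φ x :=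
  morphAt_generate fun _ _ hU hx => MorphAt.of_mem_pull h hU hx

/-! ### Quotients -/

theorem quot_mk_continuous (r : Setoid X) :
    @Continuous _ _ a.top (a.quot r).top (Quotient.mk r) :=
  @continuous_quotient_mk' _ a.top r

theorem quot_isOpen_iff {r : Setoid X} {U : Set (Quotient r)} :
    IsOpen[(a.quot r).top] U ↔ IsOpen[a.top] (Quotient.mk r ⁻¹' U) := Iff.rfl

theorem isMorphism_quot_mk (r : Setoid X) : IsMorphism a (a.quot r) (Quotient.mk r) := by
  refine ⟨quot_mk_continuous r, fun x f hf => ?_⟩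
  exact (@Filter.Eventually.self_of_nhds _ (a.quot r).top _ _ hf) x rfl

theorem mem_quot_reg {r : Setoid X} {f : Quotient r → ℂ} {x : X} {U : Set (Quotient r)}
    (hU : IsOpen[(a.quot r).top] U) (hx : Quotient.mk r x ∈ U)
    (h : ∀ y, Quotient.mk r y ∈ U → f ∘ Quotient.mk r ∈ a.reg y) :
    f ∈ (a.quot r).reg (Quotient.mk r x) := by
  refine Filter.mem_of_superset (mem_nhds_of_isOpen hU hx) ?_
  rintro z hz y rfl
  exact h y hz

/-- A function on a quotient is a morphism at a point if its pull-back is one on a saturated open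
neighbourhood. -/
theorem morphAt_quot {r : Setoid X} {φ : Quotient r → Y} {x : X} {U : Set (Quotient r)}
    (hU : IsOpen[(a.quot r).top] U) (hx : Quotient.mk r x ∈ U)
    (h : ∀ y, Quotient.mk r y ∈ U → MorphAt a b (fun y => φ (Quotient.mk r y)) y) :
    MorphAt (a.quot r) b φ (Quotient.mk r x) := by
  have pre : ∀ V : Set Y, IsOpen[b.top] V → IsOpen[(a.quot r).top] (U ∩ φ ⁻¹' V) := by
    intro V hV
    rw [quot_isOpen_iff]
    let _ := a.top
    rw [isOpen_iff_mem_nhds]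
    rintro y ⟨hy, hyV⟩
    refine Filter.inter_mem (mem_nhds_of_isOpen (quot_isOpen_iff.1 hU) hy) ?_
    exact (h y hy).tendsto (mem_nhds_of_isOpen hV hyV)
  refine ⟨fun V hV => ?_, fun f hf => ?_⟩
  · obtain ⟨V', hV', hVo, hxV⟩ := exists_isOpen hV
    have := mem_nhds_of_isOpen (pre V' hVo) ⟨hx, hxV⟩
    exact Filter.mem_map.2 (Filter.mem_of_superset this fun z hz => hV' hz.2)
  · obtain ⟨V, hV, hVo, hxV⟩ := exists_isOpen (b.eventually_mem hf)
    exact mem_quot_reg (pre V hVo) ⟨hx, hxV⟩ fun y hy =>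
      (h y hy.1).comp_mem f (hV hy.2)

theorem isMorphism_quot {r : Setoid X} {φ : Quotient r → Y}
    (h : IsMorphism a b (fun y => φ (Quotient.mk r y))) : IsMorphism (a.quot r) b φ :=
  .of_morphAt fun z => by
    induction z using Quotient.inductionOn with
    | h x => exact morphAt_quot (@isOpen_univ _ (a.quot r).top) trivial fun y _ => h.morphAt y

/-- A map that is constant on the classes in a saturated open set descends to the quotient. -/
theorem morphAt_comp_out {r : Setoid X} {N : X → Y} {x : X} {U : Set (Quotient r)}
    (hU : IsOpen[(a.quot r).top] U) (hx : Quotient.mk r x ∈ U)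
    (hN : ∀ y y', Quotient.mk r y ∈ U → r y y' → N y = N y')
    (h : ∀ y, Quotient.mk r y ∈ U → MorphAt a b N y) :
    MorphAt (a.quot r) b (fun z => N z.out) (Quotient.mk r x) := by
  refine morphAt_quot hU hx fun y hy => (h y hy).congr ?_
  refine Filter.mem_of_superset
    (mem_nhds_of_isOpen (quot_isOpen_iff.1 hU) hy) fun y' hy' => ?_
  exact hN _ _ hy' (r.symm (Quotient.mk_out y'))

/-! ### Structures generated by functions -/

/-- Fractions over principal open sets are closed under the generating operations: sums and products
use the product of the denominators, and the inverse of `p / s` is written `s² / (s p)`, so that its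
denominator vanishes exactly where `s` or the function does. -/
theorem exists_adjoin_of_gen {F : Set (Z → ℂ)} {U : Set Z} {g : Z → ℂ}
    (h : Gen ((fun f => (Set.univ, f)) '' F) U g) :
    ∃ p ∈ Algebra.adjoin ℂ F, ∃ s ∈ Algebra.adjoin ℂ F, U = {z | s z ≠ 0} ∧
      ∀ z, s z ≠ 0 → s z * g z = p z := by
  induction h with
  | base hF =>
    obtain ⟨f, hf, e⟩ := hF
    cases e
    exact ⟨_, Algebra.subset_adjoin hf, 1, one_mem _, by simp, by simp⟩
  | const c =>
    exact ⟨fun _ => c, (Algebra.adjoin ℂ F).algebraMap_mem c, 1, one_mem _, by simp, by simp⟩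
  | add _ _ ih ih' =>
    obtain ⟨p, hp, s, hs, rfl, h⟩ := ih
    obtain ⟨p', hp', s', hs', rfl, h'⟩ := ih'
    refine ⟨s' * p + s * p', add_mem (mul_mem hs' hp) (mul_mem hs hp'), s * s', mul_mem hs hs',
      ?_, fun z hz => ?_⟩
    · ext z; simp
    · simp only [Pi.mul_apply, ne_eq, mul_eq_zero, not_or] at hz
      simp only [Pi.mul_apply, Pi.add_apply, ← h z hz.1, ← h' z hz.2]; ring
  | mul _ _ ih ih' =>
    obtain ⟨p, hp, s, hs, rfl, h⟩ := ih
    obtain ⟨p', hp', s', hs', rfl, h'⟩ := ih'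
    refine ⟨p * p', mul_mem hp hp', s * s', mul_mem hs hs', ?_, fun z hz => ?_⟩
    · ext z; simp
    · simp only [Pi.mul_apply, ne_eq, mul_eq_zero, not_or] at hz
      simp only [Pi.mul_apply, ← h z hz.1, ← h' z hz.2]; ring
  | @inv _ f _ ih =>
    obtain ⟨p, hp, s, hs, rfl, h⟩ := ih
    refine ⟨s * s, mul_mem hs hs, s * p, mul_mem hs hp, ?_, fun z hz => ?_⟩
    · ext z
      simp only [Set.mem_inter_iff, Set.mem_ofPred_eq, Pi.mul_apply, ne_eq, mul_eq_zero, not_or]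
      refine and_congr_right fun hz => ?_
      rw [← h z hz]
      simp [hz]
    · simp only [Pi.mul_apply, ne_eq, mul_eq_zero, not_or] at hz ⊢
      have := h z hz.1
      have hg : f z ≠ 0 := fun h0 => hz.2 (by rw [← this, h0, mul_zero])
      rw [← this]
      field_simp

/-- A function that is regular at `z` in the structure generated by functions is a fraction; the
equation can be made to hold globally. -/
theorem exists_fraction {F : Set (Z → ℂ)} {f : Z → ℂ} {z : Z} (h : f ∈ (ofFunctions F).reg z) :
    ∃ p ∈ Algebra.adjoin ℂ F, ∃ s ∈ Algebra.adjoin ℂ F, s z ≠ 0 ∧ ∀ y, s y * f y = p y := by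
  obtain ⟨U, g, hU, hz, hfg⟩ := h
  obtain ⟨p, hp, s, hs, rfl, h⟩ := exists_adjoin_of_gen hU
  -- The extra factor `s` makes both sides vanish where `s` does, and there nothing is known about
  -- `f`.
  refine ⟨s * p, mul_mem hs hp, s * s, mul_mem hs hs, mul_ne_zero hz hz, fun y => ?_⟩
  by_cases hy : s y = 0
  · simp [hy]
  · rw [hfg hy, Pi.mul_apply, Pi.mul_apply, ← h y hy]; ring

theorem adjoin_le_reg {F : Set (Z → ℂ)} (z : Z) : Algebra.adjoin ℂ F ≤ (ofFunctions F).reg z :=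
  Algebra.adjoin_le fun _ hf => mem_reg_ofFunctions hf z

theorem mem_reg_of_fraction {f p s : X → ℂ} {x : X} (hp : p ∈ a.reg x)
    (hs : s ∈ a.reg x) (h0 : s x ≠ 0) (h : ∀ᶠ y in @nhds _ a.top x, s y * f y = p y) :
    f ∈ a.reg x := by
  refine a.congr_mem ((a.reg x).mul_mem hp (a.inv_mem hs h0)) ?_
  filter_upwards [h, a.eventually_ne hs h0] with y hy h0
  simp only [Pi.mul_apply]
  rw [← hy]; field_simp

/-! ### Point derivations as functionals -/

/-- `D` restricts to a point derivation at `x` of the functions that are regular near `x`. -/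
structure PD (a : FunStr X) (x : X) (D : (X → ℂ) → ℂ) : Prop where
  add : ∀ f ∈ a.reg x, ∀ g ∈ a.reg x, D (f + g) = D f + D g
  smul : ∀ (z : ℂ), ∀ f ∈ a.reg x, D (z • f) = z * D f
  mul : ∀ f ∈ a.reg x, ∀ g ∈ a.reg x, D (f * g) = f x * D g + g x * D f

namespace PD

variable {x : X} {D D' : (X → ℂ) → ℂ}

theorem const (h : PD a x D) (z : ℂ) : D (fun _ => z) = 0 := by
  have h1 := h.mul 1 (one_mem _) 1 (one_mem _)
  simp only [mul_one, Pi.one_apply, one_mul] at h1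
  have h2 := h.smul z 1 (one_mem _)
  have h3 : D 1 = 0 := by simpa using h1
  rw [h3, mul_zero] at h2
  rw [← h2]
  congr 1
  ext; simp

/-- The indicator `u` of the set where `f = g` is regular at `x` with value `1`, and `u * f = u *
g`; the Leibniz rule does the rest. -/
theorem congr (h : PD a x D) {f g : X → ℂ} (hf : f ∈ a.reg x) (e : f =ᶠ[@nhds _ a.top x] g) :
    D f = D g := by
  classical
  have hg : g ∈ a.reg x := a.congr_mem hf e
  let u : X → ℂ := fun y => if f y = g y then 1 else 0
  have hu : u ∈ a.reg x := a.congr_mem (const_mem x 1) (e.mono fun y hy => by simp [u, hy])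
  have e0 : f x = g x := eq_of_eventuallyEq e
  have ux : u x = 1 := by simp [u, e0]
  have h1 := h.mul u hu f hf
  have h2 := h.mul u hu g hg
  have : u * f = u * g := by
    ext y; by_cases hy : f y = g y <;> simp [u, hy]
  rw [this, h2, ux, e0] at h1
  linear_combination -h1

theorem inv (h : PD a x D) {f : X → ℂ} (hf : f ∈ a.reg x) (h0 : f x ≠ 0) :
    D (fun y => (f y)⁻¹) = -((f x)⁻¹ ^ 2 * D f) := by
  have h1 := h.mul f hf _ (a.inv_mem hf h0)
  have h2 : D (f * fun y => (f y)⁻¹) = 0 := by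
    rw [← h.const 1]
    refine h.congr ((a.reg x).mul_mem hf (a.inv_mem hf h0)) ?_
    filter_upwards [a.eventually_ne hf h0] with y hy
    simp [hy]
  rw [h2] at h1
  field_simp
  field_simp at h1
  linear_combination -h1

theorem push (h : PD a x D) {φ : X → Y} (hφ : MorphAt a b φ x) :
    PD b (φ x) (fun f => D (f ∘ φ)) :=
  ⟨fun f hf g hg => h.add _ (hφ.comp_mem f hf) _ (hφ.comp_mem g hg),
    fun z f hf => h.smul z _ (hφ.comp_mem f hf),
    fun f hf g hg => h.mul _ (hφ.comp_mem f hf) _ (hφ.comp_mem g hg)⟩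

theorem add' (h : PD a x D) (h' : PD a x D') : PD a x (fun f => D f + D' f) :=
  ⟨fun f hf g hg => by rw [h.add f hf g hg, h'.add f hf g hg]; ring,
    fun z f hf => by rw [h.smul z f hf, h'.smul z f hf]; ring,
    fun f hf g hg => by rw [h.mul f hf g hg, h'.mul f hf g hg]; ring⟩

theorem smul' (h : PD a x D) (c : ℂ) : PD a x (fun f => c * D f) :=
  ⟨fun f hf g hg => by rw [h.add f hf g hg]; ring,
    fun z f hf => by rw [h.smul z f hf]; ring,
    fun f hf g hg => by rw [h.mul f hf g hg]; ring⟩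

/-- Two point derivations of a generated structure that agree on the generators agree. -/
theorem ext_generate {F : Set (Set Z × (Z → ℂ))} {z : Z} {D D' : (Z → ℂ) → ℂ}
    (h : PD (generate F) z D) (h' : PD (generate F) z D')
    (e : ∀ U f, (U, f) ∈ F → z ∈ U → D f = D' f) : ∀ f ∈ (generate F).reg z, D f = D' f := by
  have mem : ∀ {U g}, Gen F U g → z ∈ U → g ∈ (generate F).reg z :=
    fun hU hz => ⟨_, _, hU, hz, fun _ _ => rfl⟩
  have key : ∀ U g, Gen F U g → z ∈ U → D g = D' g := by
    intro U g hU
    induction hU with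
    | base hF => exact e _ _ hF
    | const c => exact fun _ => by rw [h.const, h'.const]
    | add h1 h2 ih ih' =>
      exact fun hz => by
        rw [h.add _ (mem h1 hz.1) _ (mem h2 hz.2), h'.add _ (mem h1 hz.1) _ (mem h2 hz.2),
          ih hz.1, ih' hz.2]
    | mul h1 h2 ih ih' =>
      exact fun hz => by
        rw [h.mul _ (mem h1 hz.1) _ (mem h2 hz.2), h'.mul _ (mem h1 hz.1) _ (mem h2 hz.2),
          ih hz.1, ih' hz.2]
    | inv h1 ih =>
      exact fun hz => by rw [h.inv (mem h1 hz.1) hz.2, h'.inv (mem h1 hz.1) hz.2, ih hz.1]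
  intro f hf
  obtain ⟨U, g, hU, hz, hfg⟩ := id hf
  have ee : f =ᶠ[@nhds _ (generate F).top z] g :=
    Filter.mem_of_superset (hU.mem_nhds hz) fun y hy => hfg hy
  rw [h.congr hf ee, h'.congr hf ee, key U g hU hz]

theorem ext_ofFunctions {F : Set (Z → ℂ)} {z : Z} {D D' : (Z → ℂ) → ℂ}
    (h : PD (ofFunctions F) z D) (h' : PD (ofFunctions F) z D')
    (e : ∀ f ∈ F, D f = D' f) : ∀ f ∈ (ofFunctions F).reg z, D f = D' f := by
  refine ext_generate h h' ?_
  rintro U f ⟨f, hf, e'⟩ -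
  cases e'
  exact e f hf

/-- Both sides are point derivations, so they are compared on functions of one variable only; there
one of the two terms differentiates a constant. -/
theorem prod_eq {y : Y} {D : (X × Y → ℂ) → ℂ} (h : PD (a.prod b) (x, y) D) :
    ∀ f ∈ (a.prod b).reg (x, y), D f = D (fun z => f (z.1, y)) + D (fun z => f (x, z.2)) := by
  have m1 : MorphAt (a.prod b) (a.prod b) (fun z => (z.1, y)) (x, y) :=
    (isMorphism_fst.morphAt _).prodMk (morphAt_const _ _)
  have m2 : MorphAt (a.prod b) (a.prod b) (fun z => (x, z.2)) (x, y) :=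
    (morphAt_const _ _).prodMk (isMorphism_snd.morphAt _)
  refine ext_generate h ((h.push m1).add' (h.push m2)) ?_
  rintro U f (⟨V, g, -, -, e⟩ | ⟨V, g, -, -, e⟩) -
  · cases e
    change D _ = D _ + D fun _ => g x
    rw [h.const, add_zero]; rfl
  · cases e
    change D _ = (D fun _ => g y) + D _
    rw [h.const, zero_add]; rfl

/-- Differentiating a function on a product with respect to the second variable gives a regular
function of the first variable. -/
theorem partial_mem {y : Y} {D : (Y → ℂ) → ℂ} (h : PD b y D) {F : X × Y → ℂ}
    (hF : F ∈ (a.prod b).reg (x, y)) : (fun x' => D (fun y' => F (x', y'))) ∈ a.reg x := by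
  have i1 : ∀ x, MorphAt a (a.prod b) (fun x' => (x', y)) x :=
    fun x => (morphAt_id x).prodMk (morphAt_const _ _)
  have i2 : ∀ x, MorphAt b (a.prod b) (fun y' => (x, y')) y :=
    fun x => (morphAt_const _ _).prodMk (morphAt_id y)
  have mem : ∀ {U g x}, Gen (pull a Prod.fst ∪ pull b Prod.snd) U g → (x, y) ∈ U →
      g ∈ (a.prod b).reg (x, y) := fun hU hz => ⟨_, _, hU, hz, fun _ _ => rfl⟩
  have nh : ∀ {U g x}, Gen (pull a Prod.fst ∪ pull b Prod.snd) U g → (x, y) ∈ U →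
      ∀ᶠ x' in @nhds _ a.top x, (x', y) ∈ U := fun hU hz => (i1 _).tendsto (hU.mem_nhds hz)
  have m2 : ∀ {U g x}, Gen (pull a Prod.fst ∪ pull b Prod.snd) U g → (x, y) ∈ U →
      (fun y' => g (x, y')) ∈ b.reg y := fun hU hz => (i2 _).comp_mem _ (mem hU hz)
  have m1 : ∀ {U g x}, Gen (pull a Prod.fst ∪ pull b Prod.snd) U g → (x, y) ∈ U →
      (fun x' => g (x', y)) ∈ a.reg x := fun hU hz => (i1 _).comp_mem _ (mem hU hz)
  -- Sum, product and quotient rules. They are available only for `x'` near `x`, because `(x', y)`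
  -- has to stay in the open set of the generated pair.
  have key : ∀ U g, Gen (pull a Prod.fst ∪ pull b Prod.snd) U g → (x, y) ∈ U →
      (fun x' => D (fun y' => g (x', y'))) ∈ a.reg x := by
    intro U g hU
    induction hU with
    | base hF =>
      rcases hF with ⟨V, g, -, -, e⟩ | ⟨V, g, -, -, e⟩
      · cases e
        intro _
        change (fun x' => D fun _ => g x') ∈ _
        simp only [h.const]
        exact const_mem x 0
      · cases e
        exact fun _ => const_mem x (D g)
    | const c => exact fun _ => const_mem x _
    | add h1 h2 ih ih' =>
      intro hz
      refine a.congr_mem (add_mem (ih hz.1) (ih' hz.2)) ?_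
      filter_upwards [nh h1 hz.1, nh h2 hz.2] with x' hx1 hx2
      exact (h.add _ (m2 h1 hx1) _ (m2 h2 hx2)).symm
    | mul h1 h2 ih ih' =>
      intro hz
      refine a.congr_mem (add_mem (mul_mem (m1 h1 hz.1) (ih' hz.2))
        (mul_mem (m1 h2 hz.2) (ih hz.1))) ?_
      filter_upwards [nh h1 hz.1, nh h2 hz.2] with x' hx1 hx2
      exact (h.mul _ (m2 h1 hx1) _ (m2 h2 hx2)).symm
    | inv h1 ih =>
      intro hz
      have hi := a.inv_mem (m1 h1 hz.1) hz.2
      refine a.congr_mem (neg_mem (mul_mem (mul_mem hi hi) (ih hz.1))) ?_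
      filter_upwards [nh h1 hz.1, a.eventually_ne (m1 h1 hz.1) hz.2] with x' hx1 hx2
      refine Eq.trans ?_ (h.inv (m2 h1 hx1) hx2).symm
      simp [sq]
  obtain ⟨U, g, hU, hz, hfg⟩ := hF
  refine a.congr_mem (key U g hU hz) ?_
  filter_upwards [nh hU hz] with x' hx'
  refine h.congr (m2 hU hx') ?_
  exact Filter.mem_of_superset ((i2 x').tendsto (hU.mem_nhds hx')) fun y' hy' => (hfg hy').symm

end PD

/-- The point derivation `D` at `φ x` lies in the image of the differential of `φ` at `x`. -/
def Reach (a : FunStr X) (b : FunStr Y) (φ : X → Y) (x : X) (D : (Y → ℂ) → ℂ) : Prop :=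
  ∃ D', PD a x D' ∧ ∀ f ∈ b.reg (φ x), D' (f ∘ φ) = D f

theorem Reach.add {φ : X → Y} {x : X} {D D' : (Y → ℂ) → ℂ} (h : Reach a b φ x D)
    (h' : Reach a b φ x D') : Reach a b φ x (fun f => D f + D' f) := by
  obtain ⟨E, hE, e⟩ := h
  obtain ⟨E', hE', e'⟩ := h'
  exact ⟨_, hE.add' hE', fun f hf => by rw [e f hf, e' f hf]⟩

theorem Reach.smul {φ : X → Y} {x : X} {D : (Y → ℂ) → ℂ} (h : Reach a b φ x D) (c : ℂ) :
    Reach a b φ x (fun f => c * D f) := by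
  obtain ⟨E, hE, e⟩ := h
  exact ⟨_, hE.smul' c, fun f hf => by rw [e f hf]⟩

theorem Reach.congr {φ : X → Y} {x : X} {D D' : (Y → ℂ) → ℂ} (h : Reach a b φ x D)
    (e : ∀ f ∈ b.reg (φ x), D f = D' f) : Reach a b φ x D' := by
  obtain ⟨E, hE, e'⟩ := h
  exact ⟨_, hE, fun f hf => by rw [e' f hf, e f hf]⟩

/-- This and `reach_of_isSmooth` translate between dual vectors on the subalgebra of germs and
functionals on all functions, which are easier to compose. -/
theorem isSmooth_of_reach {φ : X → Y} (h : IsMorphism a b φ)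
    (hr : ∀ x D, PD b (φ x) D → Reach a b φ x D) : IsSmooth a b φ := by
  classical
  refine ⟨h, fun x D => ?_⟩
  -- The value `0` outside the regular functions is never used.
  let Dt : (Y → ℂ) → ℂ := fun f => if hf : f ∈ b.reg (φ x) then D.1 ⟨f, hf⟩ else 0
  have hDt : ∀ f (hf : f ∈ b.reg (φ x)), Dt f = D.1 ⟨f, hf⟩ := fun f hf => dif_pos hf
  have hPD : PD b (φ x) Dt := by
    refine ⟨fun f hf g hg => ?_, fun z f hf => ?_, fun f hf g hg => ?_⟩
    · rw [hDt _ hf, hDt _ hg, hDt _ (add_mem hf hg), ← map_add]; rfl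
    · rw [hDt _ hf, hDt _ (Subalgebra.smul_mem _ hf z), ← smul_eq_mul, ← map_smul]; rfl
    · rw [hDt _ hf, hDt _ hg, hDt _ (mul_mem hf hg)]
      exact D.2 ⟨f, hf⟩ ⟨g, hg⟩
  obtain ⟨E, hE, e⟩ := hr x Dt hPD
  refine ⟨⟨⟨⟨fun f => E f, fun f g => hE.add f f.2 g g.2⟩, fun z f => hE.smul z f f.2⟩,
    fun f g => hE.mul f f.2 g g.2⟩, ?_⟩
  refine Subtype.ext (LinearMap.ext fun f => ?_)
  exact (e f f.2).trans (hDt f f.2)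

theorem reach_of_isSmooth {φ : X → Y} (h : IsSmooth a b φ) (x : X) (D : (Y → ℂ) → ℂ)
    (hD : PD b (φ x) D) : Reach a b φ x D := by
  classical
  obtain ⟨hm, hs⟩ := h
  obtain ⟨E, hE⟩ := hs x ⟨⟨⟨fun f => D f, fun f g => hD.add f f.2 g g.2⟩,
    fun z f => hD.smul z f f.2⟩, fun f g => hD.mul f f.2 g g.2⟩
  refine ⟨fun f => if hf : f ∈ a.reg x then E.1 ⟨f, hf⟩ else 0, ?_, fun f hf => ?_⟩
  · refine ⟨fun f hf g hg => ?_, fun z f hf => ?_, fun f hf g hg => ?_⟩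
    · rw [dif_pos hf, dif_pos hg, dif_pos (add_mem hf hg), ← map_add]; rfl
    · rw [dif_pos hf, dif_pos (Subalgebra.smul_mem _ hf z), ← smul_eq_mul, ← map_smul]; rfl
    · rw [dif_pos hf, dif_pos hg, dif_pos (mul_mem hf hg)]
      exact E.2 ⟨f, hf⟩ ⟨g, hg⟩
  · refine (dif_pos (hm.comp_mem x f hf)).trans ?_
    exact LinearMap.congr_fun (congrArg Subtype.val hE) ⟨f, hf⟩

/-! ### The affine line and curves -/

/-- The affine line. -/
def line : FunStr ℂ := ofFunctions {fun t => t}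

theorem exists_polynomial_of_mem_adjoin {p : ℂ → ℂ}
    (h : p ∈ Algebra.adjoin ℂ {fun t : ℂ => t}) : ∃ P : Polynomial ℂ, ∀ t, p t = P.eval t := by
  induction h using Algebra.adjoin_induction with
  | mem f hf => cases hf; exact ⟨.X, by simp⟩
  | algebraMap c => exact ⟨.C c, by simp⟩
  | add f g _ _ h h' =>
    obtain ⟨P, hP⟩ := h
    obtain ⟨Q, hQ⟩ := h'
    exact ⟨P + Q, fun t => by simp [hP, hQ]⟩
  | mul f g _ _ h h' =>
    obtain ⟨P, hP⟩ := h
    obtain ⟨Q, hQ⟩ := h'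
    exact ⟨P * Q, fun t => by simp [hP, hQ]⟩

theorem exists_fraction_line {f : ℂ → ℂ} {z : ℂ} (h : f ∈ line.reg z) :
    ∃ P Q : Polynomial ℂ, Q.eval z ≠ 0 ∧ ∀ t, Q.eval t * f t = P.eval t := by
  obtain ⟨p, hp, s, hs, h0, h⟩ := exists_fraction h
  obtain ⟨P, hP⟩ := exists_polynomial_of_mem_adjoin hp
  obtain ⟨Q, hQ⟩ := exists_polynomial_of_mem_adjoin hs
  exact ⟨P, Q, by rwa [← hQ], fun t => by rw [← hP, ← hQ, h]⟩

theorem id_mem_line (z : ℂ) : (fun t : ℂ => t) ∈ line.reg z := mem_reg_ofFunctions (Set.mem_singleton _) z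

theorem eval_mem_line (P : Polynomial ℂ) (z : ℂ) : (fun t => P.eval t) ∈ line.reg z := by
  have : (fun t : ℂ => P.eval t) = Polynomial.aeval (fun t : ℂ => t) P := by
    funext t
    rw [Polynomial.aeval_eq_sum_range, Polynomial.eval_eq_sum_range]
    simp
  rw [this]
  exact Polynomial.aeval_mem_adjoin_singleton ℂ _ |> fun h =>
    Algebra.adjoin_le (Set.singleton_subset_iff.2 (id_mem_line z)) h

theorem differentiableAt_of_mem_line {f : ℂ → ℂ} {z : ℂ} (h : f ∈ line.reg z) :
    DifferentiableAt ℂ f z := by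
  obtain ⟨P, Q, h0, h⟩ := exists_fraction_line h
  have : DifferentiableAt ℂ (fun t => P.eval t / Q.eval t) z :=
    P.differentiable.differentiableAt.div Q.differentiable.differentiableAt h0
  refine this.congr_of_eventuallyEq ?_
  filter_upwards [Q.continuous.continuousAt.eventually_ne h0] with t ht
  rw [← h t]; field_simp

/-- Ordinary differentiation is a tangent vector of the line, so velocities of algebraic curves can
be found by calculus. -/
theorem pd_deriv (z : ℂ) : PD line z (fun f => deriv f z) :=
  ⟨fun f hf g hg => deriv_add (differentiableAt_of_mem_line hf) (differentiableAt_of_mem_line hg),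
    fun c f hf => deriv_const_smul c (differentiableAt_of_mem_line hf),
    fun f hf g hg => by
      rw [deriv_mul (differentiableAt_of_mem_line hf) (differentiableAt_of_mem_line hg)]; ring⟩

/-- A polynomial that is nonzero at `z` is nonzero on a Euclidean neighbourhood. Identities that
hold on Zariski open sets can therefore be differentiated and passed to the limit. -/
theorem nhds_line_le (z : ℂ) : 𝓝 z ≤ @nhds _ line.top z := by
  intro V hV
  obtain ⟨U, f, hU, hz, hUV⟩ := exists_gen_of_mem_nhds hV
  obtain ⟨p, hp, s, hs, rfl, h⟩ := exists_adjoin_of_gen hU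
  obtain ⟨Q, hQ⟩ := exists_polynomial_of_mem_adjoin hs
  refine Filter.mem_of_superset ?_ hUV
  have h0 : Q.eval z ≠ 0 := by rw [← hQ]; exact hz
  filter_upwards [Q.continuous.continuousAt.eventually_ne h0] with t ht
  rwa [hQ]

/-- The velocity of a curve. -/
theorem pd_curve {γ : ℂ → X} (h : MorphAt line a γ 0) :
    PD a (γ 0) (fun f => deriv (fun t => f (γ t)) 0) :=
  (pd_deriv 0).push h

theorem reach_curve {φ : X → Y} {γ : ℂ → X} {x : X} (h : MorphAt line a γ 0) (hx : γ 0 = x) :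
    Reach a b φ x (fun f => deriv (fun t => f (φ (γ t))) 0) := by
  subst hx
  exact ⟨_, pd_curve h, fun f _ => rfl⟩

end FunStr

/-! ### The adjoint group: exponentials, polynomial curves, coordinate ring. -/

section Group

/-! ### One-parameter unipotent subgroups -/

section NilExp

variable {M : Type*} [AddCommGroup M] [Module ℂ M]

/-- The exponential of `t • N` for a nilpotent endomorphism `N`. -/
def nilExp (N : Module.End ℂ M) (t : ℂ) : Module.End ℂ M :=
  ∑ k ∈ Finset.range (nilpotencyClass N), (t ^ k * (k.factorial : ℂ)⁻¹) • N ^ k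

theorem nilExp_eq {N : Module.End ℂ M} {n : ℕ} (h : N ^ n = 0) (t : ℂ) :
    nilExp N t = ∑ k ∈ Finset.range n, (t ^ k * (k.factorial : ℂ)⁻¹) • N ^ k := by
  have hc : nilpotencyClass N ≤ n := csInf_le' h
  refine Finset.sum_subset (Finset.range_mono hc) fun k _ hk => ?_
  rw [pow_eq_zero_of_le (by simpa using hk) (pow_nilpotencyClass ⟨n, h⟩), smul_zero]

theorem nilExp_apply {N : Module.End ℂ M} (hN : IsNilpotent N) {n : ℕ} {x : M}
    (h : (N ^ n) x = 0) (t : ℂ) :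
    nilExp N t x = ∑ k ∈ Finset.range n, (t ^ k * (k.factorial : ℂ)⁻¹) • (N ^ k) x := by
  have h0 : ∀ k, n ≤ k → (N ^ k) x = 0 := fun k hk => by
    obtain ⟨j, rfl⟩ := Nat.exists_eq_add_of_le' hk
    rw [pow_add, Module.End.mul_apply, h, map_zero]
  have hc : N ^ max n (nilpotencyClass N) = 0 :=
    pow_eq_zero_of_le (le_max_right _ _) (pow_nilpotencyClass hN)
  rw [nilExp_eq hc, LinearMap.sum_apply]
  refine (Finset.sum_subset (Finset.range_mono (le_max_left _ _)) fun k _ hk => ?_).symm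
  rw [LinearMap.smul_apply, h0 k (by simpa using hk), smul_zero]

theorem nilExp_add {N : Module.End ℂ M} (hN : IsNilpotent N) (s t : ℂ) :
    nilExp N (s + t) = nilExp N s * nilExp N t := by
  let _ : Module ℚ (Module.End ℂ M) := Module.compHom _ (algebraMap ℚ ℂ)
  have hsmul : ∀ (c : ℚ) (z : Module.End ℂ M), c • z = (c : ℂ) • z := fun c z => rfl
  have e : ∀ t, nilExp N t = IsNilpotent.exp (t • N) := fun t => by
    obtain ⟨n, hn⟩ := hN
    rw [nilExp_eq hn, IsNilpotent.exp_eq_sum (k := n) (by rw [smul_pow, hn, smul_zero])]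
    refine Finset.sum_congr rfl fun k _ => ?_
    rw [hsmul, smul_pow, smul_smul]
    simp [mul_comm]
  rw [e, e, e, add_smul, IsNilpotent.exp_add_of_commute]
  · exact ((Commute.refl N).smul_left s).smul_right t
  · exact hN.smul s
  · exact hN.smul t

theorem nilExp_zero {N : Module.End ℂ M} (hN : IsNilpotent N) : nilExp N 0 = 1 := by
  obtain ⟨n, hn⟩ := hN
  rw [nilExp_eq (n := n + 1) (by rw [pow_succ, hn, zero_mul]), Finset.sum_range_succ']
  simp

theorem exists_eval_nilExp (N : Module.End ℂ M) (ξ : Module.Dual ℂ M) (x : M) :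
    ∃ P : Polynomial ℂ, ∀ t, ξ (nilExp N t x) = P.eval t := by
  refine ⟨∑ k ∈ Finset.range (nilpotencyClass N),
    .monomial k ((k.factorial : ℂ)⁻¹ * ξ ((N ^ k) x)), fun t => ?_⟩
  rw [nilExp, LinearMap.sum_apply, map_sum, Polynomial.eval_finsetSum]
  refine Finset.sum_congr rfl fun k _ => ?_
  rw [LinearMap.smul_apply, map_smul, Polynomial.eval_monomial, smul_eq_mul]; ring

theorem hasDerivAt_nilExp {N : Module.End ℂ M} (hN : IsNilpotent N) (ξ : Module.Dual ℂ M) (x : M)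
    (t : ℂ) : HasDerivAt (fun t => ξ (nilExp N t x)) (ξ (N (nilExp N t x))) t := by
  have h0 : ∀ x, HasDerivAt (fun t => ξ (nilExp N t x)) (ξ (N x)) 0 := by
    intro x
    obtain ⟨n, hn⟩ := hN
    -- Two extra powers ensure that the terms `k = 0` and `k = 1` are present and can be split off.
    have hn' : N ^ (n + 2) = 0 := by rw [pow_add, hn, zero_mul]
    have e : (fun t => ξ (nilExp N t x)) = fun t => ∑ k ∈ Finset.range (n + 2),
        (t ^ k * (k.factorial : ℂ)⁻¹) * ξ ((N ^ k) x) := by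
      funext t
      rw [nilExp_eq hn', LinearMap.sum_apply, map_sum]
      simp
    rw [e]
    have hd : ∀ k ∈ Finset.range (n + 2), HasDerivAt (fun t : ℂ =>
        (t ^ k * (k.factorial : ℂ)⁻¹) * ξ ((N ^ k) x))
        (((k : ℂ) * 0 ^ (k - 1) * (k.factorial : ℂ)⁻¹) * ξ ((N ^ k) x)) 0 := fun k _ =>
      ((hasDerivAt_pow k (0 : ℂ)).mul_const _).mul_const _
    refine (HasDerivAt.fun_sum hd).congr_deriv ?_
    rw [Finset.sum_range_succ', Finset.sum_range_succ']
    simp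
  -- The law `exp(sN) = exp((s-t)N) exp(tN)` reduces the derivative at `t` to the one at `0`.
  have h1 := h0 (nilExp N t x)
  rw [← sub_self t] at h1
  have h2 := h1.comp_sub_const t t
  refine h2.congr_of_eventuallyEq (.of_forall fun s => ?_)
  change _ = ξ ((nilExp N (s - t) * nilExp N t) x)
  rw [← nilExp_add hN, sub_add_cancel]

end NilExp

variable {L : Type u} [LieRing L] [LieAlgebra ℂ L]

theorem val_mul (g g' : AdjointGroup L) (x : L) : (g * g').1 x = g.1 (g'.1 x) := rfl

theorem val_inv_val (g : AdjointGroup L) (x : L) : (g⁻¹).1 (g.1 x) = x := by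
  change (g⁻¹ * g).1 x = x
  simp

theorem val_val_inv (g : AdjointGroup L) (x : L) : g.1 ((g⁻¹).1 x) = x := by
  change (g * g⁻¹).1 x = x
  simp

theorem val_lie (g : AdjointGroup L) (x y : L) : g.1 ⁅x, y⁆ = ⁅g.1 x, g.1 y⁆ := innerAut_lie g.2 x y

theorem group_ext {g g' : AdjointGroup L} (h : ∀ x, g.1 x = g'.1 x) : g = g' :=
  Subtype.ext (LinearEquiv.ext h)

/-- The element `exp (t • ad x)` of the adjoint group. -/
def expAd (x : L) (hx : IsNilpotent (LieAlgebra.ad ℂ L x)) (t : ℂ) : AdjointGroup L :=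
  ⟨LinearEquiv.ofLinearMap (nilExp (LieAlgebra.ad ℂ L x) t) (nilExp (LieAlgebra.ad ℂ L x) (-t))
    (by
      have := nilExp_add hx t (-t)
      rw [add_neg_cancel, nilExp_zero hx] at this
      exact this.symm)
    (by
      have := nilExp_add hx (-t) t
      rw [neg_add_cancel, nilExp_zero hx] at this
      exact this.symm),
    Subgroup.subset_closure (by
      obtain ⟨n, hn⟩ := hx
      refine ⟨t • x, n, by rw [map_smul, smul_pow, hn, smul_zero], ?_⟩
      change nilExp (LieAlgebra.ad ℂ L x) t = _
      rw [nilExp_eq hn]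
      refine Finset.sum_congr rfl fun k _ => ?_
      rw [map_smul, smul_pow, smul_smul, mul_comm])⟩

theorem expAd_apply {x : L} (hx : IsNilpotent (LieAlgebra.ad ℂ L x)) (t : ℂ) (y : L) :
    (expAd x hx t).1 y = nilExp (LieAlgebra.ad ℂ L x) t y := rfl

theorem expAd_inv {x : L} (hx : IsNilpotent (LieAlgebra.ad ℂ L x)) (t : ℂ) :
    (expAd x hx t)⁻¹ = expAd x hx (-t) := by
  refine inv_eq_of_mul_eq_one_right (group_ext fun y => ?_)
  rw [val_mul, expAd_apply, expAd_apply, ← Module.End.mul_apply, ← nilExp_add hx, add_neg_cancel,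
    nilExp_zero hx]
  rfl

theorem expAd_zero {x : L} (hx : IsNilpotent (LieAlgebra.ad ℂ L x)) : expAd x hx 0 = 1 :=
  group_ext fun y => by rw [expAd_apply, nilExp_zero hx]; rfl

/-- Conjugation of a one-parameter subgroup. -/
theorem conj_expAd (g : AdjointGroup L) {x : L} (hx : IsNilpotent (LieAlgebra.ad ℂ L x)) {c : ℂ}
    (h : g.1 x = c • x) (t : ℂ) : g * expAd x hx t * g⁻¹ = expAd x hx (c * t) := by
  have key : ∀ (k : ℕ) y, g.1 ((LieAlgebra.ad ℂ L x ^ k) y) =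
      c ^ k • (LieAlgebra.ad ℂ L x ^ k) (g.1 y) := by
    intro k
    induction k with
    | zero => intro y; simp
    | succ k ih =>
      intro y
      rw [pow_succ, Module.End.mul_apply, ih, LieAlgebra.ad_apply, val_lie, h, Module.End.mul_apply,
        LieAlgebra.ad_apply, smul_lie, map_smul, smul_smul, pow_succ]
  refine group_ext fun y => ?_
  rw [val_mul, val_mul, expAd_apply, expAd_apply, nilExp, nilExp, LinearMap.sum_apply,
    LinearMap.sum_apply, map_sum]
  refine Finset.sum_congr rfl fun k _ => ?_
  rw [LinearMap.smul_apply, map_smul, key, val_val_inv, LinearMap.smul_apply, smul_smul, mul_pow]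
  congr 1
  ring

/-! ### Polynomial curves and irreducibility -/

/-- The regular functions on the adjoint group. -/
abbrev coordRing (L : Type u) [LieRing L] [LieAlgebra ℂ L] : Subalgebra ℂ (AdjointGroup L → ℂ) :=
  Algebra.adjoin ℂ matrixCoeffs

theorem coordRing_le_reg (g : AdjointGroup L) : coordRing L ≤ (groupStr L).reg g := adjoin_le_reg g

/-- Any element of the group is joined to the identity by a curve along which all regular functions
are polynomials. -/
theorem exists_polynomial_curve [FiniteDimensional ℂ L] (g : AdjointGroup L) :
    ∃ c : ℂ → AdjointGroup L, c 0 = 1 ∧ c 1 = g ∧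
      ∀ p ∈ coordRing L, ∃ P : Polynomial ℂ, ∀ t, p (c t) = P.eval t := by
  -- The coefficients of the inverse are carried along, because they are regular functions too and
  -- because the generation of the group involves inverses.
  suffices h : ∃ c : ℂ → AdjointGroup L, c 0 = 1 ∧ c 1 = g ∧
      (∀ (ξ : Module.Dual ℂ L) x, ∃ P : Polynomial ℂ, ∀ t, ξ ((c t).1 x) = P.eval t) ∧
      ∀ (ξ : Module.Dual ℂ L) x, ∃ P : Polynomial ℂ, ∀ t, ξ ((c t)⁻¹.1 x) = P.eval t by
    obtain ⟨c, h0, h1, hc, hc'⟩ := h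
    refine ⟨c, h0, h1, fun p hp => ?_⟩
    induction hp using Algebra.adjoin_induction with
    | mem f hf =>
      obtain ⟨ξ, x, rfl⟩ | ⟨ξ, x, rfl⟩ := hf
      · exact hc ξ x
      · exact hc' ξ x
    | algebraMap z => exact ⟨.C z, by simp⟩
    | add f g _ _ h h' =>
      obtain ⟨P, hP⟩ := h
      obtain ⟨Q, hQ⟩ := h'
      exact ⟨P + Q, fun t => by simp [hP, hQ]⟩
    | mul f g _ _ h h' =>
      obtain ⟨P, hP⟩ := h
      obtain ⟨Q, hQ⟩ := h'
      exact ⟨P * Q, fun t => by simp [hP, hQ]⟩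
  have hmul : ∀ a b : ℂ → AdjointGroup L,
      (∀ (ξ : Module.Dual ℂ L) x, ∃ P : Polynomial ℂ, ∀ t, ξ ((a t).1 x) = P.eval t) →
      (∀ (ξ : Module.Dual ℂ L) x, ∃ P : Polynomial ℂ, ∀ t, ξ ((b t).1 x) = P.eval t) →
      ∀ (ξ : Module.Dual ℂ L) x, ∃ P : Polynomial ℂ, ∀ t, ξ ((a t * b t).1 x) = P.eval t := by
    intro a b ha hb ξ x
    let c := Module.finBasis ℂ L
    choose P hP using fun k => ha ξ (c k)
    choose Q hQ using fun k => hb (c.coord k) x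
    refine ⟨∑ k, P k * Q k, fun t => ?_⟩
    rw [val_mul]
    conv_lhs => rw [← c.sum_repr ((b t).1 x)]
    simp only [map_sum, map_smul, smul_eq_mul, Polynomial.eval_finsetSum, Polynomial.eval_mul,
      ← hP, ← hQ, Module.Basis.coord_apply]
    exact Finset.sum_congr rfl fun k _ => mul_comm _ _
  obtain ⟨g, hg⟩ := g
  induction hg using Subgroup.closure_induction with
  | mem g hg =>
    obtain ⟨x, n, hn, h⟩ := hg
    have hx : IsNilpotent (LieAlgebra.ad ℂ L x) := ⟨n, hn⟩
    refine ⟨expAd x hx, expAd_zero hx, group_ext fun y => ?_, fun ξ y => ?_, fun ξ y => ?_⟩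
    · rw [expAd_apply, nilExp_eq hn]
      change _ = (g : L →ₗ[ℂ] L) y
      rw [h]; simp
    · exact exists_eval_nilExp _ ξ y
    · obtain ⟨P, hP⟩ := exists_eval_nilExp (LieAlgebra.ad ℂ L x) ξ y
      refine ⟨P.comp (-.X), fun t => ?_⟩
      rw [expAd_inv, expAd_apply, hP]; simp
  | one => exact ⟨fun _ => 1, rfl, rfl, fun ξ x => ⟨.C (ξ x), by simp⟩,
      fun ξ x => ⟨.C (ξ x), by simp⟩⟩
  | mul g g' hg hg' ih ih' =>
    obtain ⟨a, a0, a1, ha, ha'⟩ := ih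
    obtain ⟨b, b0, b1, hb, hb'⟩ := ih'
    refine ⟨fun t => a t * b t, by simp [a0, b0], by simp only [a1, b1]; rfl, hmul a b ha hb, fun ξ x => ?_⟩
    simp only [mul_inv_rev]
    exact hmul _ _ hb' ha' ξ x
  | inv g hg ih =>
    obtain ⟨a, a0, a1, ha, ha'⟩ := ih
    exact ⟨fun t => (a t)⁻¹, by simp [a0], by simp only [a1]; rfl, ha', by simpa using ha⟩

variable [FiniteDimensional ℂ L]

/-! ### The group operations are morphisms -/

theorem isMorphism_groupMul : IsMorphism ((groupStr L).prod (groupStr L)) (groupStr L)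
    (fun z => z.1 * z.2) :=
  isMorphism_mul isMorphism_fst isMorphism_snd

section Mul

variable {X : Type*} {a : FunStr X} {f f' : X → AdjointGroup L} {x : X}

theorem FunStr.MorphAt.gmul (h : MorphAt a (groupStr L) f x) (h' : MorphAt a (groupStr L) f' x) :
    MorphAt a (groupStr L) (fun x => f x * f' x) x :=
  (isMorphism_groupMul.comp_at (h.prodMk h') :)

end Mul

omit [FiniteDimensional ℂ L] in
theorem translate_left_mem {p : AdjointGroup L → ℂ} (hp : p ∈ coordRing L) (g : AdjointGroup L) :
    (fun h => p (g * h)) ∈ coordRing L := by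
  induction hp using Algebra.adjoin_induction with
  | mem f hf =>
    obtain ⟨ξ, x, rfl⟩ | ⟨ξ, x, rfl⟩ := hf
    · exact Algebra.subset_adjoin (Or.inl ⟨ξ.comp (g.1 : L →ₗ[ℂ] L), x, rfl⟩)
    · exact Algebra.subset_adjoin (Or.inr ⟨ξ, (g⁻¹).1 x, by simp⟩)
  | algebraMap z => exact (coordRing L).algebraMap_mem z
  | add _ _ _ _ h h' => exact add_mem h h'
  | mul _ _ _ _ h h' => exact mul_mem h h'

/-- Local finiteness of the regular representation: translating a matrix coefficient of `x` replaces
`x` by another vector of `L` (or `ξ` by another form, for inverse coefficients), and the spaces `W ⊔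
W'` and `W * W'` handle sums and products. It is used to separate the variables in `p (g * h)`. -/
theorem exists_finite_translates {p : AdjointGroup L → ℂ} (hp : p ∈ coordRing L) :
    ∃ W : Submodule ℂ (AdjointGroup L → ℂ), W.FG ∧ W ≤ (coordRing L).toSubmodule ∧
      ∀ h, (fun g => p (g * h)) ∈ W := by
  induction hp using Algebra.adjoin_induction with
  | mem f hf =>
    obtain ⟨ξ, x, rfl⟩ | ⟨ξ, x, rfl⟩ := hf
    · let φ : L →ₗ[ℂ] (AdjointGroup L → ℂ) := LinearMap.pi fun g => ξ.comp (g.1 : L →ₗ[ℂ] L)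
      refine ⟨LinearMap.range φ, ?_, ?_, fun h => ⟨h.1 x, rfl⟩⟩
      · exact Module.Finite.iff_fg.1 inferInstance
      · rintro _ ⟨y, rfl⟩
        exact Algebra.subset_adjoin (Or.inl ⟨ξ, y, rfl⟩)
    · let φ : Module.Dual ℂ L →ₗ[ℂ] (AdjointGroup L → ℂ) :=
        LinearMap.pi fun g => LinearMap.applyₗ ((g⁻¹).1 x)
      refine ⟨LinearMap.range φ, ?_, ?_, fun h => ⟨ξ.comp ((h⁻¹).1 : L →ₗ[ℂ] L), ?_⟩⟩
      · exact Module.Finite.iff_fg.1 inferInstance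
      · rintro _ ⟨y, rfl⟩
        exact Algebra.subset_adjoin (Or.inr ⟨y, x, rfl⟩)
      · funext g
        simp only [mul_inv_rev]
        rfl
  | algebraMap z =>
    refine ⟨Submodule.span ℂ {fun _ => z}, Submodule.fg_span (Set.finite_singleton _), ?_,
      fun h => Submodule.subset_span rfl⟩
    exact Submodule.span_le.2 (Set.singleton_subset_iff.2 ((coordRing L).algebraMap_mem z))
  | add f g _ _ h h' =>
    obtain ⟨W, h1, h2, h3⟩ := h
    obtain ⟨W', h1', h2', h3'⟩ := h'
    exact ⟨W ⊔ W', h1.sup h1', sup_le h2 h2', fun h => Submodule.add_mem_sup (h3 h) (h3' h)⟩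
  | mul f g _ _ h h' =>
    obtain ⟨W, h1, h2, h3⟩ := h
    obtain ⟨W', h1', h2', h3'⟩ := h'
    refine ⟨W * W', h1.mul h1', ?_, fun h => Submodule.mul_mem_mul (h3 h) (h3' h)⟩
    exact Submodule.mul_le.2 fun a ha b hb => (coordRing L).mul_mem (h2 ha) (h2' hb)

/-- The coordinate ring is a domain: the group is irreducible. -/
theorem coordRing_eq_zero {p q : AdjointGroup L → ℂ} (hp : p ∈ coordRing L) (hq : q ∈ coordRing L)
    (h : ∀ g, p g * q g = 0) : (∀ g, p g = 0) ∨ ∀ g, q g = 0 := by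
  by_contra! hne
  obtain ⟨⟨g, hg⟩, g', hg'⟩ := hne
  -- The curve `t ↦ g * c t` joins `g` to `g'`; along it `p` and `q` become polynomials in one
  -- variable with product zero.
  obtain ⟨c, h0, h1, hc⟩ := exists_polynomial_curve (g⁻¹ * g')
  obtain ⟨P, hP⟩ := hc _ (translate_left_mem hp g)
  obtain ⟨Q, hQ⟩ := hc _ (translate_left_mem hq g)
  have : P * Q = 0 := Polynomial.funext fun t => by
    rw [Polynomial.eval_mul, ← hP, ← hQ, h, Polynomial.eval_zero]
  rcases mul_eq_zero.1 this with h' | h'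
  · have := hP 0
    rw [h', h0, mul_one, Polynomial.eval_zero] at this
    exact hg this
  · have := hQ 1
    rw [h', h1, mul_inv_cancel_left, Polynomial.eval_zero] at this
    exact hg' this

end Group

/-! ### Interpolation in finite-dimensional spaces of functions. -/

/-- Interpolation: a finite-dimensional space of functions has a basis that is dual to the
evaluations at finitely many points. -/
theorem exists_interpolation {X : Type*} (W : Submodule ℂ (X → ℂ)) (hW : W.FG) :
    ∃ (n : ℕ) (z : Fin n → X) (c : Fin n → X → ℂ), (∀ i, c i ∈ W) ∧
      (∀ i j, c i (z j) = if i = j then 1 else 0) ∧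
      ∀ f ∈ W, ∀ x, f x = ∑ i, f (z i) * c i x := by
  have : FiniteDimensional ℂ W := Module.Finite.iff_fg.2 hW
  let ev : X → Module.Dual ℂ W := fun x => (LinearMap.proj x).comp W.subtype
  -- A function killed by all evaluations is zero, so the evaluations span the dual. A basis of the
  -- dual can be chosen among them, and `c` is the basis dual to it.
  have hspan : Submodule.span ℂ (Set.range ev) = ⊤ := by
    have : (Submodule.span ℂ (Set.range ev)).dualCoannihilator = ⊥ := by
      refine (Submodule.eq_bot_iff _).2 fun f hf => ?_
      rw [Submodule.mem_dualCoannihilator] at hf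
      exact Subtype.ext (funext fun x => hf _ (Submodule.subset_span ⟨x, rfl⟩))
    rw [← Subspace.dualCoannihilator_dualAnnihilator_eq (W := Submodule.span ℂ (Set.range ev)),
      this, Submodule.dualAnnihilator_bot]
  obtain ⟨s, hs, hspan', hli⟩ := exists_linearIndependent ℂ (Set.range ev)
  let b := Module.Basis.mk hli (by rw [Subtype.range_coe, hspan', hspan])
  have : Fintype s := FiniteDimensional.fintypeBasisIndex b
  let e := Fintype.equivFin s
  choose z hz using fun i : Fin (Fintype.card s) => hs (e.symm i).2
  let b' := b.reindex e
  have hb' : ∀ i, b' i = ev (z i) := fun i => by simp [b', b, hz]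
  let d := b'.dualBasis
  let c : Fin (Fintype.card s) → W := fun i => (Module.evalEquiv ℂ W).symm (d i)
  have hc : ∀ i (φ : Module.Dual ℂ W), φ (c i) = d i φ := fun i φ => by
    rw [← Module.apply_evalEquiv_symm_apply (R := ℂ) (M := W)]
  refine ⟨_, z, fun i => (c i : X → ℂ), fun i => (c i).2, fun i j => ?_, fun f hf x => ?_⟩
  · change ev (z j) (c i) = _
    rw [hc, ← hb', Module.Basis.dualBasis_apply_self]
    simp [eq_comm]
  · have h1 := LinearMap.congr_fun (b'.sum_repr (ev x)) ⟨f, hf⟩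
    rw [LinearMap.sum_apply] at h1
    refine h1.symm.trans (Finset.sum_congr rfl fun i _ => ?_)
    rw [hb', LinearMap.smul_apply, smul_eq_mul, mul_comm]
    congr 1
    exact ((hc i (ev x)).trans (Module.Basis.dualBasis_apply b' i (ev x))).symm

theorem det_mem {X : Type*} {S : Subalgebra ℂ (X → ℂ)} {n : ℕ} {A : X → Matrix (Fin n) (Fin n) ℂ}
    (hA : ∀ i j, (fun x => A x i j) ∈ S) : (fun x => (A x).det) ∈ S := by
  have : (fun x => (A x).det) = ∑ τ : Equiv.Perm (Fin n),
      ((Equiv.Perm.sign τ : ℤ) : ℂ) • ∏ i, fun x => A x (τ i) i := by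
    funext x
    simp [Matrix.det_apply']
  rw [this]
  exact sum_mem fun τ _ => Subalgebra.smul_mem _ (prod_mem fun i _ => hA _ _) _

/-! ### Regular functions on `G/P` and the action of `G`. -/

section Flag

variable {L : Type u} [LieRing L] [LieAlgebra ℂ L] [FiniteDimensional ℂ L]
  {P : Subgroup (AdjointGroup L)}

omit [FiniteDimensional ℂ L] in
theorem isMorphism_flag_mk : IsMorphism (groupStr L) (flagStr P)
    (fun g => (g : AdjointGroup L ⧸ P)) :=
  isMorphism_quot_mk _

omit [FiniteDimensional ℂ L] in
theorem exists_mul_eq_out (P : Subgroup (AdjointGroup L)) (h : AdjointGroup L) :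
    ∃ k : P, (Quotient.out (h : AdjointGroup L ⧸ P) : AdjointGroup L) = h * k :=
  QuotientGroup.mk_out_eq_mul P h

/-- Solving a linear system with `P`-equivariant coefficients gives functions on `G/P`. -/
theorem solve_mem {n : ℕ} {ρ : P → Matrix (Fin n) (Fin n) ℂ} (hρ : ∀ k, IsUnit (ρ k).det)
    {A : AdjointGroup L → Matrix (Fin n) (Fin n) ℂ} {y : AdjointGroup L → Fin n → ℂ}
    (hA : ∀ i j, (fun h => A h i j) ∈ coordRing L) (hy : ∀ i, (fun h => y h i) ∈ coordRing L)
    (hAk : ∀ h (k : P), A (h * k) = ρ k * A h)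
    (hyk : ∀ h (k : P), y (h * k) = (ρ k).mulVec (y h))
    (g₀ : AdjointGroup L) {h₀ : AdjointGroup L} (h0 : (A h₀).det ≠ 0) :
    ∃ C : Fin n → AdjointGroup L × (AdjointGroup L ⧸ P) → ℂ,
      (∀ (g h : AdjointGroup L) j, C j (g, (h : AdjointGroup L ⧸ P)) = ((A h)⁻¹.mulVec (y (g * h))) j) ∧
      ∀ j, C j ∈ ((groupStr L).prod (flagStr P)).reg (g₀, (h₀ : AdjointGroup L ⧸ P)) := by
  -- The choice of representative is harmless: passing from `h` to `h * k` multiplies both `A h` and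
  -- `y (g * h)` by `ρ k`, which cancels in the solution.
  let C : Fin n → AdjointGroup L × (AdjointGroup L ⧸ P) → ℂ :=
    fun j z => ((A z.2.out)⁻¹.mulVec (y (z.1 * z.2.out))) j
  have hC : ∀ (g h : AdjointGroup L) j, C j (g, (h : AdjointGroup L ⧸ P)) = ((A h)⁻¹.mulVec (y (g * h))) j := by
    intro g h j
    obtain ⟨k, hk⟩ := exists_mul_eq_out P h
    simp only [C, hk]
    rw [hAk, ← mul_assoc, hyk, Matrix.mul_inv_rev, Matrix.mulVec_mulVec, mul_assoc,
      Matrix.nonsing_inv_mul _ (hρ k), mul_one]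
  refine ⟨C, hC, fun j => ?_⟩
  -- For a fixed group element, Cramer's rule shows that the solution is a fraction with denominator
  -- `det (A h)`, whose nonvanishing is a condition on the coset.
  have hreg : ∀ z, (fun x => C j (z, x)) ∈ (flagStr P).reg (h₀ : AdjointGroup L ⧸ P) := by
    intro z
    let U : Set (AdjointGroup L ⧸ P) := {x | (A x.out).det ≠ 0}
    have hU : ∀ h : AdjointGroup L, (h : AdjointGroup L ⧸ P) ∈ U ↔ (A h).det ≠ 0 := by
      intro h
      obtain ⟨k, hk⟩ := exists_mul_eq_out P h
      simp only [U, Set.mem_ofPred_eq, hk]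
      rw [hAk, Matrix.det_mul]
      simp [(hρ k).ne_zero]
    have hUo : IsOpen[(flagStr P).top] U := by
      refine quot_isOpen_iff.2 ?_
      let _ := (groupStr L).top
      refine isOpen_iff_mem_nhds.2 fun h hh => ?_
      have := (groupStr L).eventually_ne (coordRing_le_reg h (det_mem hA)) ((hU h).1 hh)
      exact Filter.mem_of_superset this fun h' hh' => (hU h').2 hh'
    refine mem_quot_reg hUo ((hU h₀).2 h0) fun h hh => ?_
    have e : ((fun x => C j (z, x)) ∘ Quotient.mk (QuotientGroup.leftRel P)) =
        fun h => ((A h)⁻¹.mulVec (y (z * h))) j := funext fun h => hC z h j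
    rw [e]
    refine mem_reg_of_fraction (p := fun h => ((A h).updateCol j (y (z * h))).det)
      (s := fun h => (A h).det) ?_ (coordRing_le_reg h (det_mem hA)) ((hU h).1 hh)
      ?_
    · refine coordRing_le_reg h (det_mem fun i l => ?_)
      by_cases hl : l = j
      · simpa [hl] using translate_left_mem (hy i) z
      · simpa [Matrix.updateCol_apply, hl] using hA i l
    · filter_upwards [(groupStr L).eventually_ne (coordRing_le_reg h (det_mem hA)) ((hU h).1 hh)]
        with h hd
      have := congrFun (Matrix.det_smul_inv_mulVec_eq_cramer (A h) (y (z * h))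
        (isUnit_iff_ne_zero.2 hd)) j
      rw [Matrix.cramer_apply] at this
      exact this
  -- Joint regularity: `y (g * h)` is a finite sum of products of functions of `g` with translates
  -- `y (z l * h)`, so the solution is a finite sum of products of regular functions on the two
  -- factors.
  choose W hfg hle hW using fun i => exists_finite_translates (hy i)
  obtain ⟨N, z, c, hc, -, hint⟩ := exists_interpolation (⨆ i, W i)
    (Submodule.fg_iSup _ hfg)
  have hexp : ∀ g h i, y (g * h) i = ∑ l, y (z l * h) i * c l g := fun g h i =>
    hint _ (Submodule.mem_iSup_of_mem i (hW i h)) g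
  have e : C j = ∑ l, (c l ∘ Prod.fst) * ((fun x => C j (z l, x)) ∘ Prod.snd) := by
    funext x
    obtain ⟨g, x⟩ := x
    induction x using QuotientGroup.induction_on with
    | H h =>
      simp only [Finset.sum_apply, Pi.mul_apply, Function.comp, hC]
      have : y (g * h) = ∑ l, c l g • y (z l * h) := by
        funext i
        rw [hexp]
        simp [mul_comm]
      rw [this, Matrix.mulVec_sum, Finset.sum_apply]
      refine Finset.sum_congr rfl fun l _ => ?_
      rw [Matrix.mulVec_smul]; rfl
  rw [e]
  refine sum_mem fun l _ => mul_mem ?_ ?_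
  · refine isMorphism_fst.comp_mem (g₀, (h₀ : AdjointGroup L ⧸ P)) _ (coordRing_le_reg g₀ ?_)
    exact (iSup_le hle : (⨆ i, W i) ≤ (coordRing L).toSubmodule) (hc l)
  · exact isMorphism_snd.comp_mem (g₀, (h₀ : AdjointGroup L ⧸ P)) _ (hreg (z l))

/-- The right translates of `s` by `P` generate a finite-dimensional equivariant system. -/
theorem exists_equivariant_system (P : Subgroup (AdjointGroup L)) {s : AdjointGroup L → ℂ}
    (hs : s ∈ coordRing L) :
    ∃ (n : ℕ) (q : AdjointGroup L → Fin n → ℂ) (z : Fin n → AdjointGroup L)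
      (ρ : P → Matrix (Fin n) (Fin n) ℂ),
      (∀ i, (fun h => q h i) ∈ Submodule.span ℂ (Set.range fun (k : P) h => s (h * k))) ∧
      (∀ i, (fun h => q h i) ∈ coordRing L) ∧ (∀ i j, q (z j) i = if i = j then 1 else 0) ∧
      (∀ k, IsUnit (ρ k).det) ∧ (∀ h (k : P), q (h * k) = (ρ k).mulVec (q h)) ∧
      ∀ h, s h ≠ 0 → q h ≠ 0 := by
  obtain ⟨W, hfg, hle, hW⟩ := exists_finite_translates hs
  have hQW : Submodule.span ℂ (Set.range fun (k : P) h => s (h * k)) ≤ W :=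
    Submodule.span_le.2 (Set.range_subset_iff.2 fun k => hW k)
  have hQ : (Submodule.span ℂ (Set.range fun (k : P) h => s (h * k))).FG := by
    have : FiniteDimensional ℂ W := Module.Finite.iff_fg.2 hfg
    have := Submodule.finiteDimensional_of_le hQW
    exact Module.Finite.iff_fg.1 this
  have hinv : ∀ f ∈ Submodule.span ℂ (Set.range fun (k : P) h => s (h * k)), ∀ k : P,
      (fun h => f (h * k)) ∈ Submodule.span ℂ (Set.range fun (k : P) h => s (h * k)) := by
    intro f hf k
    induction hf using Submodule.span_induction with
    | mem f hf =>
      obtain ⟨k', rfl⟩ := hf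
      exact Submodule.subset_span ⟨k * k', by funext h; simp [mul_assoc]⟩
    | zero => exact zero_mem _
    | add _ _ _ _ h h' => exact add_mem h h'
    | smul c _ _ h => exact Submodule.smul_mem _ c h
  obtain ⟨n, z, c, hc, hcz, hint⟩ := exists_interpolation _ hQ
  -- The matrix of right translation by `k` in the interpolating basis. It reverses products
  -- (`hmul`), which still makes every `ρ k` invertible.
  let ρ : P → Matrix (Fin n) (Fin n) ℂ := fun k => .of fun i j => c i (z j * k)
  have hρ : ∀ h (k : P), (fun i => c i (h * k)) = (ρ k).mulVec (fun i => c i h) :=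
    fun h k => funext fun i => hint _ (hinv _ (hc i) k) h
  have hmul : ∀ k k', ρ (k * k') = ρ k' * ρ k := by
    intro k k'
    ext i j
    rw [Matrix.mul_apply]
    have := congrFun (hρ (z j * k) k') i
    simpa [ρ, mul_assoc, Matrix.mulVec, dotProduct] using this
  have hone : ρ 1 = 1 := by
    ext i j
    simp [ρ, hcz, Matrix.one_apply]
  refine ⟨n, fun h i => c i h, z, ρ, hc, fun i => hle (hQW (hc i)), fun i j => hcz i j, fun k => ?_,
    hρ, fun h hs h0 => hs ?_⟩
  · rw [← Matrix.isUnit_iff_isUnit_det]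
    refine IsUnit.of_mul_eq_one (ρ k⁻¹) ?_
    rw [← hmul, inv_mul_cancel, hone]
  · have := hint _ (Submodule.subset_span ⟨1, rfl⟩) h
    simp only [OneMemClass.coe_one, mul_one] at this
    rw [this]
    exact Finset.sum_eq_zero fun i _ => by rw [show c i h = 0 from congrFun h0 i, mul_zero]

theorem translate_right_mem {p : AdjointGroup L → ℂ} (hp : p ∈ coordRing L) (g : AdjointGroup L) :
    (fun h => p (h * g)) ∈ coordRing L := by
  obtain ⟨W, -, hle, hW⟩ := exists_finite_translates hp
  exact hle (hW g)

/-- The action of the group on `G/P` is a morphism. -/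
theorem isMorphism_flag_smul (P : Subgroup (AdjointGroup L)) :
    IsMorphism ((groupStr L).prod (flagStr P)) (flagStr P) (fun z => z.1 • z.2) := by
  refine .of_morphAt ?_
  rintro ⟨g₀, x₀⟩
  induction x₀ using QuotientGroup.induction_on with | H h₀ => ?_
  -- A polynomial `s` on the group is not a function on `G/P`, but the basis `q` of the span of its
  -- translates by `P` is equivariant. The columns of `A h` are the vectors `q (z j * h₀⁻¹ * h)`,
  -- and `C` gives the coordinates of `q (g * h)` in these columns; these do descend. As `A h₀ = 1`,
  -- the value of `C` at the base point is `q (g₀ * h₀)`, which is nonzero.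
  have key : ∀ s ∈ coordRing L, s (g₀ * h₀) ≠ 0 →
      ∃ (n : ℕ) (q : AdjointGroup L → Fin n → ℂ) (ρ : P → Matrix (Fin n) (Fin n) ℂ)
      (A : AdjointGroup L → Matrix (Fin n) (Fin n) ℂ)
      (C : Fin n → AdjointGroup L × (AdjointGroup L ⧸ P) → ℂ) (j : Fin n),
      (∀ i, (fun h => q h i) ∈ Submodule.span ℂ (Set.range fun (k : P) h => s (h * k))) ∧
      (∀ k, IsUnit (ρ k).det) ∧ (∀ h (k : P), q (h * k) = (ρ k).mulVec (q h)) ∧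
      (∀ i j, (fun h => A h i j) ∈ coordRing L) ∧ (∀ h (k : P), A (h * k) = ρ k * A h) ∧
      (A h₀).det ≠ 0 ∧
      (∀ (g h : AdjointGroup L) j, C j (g, (h : AdjointGroup L ⧸ P)) = ((A h)⁻¹.mulVec (q (g * h))) j) ∧
      (∀ j, C j ∈ ((groupStr L).prod (flagStr P)).reg (g₀, (h₀ : AdjointGroup L ⧸ P))) ∧
      C j (g₀, (h₀ : AdjointGroup L ⧸ P)) ≠ 0 := by
    intro s hs hs0
    obtain ⟨n, q, z, ρ, hspan, hq, hqz, hρ, hqk, hne⟩ := exists_equivariant_system P hs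
    let A : AdjointGroup L → Matrix (Fin n) (Fin n) ℂ :=
      fun h => .of fun i j => q (z j * h₀⁻¹ * h) i
    have hA1 : A h₀ = 1 := by
      ext i j
      simp [A, hqz, Matrix.one_apply]
    have hA : ∀ i j, (fun h => A h i j) ∈ coordRing L := fun i j =>
      translate_left_mem (hq i) (z j * h₀⁻¹)
    have hAk : ∀ h (k : P), A (h * k) = ρ k * A h := by
      intro h k
      ext i j
      have := congrFun (hqk (z j * h₀⁻¹ * h) k) i
      rw [mul_assoc] at this
      exact this
    have hdet : (A h₀).det ≠ 0 := by simp [hA1]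
    obtain ⟨C, hC, hCr⟩ := solve_mem hρ hA hq hAk hqk g₀ hdet
    have : ∃ j, C j (g₀, (h₀ : AdjointGroup L ⧸ P)) ≠ 0 := by
      by_contra! h0
      refine hne _ hs0 (funext fun j => ?_)
      have := h0 j
      rw [hC, hA1, inv_one, Matrix.one_mulVec] at this
      exact this
    obtain ⟨j, hj⟩ := this
    exact ⟨n, q, ρ, A, C, j, hspan, hρ, hqk, hA, hAk, hdet, hC, hCr, hj⟩
  refine ⟨fun V hV => ?_, fun f hf => ?_⟩
  · obtain ⟨V', hV', hVo, hx⟩ := exists_isOpen hV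
    have h1 := mem_nhds_of_isOpen (quot_isOpen_iff.1 hVo)
      (show g₀ * h₀ ∈ Quotient.mk (QuotientGroup.leftRel P) ⁻¹' V' from hx)
    obtain ⟨U, f, hU, hz, hUV⟩ := exists_gen_of_mem_nhds h1
    obtain ⟨-, -, s, hs, rfl, -⟩ := exists_adjoin_of_gen hU
    obtain ⟨n, q, ρ, A, C, j, hspan, -, -, -, -, -, hC, hCr, hj⟩ := key s hs hz
    refine Filter.mem_map.2 (Filter.mem_of_superset
      (((groupStr L).prod (flagStr P)).eventually_ne (hCr j) hj) ?_)
    rintro ⟨g, x⟩ hgx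
    induction x using QuotientGroup.induction_on with | H h => ?_
    refine hV' ?_
    -- The entries of `q` are combinations of translates of `s` by `P`; if all translates vanished
    -- at `g * h`, so would `C j`. The element `k` found here does not change the coset.
    have h2 : ∃ k : P, s (g * h * k) ≠ 0 := by
      by_contra! h0
      refine hgx ?_
      have : q (g * h) = 0 := by
        funext i
        have : ∀ f ∈ Submodule.span ℂ (Set.range fun (k : P) h => s (h * k)), f (g * h) = 0 := by
          intro f hf
          induction hf using Submodule.span_induction with
          | mem f hf => obtain ⟨k, rfl⟩ := hf; exact h0 k
          | zero => rfl
          | add _ _ _ _ h h' => rw [Pi.add_apply, h, h', add_zero]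
          | smul c _ _ h => rw [Pi.smul_apply, h, smul_zero]
        exact this _ (hspan i)
      rw [hC, this, Matrix.mulVec_zero]; rfl
    obtain ⟨k, hk⟩ := h2
    have h3 : ((g * h * k : AdjointGroup L) : AdjointGroup L ⧸ P) ∈ V' := hUV hk
    rwa [QuotientGroup.mk_mul_of_mem _ k.2] at h3
  · obtain ⟨p, hp, s, hs, hs0, hps⟩ := exists_fraction (isMorphism_flag_mk.comp_mem (g₀ * h₀) f hf)
    obtain ⟨n, q, ρ, A, C, j, hspan, hρ, hqk, hA, hAk, hdet, hC, hCr, hj⟩ := key s hs hs0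
    -- Multiplying `q` by the right invariant function `f` keeps it equivariant, and it stays
    -- polynomial because `f` times a translate of `s` is the same translate of `p`. So `f (g * h)`
    -- is the quotient of the solutions for `y` and for `q`.
    let y : AdjointGroup L → Fin n → ℂ := fun h => f (h : AdjointGroup L ⧸ P) • q h
    have hy : ∀ i, (fun h => y h i) ∈ coordRing L := by
      intro i
      have : ∀ q ∈ Submodule.span ℂ (Set.range fun (k : P) h => s (h * k)),
          (fun h : AdjointGroup L => f (h : AdjointGroup L ⧸ P) * q h) ∈ coordRing L := by
        intro q hq
        induction hq using Submodule.span_induction with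
        | mem q hq =>
          obtain ⟨k, rfl⟩ := hq
          convert translate_right_mem hp k using 1
          funext h
          rw [← hps, Function.comp, QuotientGroup.mk_mul_of_mem _ k.2, mul_comm]
        | zero =>
          simp only [Pi.zero_apply, mul_zero]
          exact zero_mem (coordRing L)
        | add _ _ _ _ h h' =>
          convert add_mem h h' using 1
          funext x; simp [mul_add]
        | smul c _ _ h =>
          convert Subalgebra.smul_mem _ h c using 1
          funext x; simp; ring
      exact this _ (hspan i)
    have hyk : ∀ h (k : P), y (h * k) = (ρ k).mulVec (y h) := by
      intro h k
      simp only [y]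
      rw [QuotientGroup.mk_mul_of_mem _ k.2, hqk, Matrix.mulVec_smul]
    obtain ⟨C', hC', hCr'⟩ := solve_mem hρ hA hy hAk hyk g₀ hdet
    refine mem_reg_of_fraction (hCr' j) (hCr j) hj (.of_forall ?_)
    rintro ⟨g, x⟩
    induction x using QuotientGroup.induction_on with | H h => ?_
    rw [hC, hC', Matrix.mulVec_smul, Pi.smul_apply, smul_eq_mul, mul_comm]
    rfl

theorem FunStr.MorphAt.flag_smul {X : Type*} {a : FunStr X} {f : X → AdjointGroup L}
    {f' : X → AdjointGroup L ⧸ P} {x : X} (h : MorphAt a (groupStr L) f x)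
    (h' : MorphAt a (flagStr P) f' x) : MorphAt a (flagStr P) (fun x => f x • f' x) x :=
  ((isMorphism_flag_smul P).comp_at (h.prodMk h') :)

/-- Orbit maps are open: a function that vanishes along the orbit map near the identity
vanishes in a neighbourhood. -/
theorem eventually_of_orbit {x : AdjointGroup L ⧸ P} {p : AdjointGroup L ⧸ P → Prop}
    (h : ∀ᶠ g in @nhds _ (groupStr L).top 1, p (g • x)) : ∀ᶠ y in @nhds _ (flagStr P).top x, p y := by
  induction x using QuotientGroup.induction_on with | H h₀ => ?_
  obtain ⟨O, hO, hOo, h1⟩ := exists_isOpen h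
  let V : Set (AdjointGroup L ⧸ P) := (fun g : AdjointGroup L => g • (h₀ : AdjointGroup L ⧸ P)) '' O
  have hV : IsOpen[(flagStr P).top] V := by
    refine quot_isOpen_iff.2 ?_
    let _ := (groupStr L).top
    refine isOpen_iff_mem_nhds.2 fun g hg => ?_
    obtain ⟨o, ho, e⟩ := hg
    have e : ((o * h₀ : AdjointGroup L) : AdjointGroup L ⧸ P) = (g : AdjointGroup L ⧸ P) := e
    have hk := QuotientGroup.eq.1 e
    -- Right multiplication by a fixed element takes `g` to `o`, so it takes every `g'` near `g`
    -- into `O`; this shows that the preimage `O h₀ P` is open.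
    have m : MorphAt (groupStr L) (groupStr L)
        (fun g' => g' * ((o * h₀)⁻¹ * g)⁻¹ * h₀⁻¹) g :=
      ((morphAt_id g).gmul (morphAt_const _ _)).gmul (morphAt_const _ _)
    have e0 : g * ((o * h₀)⁻¹ * g)⁻¹ * h₀⁻¹ = o := by group
    have := m.tendsto (by rw [e0]; exact hOo.mem_nhds ho)
    refine Filter.mem_of_superset this fun g' hg' => ⟨_, hg', ?_⟩
    change ((g' * ((o * h₀)⁻¹ * g)⁻¹ * h₀⁻¹ * h₀ : AdjointGroup L) : AdjointGroup L ⧸ P) = g'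
    refine QuotientGroup.eq.2 ?_
    convert hk using 1
    group
  refine Filter.mem_of_superset (mem_nhds_of_isOpen hV ⟨1, h1, one_smul _ _⟩) ?_
  rintro _ ⟨g, hg, rfl⟩
  exact hO hg

end Flag

/-! ### Tangent vectors of the adjoint group and velocities of curves. -/

/-- `D` restricts to a point derivation at `x` of the algebra of functions `S`. -/
structure PDOn {X : Type*} (S : Subalgebra ℂ (X → ℂ)) (x : X) (D : (X → ℂ) → ℂ) : Prop where
  add : ∀ f ∈ S, ∀ g ∈ S, D (f + g) = D f + D g
  smul : ∀ (z : ℂ), ∀ f ∈ S, D (z • f) = z * D f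
  mul : ∀ f ∈ S, ∀ g ∈ S, D (f * g) = f x * D g + g x * D f

namespace PDOn

variable {X : Type*} {S : Subalgebra ℂ (X → ℂ)} {x : X} {D : (X → ℂ) → ℂ}

theorem _root_.MixingSpace.FunStr.PD.on {a : FunStr X} (h : PD a x D) (hS : S ≤ a.reg x) :
    PDOn S x D :=
  ⟨fun f hf g hg => h.add f (hS hf) g (hS hg), fun z f hf => h.smul z f (hS hf),
    fun f hf g hg => h.mul f (hS hf) g (hS hg)⟩

theorem const (h : PDOn S x D) (z : ℂ) : D (fun _ => z) = 0 := by
  have h1 := h.mul 1 (one_mem _) 1 (one_mem _)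
  simp only [mul_one, Pi.one_apply, one_mul] at h1
  have h2 := h.smul z 1 (one_mem _)
  have h3 : D 1 = 0 := by simpa using h1
  rw [h3, mul_zero] at h2
  rw [← h2]
  congr 1
  ext; simp

theorem sum (h : PDOn S x D) {ι : Type*} (s : Finset ι) {f : ι → X → ℂ} (hf : ∀ i, f i ∈ S) :
    D (∑ i ∈ s, f i) = ∑ i ∈ s, D (f i) := by
  classical
  induction s using Finset.induction_on with
  | empty => exact h.const 0
  | insert i s hi ih =>
    rw [Finset.sum_insert hi, Finset.sum_insert hi, h.add _ (hf i) _ (sum_mem fun j _ => hf j), ih]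

end PDOn

section Tangent

variable {L : Type u} [LieRing L] [LieAlgebra ℂ L]

theorem coeff_mem_coordRing (ξ : Module.Dual ℂ L) (v : L) :
    (fun g : AdjointGroup L => ξ (g.1 v)) ∈ coordRing L :=
  Algebra.subset_adjoin (Or.inl ⟨ξ, v, rfl⟩)

theorem inv_coeff_mem_coordRing (ξ : Module.Dual ℂ L) (v : L) :
    (fun g : AdjointGroup L => ξ ((g⁻¹).1 v)) ∈ coordRing L :=
  Algebra.subset_adjoin (Or.inr ⟨ξ, v, rfl⟩)

variable [FiniteDimensional ℂ L]

omit [FiniteDimensional ℂ L] in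
theorem dual_eq_sum {ι : Type*} [Fintype ι] (c : Module.Basis ι ℂ L) (η : Module.Dual ℂ L) (x : L) :
    η x = ∑ k, c.coord k x * η (c k) := by
  have := congrArg η (c.sum_repr x)
  rw [map_sum] at this
  simpa only [map_smul, smul_eq_mul, Module.Basis.coord_apply] using this.symm

theorem coeff_eq_sum {X : Type*} (f : X → L) (ξ : Module.Dual ℂ L) :
    (fun x => ξ (f x)) = ∑ k, ξ (Module.finBasis ℂ L k) •
      fun x => (Module.finBasis ℂ L).coord k (f x) := by
  funext x
  rw [dual_eq_sum (Module.finBasis ℂ L), Finset.sum_apply]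
  exact Finset.sum_congr rfl fun k _ => mul_comm _ _

/-- A point derivation of the coordinate ring is determined by its values on the matrix
coefficients. -/
theorem PDOn.ext_coordRing {g : AdjointGroup L} {D D' : (AdjointGroup L → ℂ) → ℂ}
    (h : PDOn (coordRing L) g D) (h' : PDOn (coordRing L) g D')
    (e : ∀ (ξ : Module.Dual ℂ L) v, D (fun g => ξ (g.1 v)) = D' (fun g => ξ (g.1 v))) :
    ∀ f ∈ coordRing L, D f = D' f := by
  let c := Module.finBasis ℂ L
  -- Differentiating the constant `∑ c_k(h⁻¹ v) η(h c_k) = η v` expresses derivatives of inverse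
  -- coefficients through those of coefficients.
  have hinv : ∀ {D : (AdjointGroup L → ℂ) → ℂ}, PDOn (coordRing L) g D →
      ∀ (ξ : Module.Dual ℂ L) v, D (fun g => ξ ((g⁻¹).1 v)) =
        - ∑ k, c.coord k ((g⁻¹).1 v) * D (fun h => ξ ((g⁻¹).1 (h.1 (c k)))) := by
    intro D h ξ v
    let η : Module.Dual ℂ L := ξ.comp ((g⁻¹).1 : L →ₗ[ℂ] L)
    have h1 : (∑ k, (fun h : AdjointGroup L => c.coord k ((h⁻¹).1 v)) *
        fun h : AdjointGroup L => η (h.1 (c k))) = fun _ => η v := by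
      funext h
      simp only [Finset.sum_apply, Pi.mul_apply]
      have := dual_eq_sum c (η.comp (h.1 : L →ₗ[ℂ] L)) ((h⁻¹).1 v)
      refine this.symm.trans ?_
      exact congrArg η (val_val_inv h v)
    have h2 := h.const (η v)
    rw [← h1, h.sum _ fun k => mul_mem (inv_coeff_mem_coordRing _ v) (coeff_mem_coordRing η _)] at h2
    simp only [h.mul _ (inv_coeff_mem_coordRing _ v) _ (coeff_mem_coordRing η _)] at h2
    rw [Finset.sum_add_distrib] at h2
    have h3 : D (fun g => ξ ((g⁻¹).1 v)) =
        ∑ k, η (g.1 (c k)) * D (fun h => c.coord k ((h⁻¹).1 v)) := by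
      rw [coeff_eq_sum, h.sum _ fun k => Subalgebra.smul_mem _ (inv_coeff_mem_coordRing _ v) _]
      refine Finset.sum_congr rfl fun k _ => ?_
      rw [h.smul _ _ (inv_coeff_mem_coordRing _ v)]
      congr 1
      exact congrArg ξ (val_inv_val g _).symm
    rw [h3]
    exact eq_neg_of_add_eq_zero_right h2
  intro f hf
  induction hf using Algebra.adjoin_induction with
  | mem f hf =>
    obtain ⟨ξ, v, rfl⟩ | ⟨ξ, v, rfl⟩ := hf
    · exact e ξ v
    · rw [hinv h, hinv h']
      have := fun k => e (ξ.comp ((g⁻¹).1 : L →ₗ[ℂ] L)) (c k)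
      simp only [LinearMap.comp_apply] at this
      congr 1
      exact Finset.sum_congr rfl fun k _ => congrArg _ (this k)
  | algebraMap z => exact (h.const z).trans (h'.const z).symm
  | add f f' hf hf' ih ih' => rw [h.add f hf f' hf', h'.add f hf f' hf', ih, ih']
  | mul f f' hf hf' ih ih' => rw [h.mul f hf f' hf', h'.mul f hf f' hf', ih, ih']

/-- The tangent space at `g` of the adjoint group consists of inner derivations. -/
theorem PDOn.exists_eq_ad [LieAlgebra.IsKilling ℂ L] {g : AdjointGroup L}
    {D : (AdjointGroup L → ℂ) → ℂ} (h : PDOn (coordRing L) g D) :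
    ∃ x : L, ∀ (ξ : Module.Dual ℂ L) v, D (fun h => ξ (h.1 v)) = ξ (g.1 ⁅x, v⁆) := by
  let c := Module.finBasis ℂ L
  have hA : ∃ A : L →ₗ[ℂ] L, ∀ (ξ : Module.Dual ℂ L) v, D (fun h => ξ (h.1 v)) = ξ (A v) := by
    refine ⟨{ toFun := fun v => ∑ k, D (fun h => c.coord k (h.1 v)) • c k,
              map_add' := fun v w => ?_, map_smul' := fun z v => ?_ }, fun ξ v => ?_⟩
    · rw [← Finset.sum_add_distrib]
      refine Finset.sum_congr rfl fun k _ => ?_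
      rw [← add_smul, ← h.add _ (coeff_mem_coordRing _ v) _ (coeff_mem_coordRing _ w)]
      congr 2
      funext h
      simp
    · rw [RingHom.id_apply, Finset.smul_sum]
      refine Finset.sum_congr rfl fun k _ => ?_
      rw [smul_smul, ← h.smul z _ (coeff_mem_coordRing _ v)]
      congr 2
      funext h
      simp
    · rw [coeff_eq_sum, h.sum _ fun k => Subalgebra.smul_mem _ (coeff_mem_coordRing _ v) _]
      simp only [LinearMap.coe_mk, AddHom.coe_mk, map_sum, map_smul]
      refine Finset.sum_congr rfl fun k _ => ?_
      rw [h.smul _ _ (coeff_mem_coordRing _ v), smul_eq_mul, mul_comm]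
  obtain ⟨A, hA⟩ := hA
  -- The derivative at `g` of `h ⁅v, w⁆ = ⁅h v, h w⁆`, with the bracket expanded in a basis.
  have hlie : ∀ v w, A ⁅v, w⁆ = ⁅A v, g.1 w⁆ + ⁅g.1 v, A w⁆ := by
    intro v w
    rw [← sub_eq_zero, ← Module.forall_dual_apply_eq_zero_iff ℂ]
    intro ξ
    have hbil : ∀ x y : L, ξ ⁅x, y⁆ =
        ∑ k, ∑ l, (c.coord k x * c.coord l y) * ξ ⁅c k, c l⁆ := by
      intro x y
      have h1 := fun x : L => dual_eq_sum c (ξ.comp (LieAlgebra.ad ℂ L x)) y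
      simp only [LinearMap.comp_apply, LieAlgebra.ad_apply] at h1
      have h2 := fun z : L => dual_eq_sum c (ξ.comp (LieAlgebra.ad ℂ L z)) x
      simp only [LinearMap.comp_apply, LieAlgebra.ad_apply] at h2
      have h3 : ∀ z : L, ξ ⁅x, z⁆ = ∑ k, c.coord k x * ξ ⁅c k, z⁆ := fun z => by
        have := h2 z
        rw [← lie_skew, map_neg, this, ← Finset.sum_neg_distrib]
        refine Finset.sum_congr rfl fun k _ => ?_
        rw [← lie_skew (c k), map_neg, mul_neg]
      rw [h1, Finset.sum_comm]
      refine Finset.sum_congr rfl fun l _ => ?_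
      rw [h3, Finset.mul_sum]
      refine Finset.sum_congr rfl fun k _ => ?_
      ring
    have e : (fun h : AdjointGroup L => ξ (h.1 ⁅v, w⁆)) = ∑ k, ∑ l, ξ ⁅c k, c l⁆ •
        ((fun h : AdjointGroup L => c.coord k (h.1 v)) *
          fun h : AdjointGroup L => c.coord l (h.1 w)) := by
      funext h
      rw [val_lie, hbil, Finset.sum_apply]
      refine Finset.sum_congr rfl fun k _ => ?_
      rw [Finset.sum_apply]
      exact Finset.sum_congr rfl fun l _ => mul_comm _ _
    have hm : ∀ k l, ((fun h : AdjointGroup L => c.coord k (h.1 v)) *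
          fun h : AdjointGroup L => c.coord l (h.1 w)) ∈ coordRing L := fun k l =>
      mul_mem (coeff_mem_coordRing _ v) (coeff_mem_coordRing _ w)
    have h1 := hA ξ ⁅v, w⁆
    rw [e, h.sum _ fun k => sum_mem fun l _ => Subalgebra.smul_mem _ (hm k l) _] at h1
    simp only [h.sum _ fun l => Subalgebra.smul_mem _ (hm _ l) _, h.smul _ _ (hm _ _),
      h.mul _ (coeff_mem_coordRing _ v) _ (coeff_mem_coordRing _ w), hA] at h1
    rw [map_sub, ← h1, sub_eq_zero]
    rw [map_add, hbil, hbil, ← Finset.sum_add_distrib]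
    refine Finset.sum_congr rfl fun k _ => ?_
    rw [← Finset.sum_add_distrib]
    refine Finset.sum_congr rfl fun l _ => ?_
    ring
  -- After translation back by `g⁻¹` the tangent vector is a derivation of `L`, and `L` has only
  -- inner ones.
  let N : LieDerivation ℂ L L := ⟨((g⁻¹).1 : L →ₗ[ℂ] L).comp A, fun v w => by
    change (g⁻¹).1 (A ⁅v, w⁆) = ⁅v, (g⁻¹).1 (A w)⁆ - ⁅w, (g⁻¹).1 (A v)⁆
    rw [hlie, map_add, val_lie, val_lie, val_inv_val, val_inv_val, ← lie_skew w, sub_neg_eq_add, add_comm]⟩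
  obtain ⟨x, hx⟩ := LieDerivation.IsKilling.exists_eq_ad N
  refine ⟨x, fun ξ v => ?_⟩
  have : ⁅x, v⁆ = (g⁻¹).1 (A v) := by
    rw [← LieDerivation.ad_apply_apply ℂ]
    exact LieDerivation.congr_fun hx v
  rw [hA, this, val_val_inv]

/-! ### Velocities of curves -/

/-- The curve `γ` has velocity `A` at `t`. -/
def HasVel (γ : ℂ → AdjointGroup L) (t : ℂ) (A : L →ₗ[ℂ] L) : Prop :=
  ∀ (ξ : Module.Dual ℂ L) v, HasDerivAt (fun s => ξ ((γ s).1 v)) (ξ (A v)) t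

theorem HasVel.mul {γ δ : ℂ → AdjointGroup L} {t : ℂ} {A B : L →ₗ[ℂ] L} (hγ : HasVel γ t A)
    (hδ : HasVel δ t B) : HasVel (fun s => γ s * δ s) t
      (A.comp ((δ t).1 : L →ₗ[ℂ] L) + ((γ t).1 : L →ₗ[ℂ] L).comp B) := by
  intro ξ v
  let c := Module.finBasis ℂ L
  have e : (fun s => ξ ((γ s * δ s).1 v)) =
      fun s => ∑ k, c.coord k ((δ s).1 v) * ξ ((γ s).1 (c k)) := by
    funext s
    exact dual_eq_sum c (ξ.comp ((γ s).1 : L →ₗ[ℂ] L)) ((δ s).1 v)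
  rw [e]
  refine (HasDerivAt.fun_sum fun k _ => (hδ (c.coord k) v).mul (hγ ξ (c k))).congr_deriv ?_
  rw [Finset.sum_add_distrib, LinearMap.add_apply, map_add, add_comm]
  congr 1
  · exact (dual_eq_sum c (ξ.comp A) ((δ t).1 v)).symm
  · exact (dual_eq_sum c (ξ.comp ((γ t).1 : L →ₗ[ℂ] L)) (B v)).symm

omit [FiniteDimensional ℂ L] in
theorem hasVel_const (g : AdjointGroup L) (t : ℂ) : HasVel (fun _ => g) t 0 := by
  intro ξ v
  simpa using hasDerivAt_const t (ξ (g.1 v))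

omit [FiniteDimensional ℂ L] in
theorem hasVel_expAd {x : L} (hx : IsNilpotent (LieAlgebra.ad ℂ L x)) {φ : ℂ → ℂ} {φ' t : ℂ}
    (hφ : HasDerivAt φ φ' t) : HasVel (fun s => expAd x hx (φ s)) t
      (φ' • (LieAlgebra.ad ℂ L x).comp ((expAd x hx (φ t)).1 : L →ₗ[ℂ] L)) := by
  intro ξ v
  refine ((hasDerivAt_nilExp hx ξ v (φ t)).comp t hφ).congr_deriv ?_
  simp [mul_comm, expAd_apply]

omit [FiniteDimensional ℂ L] in
theorem isMorphism_expAd {x : L} (hx : IsNilpotent (LieAlgebra.ad ℂ L x)) :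
    IsMorphism line (groupStr L) (expAd x hx) := by
  refine isMorphism_ofFunctions ?_
  rintro _ (⟨ξ, v, rfl⟩ | ⟨ξ, v, rfl⟩) t
  · obtain ⟨P, hP⟩ := exists_eval_nilExp (LieAlgebra.ad ℂ L x) ξ v
    convert eval_mem_line P t using 1
    exact funext hP
  · obtain ⟨P, hP⟩ := exists_eval_nilExp (LieAlgebra.ad ℂ L x) ξ v
    convert eval_mem_line (P.comp (-.X)) t using 1
    funext s
    rw [Function.comp, expAd_inv, expAd_apply, hP]; simp

omit [FiniteDimensional ℂ L] in
theorem expAd_of_lie_lie {x y : L} (hx : IsNilpotent (LieAlgebra.ad ℂ L x)) (h : ⁅x, ⁅x, y⁆⁆ = 0)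
    (t : ℂ) : (expAd x hx t).1 y = y + t • ⁅x, y⁆ := by
  rw [expAd_apply, nilExp_apply hx (n := 2) (by simpa [pow_succ] using h)]
  simp [Finset.sum_range_succ]

omit [FiniteDimensional ℂ L] in
theorem expAd_of_lie_lie_lie {x y : L} (hx : IsNilpotent (LieAlgebra.ad ℂ L x))
    (h : ⁅x, ⁅x, ⁅x, y⁆⁆⁆ = 0) (t : ℂ) :
    (expAd x hx t).1 y = y + t • ⁅x, y⁆ + (t ^ 2 / 2) • ⁅x, ⁅x, y⁆⁆ := by
  rw [expAd_apply, nilExp_apply hx (n := 3) (by simpa [pow_succ] using h)]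
  simp [Finset.sum_range_succ, pow_succ, div_eq_mul_inv]

/-- The curve `exp (-(c/(1+c)) f) exp(e) exp(c f) exp (-(1/(1+c)) e)`, which lies in the torus. -/
def torusCurve (e f : L) (he : IsNilpotent (LieAlgebra.ad ℂ L e))
    (hf : IsNilpotent (LieAlgebra.ad ℂ L f)) (c : ℂ) : AdjointGroup L :=
  if 1 + c = 0 then 1 else
    expAd f hf (-(c / (1 + c))) * expAd e he 1 * expAd f hf c * expAd e he (-(1 / (1 + c)))

section

variable {h e f : L} (t : IsSl2Triple h e f) (he : IsNilpotent (LieAlgebra.ad ℂ L e))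
  (hf : IsNilpotent (LieAlgebra.ad ℂ L f))

omit [FiniteDimensional ℂ L] in
include t in
theorem sl2_brackets : ⁅e, f⁆ = h ∧ ⁅f, e⁆ = -h ∧ ⁅e, h⁆ = -((2 : ℂ) • e) ∧ ⁅f, h⁆ = (2 : ℂ) • f := by
  refine ⟨t.lie_e_f, by rw [← lie_skew, t.lie_e_f], ?_, ?_⟩
  · rw [← lie_skew, t.lie_h_e_smul ℂ]
  · rw [← lie_skew, t.lie_lie_smul_f ℂ, neg_neg]

-- In `SL₂` the product of the four factors is the diagonal matrix with entries `1 + c` and `(1 +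
-- c)⁻¹`. It supplies an algebraic curve in the torus with velocity `h`, where the exponential of
-- `ad h` would not be algebraic. The vectors `y` in question are the elements of `H`; each
-- exponential acts on `y, e, h, f` through at most quadratic polynomials.
omit [FiniteDimensional ℂ L] in
include t in
theorem torusCurve_apply (c : ℂ) {y : L} {a : ℂ} (hy : ⁅y, e⁆ = a • e) (hy' : ⁅y, f⁆ = -(a • f)) :
    (torusCurve e f he hf c).1 y = y := by
  obtain ⟨h1, h2, h3, h4⟩ := sl2_brackets t
  have hy1 : ⁅e, y⁆ = -(a • e) := by rw [← lie_skew, hy]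
  have hy2 : ⁅f, y⁆ = a • f := by rw [← lie_skew, hy', neg_neg]
  unfold torusCurve
  split_ifs with hc
  · rfl
  have ey : ∀ s, (expAd e he s).1 y = y - (s * a) • e := fun s => by
    rw [expAd_of_lie_lie he (by rw [hy1]; simp), hy1]; module
  have ee : ∀ s, (expAd e he s).1 e = e := fun s => by
    rw [expAd_of_lie_lie he (by simp)]; simp
  have eh : ∀ s, (expAd e he s).1 h = h - (2 * s) • e := fun s => by
    rw [expAd_of_lie_lie he (by rw [h3]; simp), h3]; module
  have ef : ∀ s, (expAd e he s).1 f = f + s • h - (s ^ 2) • e := fun s => by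
    rw [expAd_of_lie_lie_lie he (by rw [h1, h3]; simp), h1, h3]; module
  have fy : ∀ s, (expAd f hf s).1 y = y + (s * a) • f := fun s => by
    rw [expAd_of_lie_lie hf (by rw [hy2]; simp), hy2]; module
  have ff : ∀ s, (expAd f hf s).1 f = f := fun s => by
    rw [expAd_of_lie_lie hf (by simp)]; simp
  have fe : ∀ s, (expAd f hf s).1 e = e - s • h - (s ^ 2) • f := fun s => by
    rw [expAd_of_lie_lie_lie hf (by rw [h2, lie_neg, h4]; simp), h2, lie_neg, h4]; module
  simp only [val_mul, ey, ee, eh, ef, fy, ff, fe, map_sub, map_add, map_smul]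
  match_scalars <;> field_simp <;> ring

include t in
theorem hasVel_torusCurve : HasVel (torusCurve e f he hf) 0 (LieAlgebra.ad ℂ L h) := by
  obtain ⟨h1, h2, h3, h4⟩ := sl2_brackets t
  have d1 : HasDerivAt (fun c : ℂ => -(c / (1 + c))) (-1) 0 := by
    have := ((hasDerivAt_id (0 : ℂ)).div ((hasDerivAt_id (0 : ℂ)).const_add 1) (by simp)).neg
    exact this.congr_deriv (by simp)
  have d2 : HasDerivAt (fun c : ℂ => -(1 / (1 + c))) 1 0 := by
    have := ((hasDerivAt_const (0 : ℂ) (1 : ℂ)).div ((hasDerivAt_id (0 : ℂ)).const_add 1)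
      (by simp)).neg
    exact this.congr_deriv (by simp)
  have key := (((hasVel_expAd hf d1).mul (hasVel_const (expAd e he 1) 0)).mul
    (hasVel_expAd hf (hasDerivAt_id' (0 : ℂ)))).mul (hasVel_expAd he d2)
  intro ξ v
  -- At `c = 0` the factors contribute `-f`, `0`, `exp(ad e) f` and `e`; since `exp(ad e) f = f + h
  -- - e`, the sum is `h`.
  have hv : LieAlgebra.ad ℂ L h v = -⁅f, v⁆ + ⁅(expAd e he 1).1 f, v⁆ + ⁅e, v⁆ := by
    rw [expAd_of_lie_lie_lie he (by rw [h1, h3]; simp), h1, h3, LieAlgebra.ad_apply]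
    simp only [add_lie, smul_lie, neg_lie]
    module
  refine ((key ξ v).congr_deriv ?_).congr_of_eventuallyEq ?_
  · congr 1
    have i1 : ∀ y, (expAd e he 1).1 ((expAd e he (-1)).1 y) = y := fun y => by
      rw [← expAd_inv, val_val_inv]
    rw [hv]
    have i2 : (expAd e he 1).1 e = e := by
      rw [expAd_of_lie_lie he (by simp)]; simp
    simp [expAd_zero, i1, i2, val_lie]
  · have : ∀ᶠ c : ℂ in 𝓝 0, 1 + c ≠ 0 :=
      (continuous_const.add continuous_id).continuousAt.eventually_ne (by simp)
    filter_upwards [this] with c hc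
    rw [torusCurve, if_neg hc]

theorem morphAt_torusCurve : MorphAt line (groupStr L) (torusCurve e f he hf) 0 := by
  have h0 : (fun c : ℂ => 1 + c) ∈ line.reg 0 := add_mem (one_mem _) (id_mem_line 0)
  have h0' : (1 : ℂ) + 0 ≠ 0 := by simp
  have hi := line.inv_mem h0 h0'
  have m1 : MorphAt line line (fun c : ℂ => -(c / (1 + c))) 0 := morphAt_ofFunctions fun g hg => by
    cases hg
    exact neg_mem (mul_mem (id_mem_line 0) hi)
  have m2 : MorphAt line line (fun c : ℂ => -(1 / (1 + c))) 0 := morphAt_ofFunctions fun g hg => by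
    cases hg
    exact neg_mem (mul_mem (const_mem 0 1) hi)
  refine MorphAt.congr (((((isMorphism_expAd hf).comp_at m1).gmul
    (morphAt_const (expAd e he 1) 0)).gmul ((isMorphism_expAd hf).morphAt 0)).gmul
    ((isMorphism_expAd he).comp_at m2)) ?_
  filter_upwards [line.eventually_ne h0 h0'] with c hc
  rw [torusCurve, if_neg hc]

end

end Tangent

/-! ### Root subgroups, Borel subgroups and generation of the tangent space. -/

section Roots

variable {L : Type u} [LieRing L] [LieAlgebra ℂ L] [FiniteDimensional ℂ L]
  [LieAlgebra.IsKilling ℂ L] {H : LieSubalgebra ℂ L} [H.IsCartanSubalgebra]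

omit [LieAlgebra.IsKilling ℂ L] in
theorem isNilpotent_ad_root (α : H.root) {x : L}
    (hx : x ∈ LieAlgebra.rootSpace H (α : LieModule.Weight ℂ H L)) :
    IsNilpotent (LieAlgebra.ad ℂ L x) :=
  LieAlgebra.isNilpotent_ad_of_mem_rootSpace H (χ := (α : LieModule.Weight ℂ H L))
    (fun h => H.isNonZero_coe_root α h) hx

theorem lie_of_mem_rootSpace {χ : H → ℂ} {x : L} (hx : x ∈ LieAlgebra.rootSpace H χ) {h : L}
    (hh : h ∈ H) : ⁅h, x⁆ = χ ⟨h, hh⟩ • x := lie_eq_smul_of_mem_rootSpace hx ⟨h, hh⟩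

omit [FiniteDimensional ℂ L] [LieAlgebra.IsKilling ℂ L] in
theorem expAd_mem_stabilizer {V : Submodule ℂ L} {x : L} (hx : IsNilpotent (LieAlgebra.ad ℂ L x))
    (h : ∀ y ∈ V, ⁅x, y⁆ ∈ V) (t : ℂ) : expAd x hx t ∈ stabilizer V := by
  have key : ∀ t, ∀ y ∈ V, (expAd x hx t).1 y ∈ V := by
    intro t y hy
    have hk : ∀ k, (LieAlgebra.ad ℂ L x ^ k) y ∈ V := fun k => by
      induction k with
      | zero => simpa using hy
      | succ k ih => rw [pow_succ', Module.End.mul_apply]; exact h _ ih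
    rw [expAd_apply, nilExp, LinearMap.sum_apply]
    exact sum_mem fun k _ => Submodule.smul_mem _ _ (hk k)
  refine fun y => ⟨fun hy => ?_, key t y⟩
  have := key (-t) _ hy
  rwa [← expAd_inv, val_inv_val] at this

/-- Closure of `s` under adding `α` makes the subspace stable under `ad x`: elements of `H` are sent
to multiples of `x`, and the root space of `β` is sent into the weight space of `α + β`, which is
`H`, zero, or the root space of an element of `s`. -/
theorem expAd_mem_stabilizer_rootSum {s : Set H.root} {α : H.root} (hα : α ∈ s)
    (hs : ∀ β ∈ s, ∀ γ, (rootSystem H).root γ = (rootSystem H).root α + (rootSystem H).root β →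
      γ ∈ s) {x : L} (hx : x ∈ LieAlgebra.rootSpace H (α : LieModule.Weight ℂ H L)) (t : ℂ) :
    expAd x (isNilpotent_ad_root α hx) t ∈ stabilizer (rootSum s) := by
  refine expAd_mem_stabilizer _ ?_ t
  suffices h : rootSum s ≤ Submodule.comap (LieAlgebra.ad ℂ L x) (rootSum s) from
    fun x hx => h hx
  have hmem : ∀ γ ∈ s, ∀ y ∈ LieAlgebra.rootSpace H (γ : LieModule.Weight ℂ H L),
      y ∈ rootSum s := fun γ hγ y hy =>
    Submodule.mem_sup_right (Submodule.mem_iSup_of_mem γ (Submodule.mem_iSup_of_mem hγ hy))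
  refine sup_le (fun y hy => ?_) (iSup₂_le fun β hβ y hy => ?_)
  · rw [Submodule.mem_comap, LieAlgebra.ad_apply, ← lie_skew, lie_of_mem_rootSpace hx hy]
    exact neg_mem (Submodule.smul_mem _ _ (hmem α hα x hx))
  · rw [Submodule.mem_comap, LieAlgebra.ad_apply]
    have hxy := LieAlgebra.lie_mem_genWeightSpace_of_mem_genWeightSpace hx hy
    by_cases h0 : ((α : LieModule.Weight ℂ H L) : H → ℂ) + ((β : LieModule.Weight ℂ H L) : H → ℂ) = 0
    · rw [h0] at hxy
      exact Submodule.mem_sup_left (SetLike.ext_iff.1 (LieAlgebra.rootSpace_zero_eq ℂ L H) _ |>.1 hxy)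
    · by_cases hb : LieModule.genWeightSpace L
          (((α : LieModule.Weight ℂ H L) : H → ℂ) + ((β : LieModule.Weight ℂ H L) : H → ℂ)) = ⊥
      · rw [hb] at hxy
        rw [(LieSubmodule.mem_bot _).1 hxy]
        exact zero_mem _
      · let γ : LieModule.Weight ℂ H L := ⟨_, hb⟩
        have hγ : γ ∈ H.root := by
          simp only [Finset.mem_filter, Finset.mem_univ, true_and]
          exact h0
        refine hmem ⟨γ, hγ⟩ (hs β hβ ⟨γ, hγ⟩ ?_) _ hxy
        ext h
        simp [γ]

variable (b : (rootSystem H).Base)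

theorem expAd_mem_borel {α : H.root} (hα : b.IsPos α) {x : L}
    (hx : x ∈ LieAlgebra.rootSpace H (α : LieModule.Weight ℂ H L)) (t : ℂ) :
    expAd x (isNilpotent_ad_root α hx) t ∈ borelSubgroup b :=
  expAd_mem_stabilizer_rootSum (s := {α | b.IsPos α}) hα
    (fun _ hβ _ hγ => RootPairing.Base.IsPos.add hα hβ hγ) hx t

theorem expAd_mem_oppBorel {α : H.root} (hα : ¬ b.IsPos α) {x : L}
    (hx : x ∈ LieAlgebra.rootSpace H (α : LieModule.Weight ℂ H L)) (t : ℂ) :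
    expAd x (isNilpotent_ad_root α hx) t ∈ oppBorel b := by
  refine expAd_mem_stabilizer_rootSum (s := {α | ¬ b.IsPos α}) hα (fun β hβ γ hγ => ?_) hx t
  -- Positivity is the sign of the height, and heights add.
  have h1 := b.height_add hγ
  simp only [Set.mem_ofPred_eq, RootPairing.Base.isPos_iff] at hα hβ ⊢
  omega

/-- The tangent space at the identity is spanned by the velocities of the root subgroups and of
curves in the torus. -/
theorem tangent_induction (H : LieSubalgebra ℂ L) [H.IsCartanSubalgebra]
    {p : ((AdjointGroup L → ℂ) → ℂ) → Prop}
    (add : ∀ D D', p D → p D' → p (fun f => D f + D' f)) (smul : ∀ c D, p D → p (fun f => c * D f))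
    (root : ∀ (α : H.root) (x : L)
      (hx : x ∈ LieAlgebra.rootSpace H (α : LieModule.Weight ℂ H L)),
      p (fun f => deriv (fun t => f (expAd x (isNilpotent_ad_root α hx) t)) 0))
    (torus : ∀ γ : ℂ → AdjointGroup L, (∀ t, γ t ∈ torus H) → γ 0 = 1 →
      MorphAt line (groupStr L) γ 0 → p (fun f => deriv (fun t => f (γ t)) 0)) (x : L) :
    ∃ D, PD (groupStr L) 1 D ∧ p D ∧
      ∀ (ξ : Module.Dual ℂ L) v, D (fun g => ξ (g.1 v)) = ξ ⁅x, v⁆ := by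
  let S : Submodule ℂ L :=
    { carrier := {x | ∃ D, PD (groupStr L) 1 D ∧ p D ∧
        ∀ (ξ : Module.Dual ℂ L) v, D (fun g => ξ (g.1 v)) = ξ ⁅x, v⁆}
      add_mem' := by
        rintro x y ⟨D, h1, h2, h3⟩ ⟨D', h1', h2', h3'⟩
        exact ⟨_, h1.add' h1', add _ _ h2 h2', fun ξ v => by rw [h3, h3', add_lie, map_add]⟩
      zero_mem' := by
        have h0 := torus (fun _ => 1) (fun _ => one_mem _) rfl (morphAt_const _ _)
        exact ⟨_, pd_curve (γ := fun _ : ℂ => (1 : AdjointGroup L)) (morphAt_const _ _), h0,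
          fun ξ v => by simp⟩
      smul_mem' := by
        rintro c x ⟨D, h1, h2, h3⟩
        exact ⟨_, h1.smul' c, smul c _ h2, fun ξ v => by rw [h3, smul_lie, map_smul, smul_eq_mul]⟩ }
  have hroot : ∀ (α : H.root) (x : L),
      x ∈ LieAlgebra.rootSpace H (α : LieModule.Weight ℂ H L) → x ∈ S := by
    intro α x hx
    have hn := isNilpotent_ad_root α hx
    refine ⟨_, ?_, root α x hx, fun ξ v => ?_⟩
    · have := pd_curve ((isMorphism_expAd hn).morphAt 0)
      rwa [expAd_zero] at this
    · refine (hasDerivAt_nilExp hn ξ v 0).deriv.trans ?_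
      rw [nilExp_zero hn]; rfl
  -- The coroots span `H`, and each of them is the velocity of the torus curve of an `sl₂`-triple.
  have hcar : ∀ x ∈ H, x ∈ S := by
    intro x hx
    have h1 : (⊤ : Submodule ℂ H) ≤ S.comap H.toSubmodule.subtype := by
      rw [← RootPairing.IsRootSystem.span_coroot_eq_top (P := rootSystem H), Submodule.span_le]
      rintro _ ⟨α, rfl⟩
      obtain ⟨h, e, f, t, he, hf⟩ :=
        exists_isSl2Triple_of_weight_isNonZero (H.isNonZero_coe_root α)
      have heq := t.h_eq_coroot (H.isNonZero_coe_root α) he hf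
      have hne := isNilpotent_ad_root α he
      have hnf : IsNilpotent (LieAlgebra.ad ℂ L f) :=
        LieAlgebra.isNilpotent_ad_of_mem_rootSpace H
          (fun h => H.isNonZero_coe_root α (neg_eq_zero.1 h)) hf
      have htor : ∀ c, torusCurve e f hne hnf c ∈ MixingSpace.torus H := fun c y hy => by
        refine torusCurve_apply t hne hnf c (a := (α : LieModule.Weight ℂ H L) ⟨y, hy⟩) ?_ ?_
        · exact lie_of_mem_rootSpace he hy
        · rw [lie_of_mem_rootSpace hf hy]; simp
      have h0 : torusCurve e f hne hnf 0 = 1 := by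
        rw [torusCurve, if_neg (by simp)]
        simp only [neg_zero, expAd_zero, add_zero, div_one, one_mul, mul_one]
        rw [← expAd_inv, mul_inv_cancel]
      have hm := morphAt_torusCurve hne hnf
      change ((rootSystem H).coroot α : L) ∈ S
      rw [rootSystem_coroot_apply, ← heq]
      refine ⟨_, ?_, torus _ htor h0 hm, fun ξ v => (hasVel_torusCurve t hne hnf ξ v).deriv⟩
      have := pd_curve hm
      rwa [h0] at this
    exact h1 (Submodule.mem_top (x := (⟨x, hx⟩ : H)))
  have htop : (⊤ : Submodule ℂ L) ≤ S := by
    have h1 := congrArg LieSubmodule.toSubmodule (LieModule.iSup_genWeightSpace_eq_top' ℂ H L)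
    rw [LieSubmodule.iSup_toSubmodule, LieSubmodule.top_toSubmodule] at h1
    rw [← h1]
    refine iSup_le fun χ y hy => ?_
    by_cases hχ : χ.IsZero
    · refine hcar y ?_
      have hy : y ∈ LieModule.genWeightSpace L (χ : H → ℂ) := hy
      rw [hχ] at hy
      exact SetLike.ext_iff.1 (LieAlgebra.rootSpace_zero_eq ℂ L H) _ |>.1 hy
    · exact hroot ⟨χ, by simpa using hχ⟩ y hy
  exact htop Submodule.mem_top

/-- The tangent space at the identity is spanned by the velocities of the root subgroups and of
curves in the torus. -/
theorem pd_induction (H : LieSubalgebra ℂ L) [H.IsCartanSubalgebra]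
    {p : ((AdjointGroup L → ℂ) → ℂ) → Prop}
    (add : ∀ D D', p D → p D' → p (fun f => D f + D' f)) (smul : ∀ c D, p D → p (fun f => c * D f))
    (congr : ∀ D D', p D → (∀ f ∈ (groupStr L).reg 1, D f = D' f) → p D')
    (root : ∀ (α : H.root) (x : L)
      (hx : x ∈ LieAlgebra.rootSpace H (α : LieModule.Weight ℂ H L)),
      p (fun f => deriv (fun t => f (expAd x (isNilpotent_ad_root α hx) t)) 0))
    (torus : ∀ γ : ℂ → AdjointGroup L, (∀ t, γ t ∈ torus H) → γ 0 = 1 →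
      MorphAt line (groupStr L) γ 0 → p (fun f => deriv (fun t => f (γ t)) 0))
    (D : (AdjointGroup L → ℂ) → ℂ) (hD : PD (groupStr L) 1 D) : p D := by
  obtain ⟨x, hx⟩ := (hD.on (coordRing_le_reg 1)).exists_eq_ad
  obtain ⟨D', hD', hp, hx'⟩ := tangent_induction H add smul root torus x
  refine congr D' D hp (PD.ext_ofFunctions hD' hD fun f hf => ?_)
  refine (hD'.on (coordRing_le_reg 1)).ext_coordRing (hD.on (coordRing_le_reg 1)) (fun ξ v => ?_) f
    (Algebra.subset_adjoin hf)
  rw [hx', hx]; rfl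

/-- Every element of `L` gives a tangent vector at the identity. -/
theorem exists_pd (H : LieSubalgebra ℂ L) [H.IsCartanSubalgebra] (x : L) :
    ∃ D, PD (groupStr L) 1 D ∧
      ∀ (ξ : Module.Dual ℂ L) v, D (fun g => ξ (g.1 v)) = ξ ⁅x, v⁆ := by
  obtain ⟨D, h1, -, h2⟩ := tangent_induction H (p := fun _ => True) (fun _ _ _ _ => trivial)
    (fun _ _ _ => trivial) (fun _ _ _ => trivial) (fun _ _ _ _ => trivial) x
  exact ⟨D, h1, h2⟩

end Roots

/-! ### Extension of derivations to fields of characteristic zero. -/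

/-- Adjoining a transcendence basis is formally smooth, and the algebraic extension that remains is
separable in characteristic zero. -/
theorem formallySmooth_of_charZero (F K : Type*) [Field F] [Field K] [Algebra F K] [CharZero F] :
    Algebra.FormallySmooth F K := by
  obtain ⟨s, hs⟩ := exists_isTranscendenceBasis F K
  have h1 : Algebra.IsAlgebraic (IntermediateField.adjoin F (Set.range ((↑) : s → K))) K :=
    hs.isAlgebraic_field
  exact .of_algebraicIndependent_of_isSeparable hs.1

/-- Square-zero extensions of a field of characteristic zero split over every subfield. -/
theorem exists_ringHom_section {F K C : Type*} [Field F] [Field K] [CharZero F] [CommRing C]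
    (π : C →+* K) (hπ : Function.Surjective π) (hn : IsNilpotent (RingHom.ker π)) (φ : F →+* C) :
    ∃ ψ : K →+* C, (∀ x, π (ψ x) = x) ∧ ∀ y, ψ (π (φ y)) = φ y := by
  let _ := (π.comp φ).toAlgebra
  let _ := φ.toAlgebra
  have := formallySmooth_of_charZero F K
  let π' : C →ₐ[F] K := ⟨π, fun _ => rfl⟩
  exact ⟨(Algebra.FormallySmooth.liftOfSurjective (AlgHom.id F K) π' hπ hn).toRingHom,
    Algebra.FormallySmooth.liftOfSurjective_apply (AlgHom.id F K) π' hπ hn,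
    (Algebra.FormallySmooth.liftOfSurjective (AlgHom.id F K) π' hπ hn).commutes⟩

open TrivSqZeroExt in
/-- A derivation with values in a field of characteristic zero extends to that field. -/
theorem exists_extend_derivation {A K : Type*} [CommRing A] [Field K] [CharZero K] (ι : A →+* K)
    (δ : A →+ K) (hδ : ∀ a b, δ (a * b) = ι a * δ b + ι b * δ a) (hk : ∀ a, ι a = 0 → δ a = 0) :
    ∃ Δ : K →+ K, (∀ a b, Δ (a * b) = a * Δ b + b * Δ a) ∧ ∀ a, Δ (ι a) = δ a := by
  -- A derivation over `ι` is a ring homomorphism `a ↦ ι a + ε δ a` to the dual numbers. By `hk` it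
  -- factors through `A / ker ι`; it extends to the fraction field, since elements with nonzero
  -- constant part are units, and then to `K` by formal smoothness. The coefficient of `ε` is the
  -- extended derivation.
  let φ : A →+* TrivSqZeroExt K K :=
    { toFun := fun a => inl (ι a) + inr (δ a)
      map_one' := by
        have h1 : δ 1 = 0 := by
          have := hδ 1 1
          simp only [mul_one, map_one, one_mul] at this
          linear_combination -this
        ext <;> simp [h1]
      map_mul' := fun a b => by
        ext
        · simp
        · simp [hδ]; ring
      map_zero' := by ext <;> simp
      map_add' := fun a b => by ext <;> simp }
  have hφ : ∀ a, (φ a).fst = ι a ∧ (φ a).snd = δ a := fun a => by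
    constructor <;> simp only [φ, RingHom.coe_mk, MonoidHom.coe_mk, OneHom.coe_mk] <;> simp
  let B := A ⧸ RingHom.ker ι
  have hP : (RingHom.ker ι).IsPrime := RingHom.ker_isPrime ι
  have hB : IsDomain B := Ideal.Quotient.isDomain _
  let F := FractionRing B
  let ι' : B →+* K := RingHom.kerLift ι
  have hι' : Function.Injective ι' := RingHom.kerLift_injective ι
  let φ' : B →+* TrivSqZeroExt K K := Ideal.Quotient.lift _ φ fun a ha => by
    ext
    · rw [(hφ a).1]; exact ha
    · rw [(hφ a).2]; exact hk a ha
  have hfst : ∀ x, (φ' x).fst = ι' x := by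
    intro x
    obtain ⟨a, rfl⟩ := Ideal.Quotient.mk_surjective x
    exact (hφ a).1
  let φF : F →+* TrivSqZeroExt K K := IsLocalization.lift (M := nonZeroDivisors B) (g := φ')
    fun y => by
      rw [TrivSqZeroExt.isUnit_iff_isUnit_fst, hfst, isUnit_iff_ne_zero]
      exact (map_ne_zero_iff _ hι').2 (nonZeroDivisors.ne_zero y.2)
  have : CharZero F := ((fstHom K K K).toRingHom.comp φF).charZero
  have hn : IsNilpotent (RingHom.ker (fstHom K K K).toRingHom) := ⟨2, kerIdeal_sq K K⟩
  obtain ⟨ψ, hψ, hψ'⟩ := exists_ringHom_section (fstHom K K K).toRingHom fst_surjective hn φF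
  have hψ : ∀ x, (ψ x).fst = x := hψ
  refine ⟨⟨⟨fun x => (ψ x).snd, by simp⟩, fun x y => by simp⟩, fun x y => ?_, fun a => ?_⟩
  · simp [hψ, mul_comm]
  · have h1 : φF (algebraMap B F (Ideal.Quotient.mk _ a)) = φ a :=
      (IsLocalization.lift_eq _ _).trans (Ideal.Quotient.lift_mk _ _ _)
    have h2 := hψ' (algebraMap B F (Ideal.Quotient.mk _ a))
    rw [h1] at h2
    have h3 : (fstHom K K K).toRingHom (φ a) = ι a := (hφ a).1
    rw [h3] at h2
    exact (congrArg snd h2).trans (hφ a).2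

/-- The elements of `R` whose image under the derivation `Δ` of `K` has denominator `s`. -/
def denominatorSubalgebra {R K : Type*} [CommRing R] [Field K] [Algebra ℂ R] [Algebra ℂ K]
    [Algebra R K] [IsScalarTower ℂ R K] (Δ : K →+ K)
    (hΔ : ∀ a b, Δ (a * b) = a * Δ b + b * Δ a) (hc : ∀ z : ℂ, Δ (algebraMap ℂ K z) = 0) (s : R) :
    Subalgebra ℂ R where
  carrier := {p | ∃ e : R, algebraMap R K e = algebraMap R K s * Δ (algebraMap R K p)}
  add_mem' := by
    rintro p p' ⟨e, he⟩ ⟨e', he'⟩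
    exact ⟨e + e', by rw [map_add, he, he', map_add, map_add, mul_add]⟩
  mul_mem' := by
    rintro p q ⟨e, he⟩ ⟨e', he'⟩
    refine ⟨p * e' + q * e, ?_⟩
    rw [map_add, map_mul, map_mul, map_mul, hΔ, he, he']
    ring
  algebraMap_mem' := fun z =>
    ⟨0, by rw [map_zero, ← IsScalarTower.algebraMap_apply, hc, mul_zero]⟩

/-! ### The function field of the adjoint group. -/

section FunctionField

variable (L : Type u) [LieRing L] [LieAlgebra ℂ L] [FiniteDimensional ℂ L]

instance : IsDomain (coordRing L) :=
  have : NoZeroDivisors (coordRing L) := ⟨fun {p q} h =>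
    (coordRing_eq_zero p.2 q.2 fun g => congrFun (congrArg Subtype.val h) g).imp
      (fun h => Subtype.ext (funext h)) (fun h => Subtype.ext (funext h))⟩
  NoZeroDivisors.to_isDomain _

/-- The field of rational functions on the adjoint group. -/
abbrev FunctionField : Type u := FractionRing (coordRing L)

instance : CharZero (FunctionField L) :=
  charZero_of_injective_algebraMap (algebraMap ℂ (FunctionField L)).injective

variable {L}

/-- The rational function `k` represents the germ of `φ` at the identity. -/
def Represents (φ : AdjointGroup L → ℂ) (k : FunctionField L) : Prop :=
  ∃ p s : coordRing L, s.1 1 ≠ 0 ∧ (∀ y, s.1 y * φ y = p.1 y) ∧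
    algebraMap _ (FunctionField L) s * k = algebraMap _ _ p

omit [FiniteDimensional ℂ L] in
theorem algebraMap_ne_zero_of_apply {s : coordRing L} {g : AdjointGroup L} (h : s.1 g ≠ 0) :
    algebraMap _ (FunctionField L) s ≠ 0 := by
  intro h0
  rw [map_eq_zero_iff _ (IsFractionRing.injective _ _)] at h0
  exact h (by rw [h0]; rfl)

omit [FiniteDimensional ℂ L] in
theorem exists_ne_zero_subset {g : AdjointGroup L} {V : Set (AdjointGroup L)}
    (hV : V ∈ @nhds _ (groupStr L).top g) : ∃ s : coordRing L, s.1 g ≠ 0 ∧ ∀ y, s.1 y ≠ 0 → y ∈ V := by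
  obtain ⟨U, f, hU, hg, hUV⟩ := exists_gen_of_mem_nhds hV
  obtain ⟨-, -, s, hs, rfl, -⟩ := exists_adjoin_of_gen hU
  exact ⟨⟨s, hs⟩, hg, fun y hy => hUV hy⟩

theorem exists_represents {φ : AdjointGroup L → ℂ} (hφ : φ ∈ (groupStr L).reg 1) :
    ∃ k, Represents φ k := by
  obtain ⟨p, hp, s, hs, h0, h⟩ := exists_fraction hφ
  have h1 : algebraMap (coordRing L) (FunctionField L) ⟨s, hs⟩ ≠ 0 :=
    algebraMap_ne_zero_of_apply (s := ⟨s, hs⟩) h0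
  exact ⟨algebraMap (coordRing L) _ ⟨p, hp⟩ / algebraMap (coordRing L) _ ⟨s, hs⟩, ⟨p, hp⟩, ⟨s, hs⟩, h0, h,
    mul_div_cancel₀ _ h1⟩

/-- The group is irreducible, so a germ determines its rational function: a polynomial `t` that
vanishes wherever `φ` and `φ'` differ turns the cross-multiplied identity into a global one. -/
theorem Represents.eq_of_eventuallyEq {φ φ' : AdjointGroup L → ℂ} {k k' : FunctionField L}
    (h : Represents φ k) (h' : Represents φ' k') (e : φ =ᶠ[@nhds _ (groupStr L).top 1] φ') :
    k = k' := by
  obtain ⟨p, s, h0, h1, h2⟩ := h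
  obtain ⟨p', s', h0', h1', h2'⟩ := h'
  obtain ⟨t, ht, ht'⟩ := exists_ne_zero_subset e
  have key : t * (s' * p) = t * (s * p') := by
    refine Subtype.ext (funext fun y => ?_)
    change t.1 y * (s'.1 y * p.1 y) = t.1 y * (s.1 y * p'.1 y)
    by_cases hy : t.1 y = 0
    · simp [hy]
    · have hy : φ y = φ' y := ht' y hy
      rw [← h1, ← h1', hy]; ring
  have key := congrArg (algebraMap _ (FunctionField L)) key
  simp only [map_mul, ← h2, ← h2'] at key
  have a1 := algebraMap_ne_zero_of_apply ht
  have a2 := algebraMap_ne_zero_of_apply h0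
  have a3 := algebraMap_ne_zero_of_apply h0'
  refine mul_left_cancel₀ (mul_ne_zero a1 (mul_ne_zero a2 a3)) ?_
  linear_combination key

omit [FiniteDimensional ℂ L] in
theorem Represents.add {φ φ' : AdjointGroup L → ℂ} {k k' : FunctionField L}
    (h : Represents φ k) (h' : Represents φ' k') : Represents (φ + φ') (k + k') := by
  obtain ⟨p, s, h0, h1, h2⟩ := h
  obtain ⟨p', s', h0', h1', h2'⟩ := h'
  refine ⟨p * s' + p' * s, s * s', mul_ne_zero h0 h0', fun y => ?_, ?_⟩
  · change (s.1 y * s'.1 y) * (φ y + φ' y) = p.1 y * s'.1 y + p'.1 y * s.1 y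
    rw [← h1, ← h1']; ring
  · simp only [map_mul, map_add, ← h2, ← h2']; ring

omit [FiniteDimensional ℂ L] in
theorem Represents.mul {φ φ' : AdjointGroup L → ℂ} {k k' : FunctionField L}
    (h : Represents φ k) (h' : Represents φ' k') : Represents (φ * φ') (k * k') := by
  obtain ⟨p, s, h0, h1, h2⟩ := h
  obtain ⟨p', s', h0', h1', h2'⟩ := h'
  refine ⟨p * p', s * s', mul_ne_zero h0 h0', fun y => ?_, ?_⟩
  · change (s.1 y * s'.1 y) * (φ y * φ' y) = p.1 y * p'.1 y
    rw [← h1, ← h1']; ring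
  · simp only [map_mul, ← h2, ← h2']; ring

omit [FiniteDimensional ℂ L] in
theorem represents_of_mem (p : coordRing L) : Represents p.1 (algebraMap _ _ p) :=
  ⟨p, 1, one_ne_zero, fun y => one_mul _, by simp⟩

/-- A derivation of the function field that is constant on the scalars preserves the coordinate
ring, up to a common denominator. -/
theorem exists_common_denominator (Δ : FunctionField L →+ FunctionField L)
    (hΔ : ∀ a b, Δ (a * b) = a * Δ b + b * Δ a)
    (hc : ∀ z : ℂ, Δ (algebraMap ℂ (FunctionField L) z) = 0) :
    ∃ (s : coordRing L) (E : coordRing L → coordRing L), s ≠ 0 ∧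
      ∀ p, algebraMap _ (FunctionField L) (E p) = algebraMap _ _ s * Δ (algebraMap _ _ p) := by
  let c := Module.finBasis ℂ L
  let f : Fin (Module.finrank ℂ L) × Fin (Module.finrank ℂ L) → coordRing L := fun i =>
    ⟨_, coeff_mem_coordRing (c.coord i.1) (c i.2)⟩
  let f' : Fin (Module.finrank ℂ L) × Fin (Module.finrank ℂ L) → coordRing L := fun i =>
    ⟨_, inv_coeff_mem_coordRing (c.coord i.1) (c i.2)⟩
  -- The matrix coefficients of `g` and `g⁻¹` in a basis generate the coordinate ring. A common
  -- denominator of their finitely many derivatives works everywhere, as the elements it works for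
  -- form a subalgebra.
  obtain ⟨s, hs⟩ := IsLocalization.exist_integer_multiples_of_finite (nonZeroDivisors (coordRing L))
    (fun i => Δ (algebraMap _ (FunctionField L) (Sum.elim f f' i)))
  let S := denominatorSubalgebra Δ hΔ hc s.1
  have hS : ∀ i, Sum.elim f f' i ∈ S := fun i => by
    obtain ⟨e, he⟩ := hs i
    exact ⟨e, by rw [he, Algebra.smul_def]⟩
  have hgen : ∀ (F : AdjointGroup L → L →ₗ[ℂ] L)
      (hF : ∀ (ξ : Module.Dual ℂ L) v, (fun g => ξ (F g v)) ∈ coordRing L)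
      (_ : ∀ k l, (⟨_, hF (c.coord k) (c l)⟩ : coordRing L) ∈ S) (ξ : Module.Dual ℂ L) (v : L),
      (⟨_, hF ξ v⟩ : coordRing L) ∈ S := by
    intro F hF h ξ v
    have : (⟨_, hF ξ v⟩ : coordRing L) = ∑ k, ∑ l, (ξ (c k) * c.coord l v) •
        (⟨_, hF (c.coord k) (c l)⟩ : coordRing L) := by
      refine Subtype.ext (funext fun g => ?_)
      simp only [AddSubmonoidClass.coe_finsetSum, SetLike.val_smul, Finset.sum_apply,
        Pi.smul_apply, smul_eq_mul]
      rw [dual_eq_sum c ξ]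
      refine Finset.sum_congr rfl fun k _ => ?_
      have := dual_eq_sum c ((c.coord k).comp (F g)) v
      rw [LinearMap.comp_apply] at this
      rw [this, Finset.sum_mul]
      refine Finset.sum_congr rfl fun l _ => ?_
      simp only [LinearMap.comp_apply]; ring
    rw [this]
    exact sum_mem fun k _ => sum_mem fun l _ => S.smul_mem (h k l) _
  have htop : ∀ p (hp : p ∈ coordRing L), (⟨p, hp⟩ : coordRing L) ∈ S := by
    intro p hp
    induction hp using Algebra.adjoin_induction with
    | mem p hp =>
      rcases hp with ⟨ξ, v, rfl⟩ | ⟨ξ, v, rfl⟩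
      · exact hgen (fun g => g.1) coeff_mem_coordRing (fun k l => hS (.inl (k, l))) ξ v
      · exact hgen (fun g => (g⁻¹).1) inv_coeff_mem_coordRing (fun k l => hS (.inr (k, l))) ξ v
    | algebraMap z => exact S.algebraMap_mem z
    | add p q hp hq ihp ihq => exact S.add_mem ihp ihq
    | mul p q hp hq ihp ihq => exact S.mul_mem ihp ihq
  choose E hE using fun p : coordRing L => htop p.1 p.2
  exact ⟨s.1, E, nonZeroDivisors.ne_zero s.2, hE⟩

end FunctionField

/-! ### Elements of the Lie algebra as derivations, vector fields on the group. -/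

section InvariantDerivations

variable {L : Type u} [LieRing L] [LieAlgebra ℂ L] [FiniteDimensional ℂ L]
  [LieAlgebra.IsKilling ℂ L] (H : LieSubalgebra ℂ L) [H.IsCartanSubalgebra]

/-- The tangent vector at the identity given by an element of the Lie algebra. -/
def lieDer (x : L) : (AdjointGroup L → ℂ) → ℂ := (exists_pd H x).choose

theorem pd_lieDer (x : L) : PD (groupStr L) 1 (lieDer H x) := (exists_pd H x).choose_spec.1

theorem lieDer_coeff (x : L) (ξ : Module.Dual ℂ L) (v : L) :
    lieDer H x (fun g => ξ (g.1 v)) = ξ ⁅x, v⁆ := (exists_pd H x).choose_spec.2 ξ v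

theorem lieDer_ext {x : L} {D : (AdjointGroup L → ℂ) → ℂ} (hD : PD (groupStr L) 1 D)
    (h : ∀ (ξ : Module.Dual ℂ L) v, D (fun g => ξ (g.1 v)) = ξ ⁅x, v⁆) {f : AdjointGroup L → ℂ}
    (hf : f ∈ (groupStr L).reg 1) : lieDer H x f = D f := by
  refine PD.ext_ofFunctions (pd_lieDer H x) hD (fun f hf => ?_) f hf
  refine ((pd_lieDer H x).on (coordRing_le_reg 1)).ext_coordRing (hD.on (coordRing_le_reg 1))
    (fun ξ v => ?_) f (Algebra.subset_adjoin hf)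
  rw [lieDer_coeff, h]

theorem lieDer_add (x y : L) {f : AdjointGroup L → ℂ} (hf : f ∈ (groupStr L).reg 1) :
    lieDer H (x + y) f = lieDer H x f + lieDer H y f :=
  lieDer_ext H ((pd_lieDer H x).add' (pd_lieDer H y))
    (fun ξ v => by rw [lieDer_coeff, lieDer_coeff, add_lie, map_add]) hf

theorem lieDer_smul (c : ℂ) (x : L) {f : AdjointGroup L → ℂ} (hf : f ∈ (groupStr L).reg 1) :
    lieDer H (c • x) f = c * lieDer H x f :=
  lieDer_ext H ((pd_lieDer H x).smul' c)
    (fun ξ v => by rw [lieDer_coeff, smul_lie, map_smul, smul_eq_mul]) hf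

/-- `x ↦ lieDer H x f` as a linear form. -/
def lieDerLin {f : AdjointGroup L → ℂ} (hf : f ∈ (groupStr L).reg 1) : Module.Dual ℂ L where
  toFun x := lieDer H x f
  map_add' x y := lieDer_add H x y hf
  map_smul' c x := lieDer_smul H c x hf

omit [LieAlgebra.IsKilling ℂ L] in
theorem mul_left_mem_reg {f : AdjointGroup L → ℂ} {g : AdjointGroup L}
    (hf : f ∈ (groupStr L).reg g) : (fun h => f (g * h)) ∈ (groupStr L).reg 1 :=
  (MorphAt.gmul (morphAt_const g 1) (morphAt_id 1)).comp_mem f (by rwa [mul_one])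

/-- The centre vanishes, so `ad` is injective. The linear map `Λ` recovers `x` from the matrix
entries of `ad x`. -/
theorem exists_leftInverse_ad :
    ∃ Λ : Module.End ℂ L →ₗ[ℂ] L, ∀ x, Λ (LieAlgebra.ad ℂ L x) = x := by
  let ad : L →ₗ[ℂ] Module.End ℂ L :=
    { toFun := fun x => LieAlgebra.ad ℂ L x
      map_add' := fun x y => LinearMap.ext fun z => add_lie x y z
      map_smul' := fun c x => LinearMap.ext fun z => smul_lie c x z }
  obtain ⟨Λ, hΛ⟩ := LinearMap.exists_leftInverse_of_injective ad (by
      refine LinearMap.ker_eq_bot'.2 fun x hx => ?_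
      have : x ∈ LieAlgebra.center ℂ L := (LieModule.mem_maxTrivSubmodule ℂ L L x).2 fun y => by
        rw [← lie_skew, neg_eq_zero]
        exact LinearMap.congr_fun hx y
      rwa [LieAlgebra.center_eq_bot, LieSubmodule.mem_bot] at this)
  exact ⟨Λ, fun x => LinearMap.congr_fun hΛ x⟩

/-- A derivation of the coordinate ring is a vector field with regular coefficients. -/
theorem exists_vectorField (E : coordRing L → coordRing L) (hadd : ∀ p q, E (p + q) = E p + E q)
    (hsmul : ∀ (z : ℂ) p, E (z • p) = z • E p) (hmul : ∀ p q, E (p * q) = p * E q + q * E p) :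
    ∃ X : AdjointGroup L → L, (∀ η : Module.Dual ℂ L, (fun g => η (X g)) ∈ coordRing L) ∧
      ∀ p g, (E p).1 g = lieDer H (X g) (fun h => p.1 (g * h)) := by
  classical
  -- Evaluating `E` at `g` gives a point derivation at `g`, hence an element `X g` of the Lie
  -- algebra.
  let Dg : AdjointGroup L → (AdjointGroup L → ℂ) → ℂ := fun g f =>
    if hf : f ∈ coordRing L then (E ⟨f, hf⟩).1 g else 0
  have hDg : ∀ g f (hf : f ∈ coordRing L), Dg g f = (E ⟨f, hf⟩).1 g := fun g f hf => dif_pos hf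
  have hPD : ∀ g, PDOn (coordRing L) g (Dg g) := fun g =>
    { add := fun f hf f' hf' => by
        rw [hDg g f hf, hDg g f' hf', hDg g _ (add_mem hf hf')]
        exact congrFun (congrArg Subtype.val (hadd ⟨f, hf⟩ ⟨f', hf'⟩)) g
      smul := fun z f hf => by
        rw [hDg g f hf, hDg g _ (Subalgebra.smul_mem _ hf z)]
        exact congrFun (congrArg Subtype.val (hsmul z ⟨f, hf⟩)) g
      mul := fun f hf f' hf' => by
        rw [hDg g f hf, hDg g f' hf', hDg g _ (mul_mem hf hf')]
        exact congrFun (congrArg Subtype.val (hmul ⟨f, hf⟩ ⟨f', hf'⟩)) g }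
  choose X hX using fun g => (hPD g).exists_eq_ad
  refine ⟨X, fun η => ?_, fun p g => ?_⟩
  -- The entries of `ad (X g)` are the values of `E` on matrix coefficients, contracted with the
  -- coefficients of `g⁻¹`; they are polynomial, and `Λ` passes from them to `X g`.
  · obtain ⟨Λ, hΛ⟩ := exists_leftInverse_ad (L := L)
    let c := Module.finBasis ℂ L
    have h1 : (fun g => η (X g)) = ∑ m, ∑ l, fun g =>
        c.coord m ⁅X g, c l⁆ * η (Λ (Matrix.toLin c c (Matrix.single m l 1))) := by
      funext g
      conv_lhs => rw [← hΛ (X g), ← Matrix.toLin_toMatrix c c (LieAlgebra.ad ℂ L (X g)),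
        Matrix.matrix_eq_sum_single (LinearMap.toMatrix c c _)]
      simp only [map_sum, Finset.sum_apply]
      refine Finset.sum_congr rfl fun m _ => Finset.sum_congr rfl fun l _ => ?_
      have : (Matrix.single m l (LinearMap.toMatrix c c (LieAlgebra.ad ℂ L (X g)) m l)) =
          c.coord m ⁅X g, c l⁆ • Matrix.single m l (1 : ℂ) := by
        rw [Matrix.smul_single, smul_eq_mul, mul_one, LinearMap.toMatrix_apply]
        rfl
      rw [this, map_smul, map_smul, map_smul, smul_eq_mul]
    have h2 : ∀ m l, (fun g => c.coord m ⁅X g, c l⁆) = ∑ k, fun g =>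
        (E ⟨_, coeff_mem_coordRing (c.coord k) (c l)⟩).1 g * c.coord m ((g⁻¹).1 (c k)) := by
      intro m l
      funext g
      rw [Finset.sum_apply]
      have h3 := dual_eq_sum c ((c.coord m).comp ((g⁻¹).1 : L →ₗ[ℂ] L)) (g.1 ⁅X g, c l⁆)
      have h4 : ((c.coord m).comp ((g⁻¹).1 : L →ₗ[ℂ] L)) (g.1 ⁅X g, c l⁆) =
          c.coord m ⁅X g, c l⁆ := congrArg (c.coord m) (val_inv_val g _)
      rw [← h4, h3]
      refine Finset.sum_congr rfl fun k _ => ?_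
      rw [← hX g (c.coord k) (c l), hDg g _ (coeff_mem_coordRing (c.coord k) (c l))]
      rfl
    rw [h1]
    refine sum_mem fun m _ => sum_mem fun l _ => mul_mem ?_ ((coordRing L).algebraMap_mem _)
    rw [h2]
    exact sum_mem fun k _ => mul_mem (Subtype.prop _) (inv_coeff_mem_coordRing _ _)
  · have h1 := (pd_lieDer H (X g)).push (MorphAt.gmul (morphAt_const g 1) (morphAt_id 1))
    rw [mul_one] at h1
    have h2 := (hPD g).ext_coordRing (h1.on (coordRing_le_reg g)) (fun ξ v => by
      rw [hX g]
      exact (lieDer_coeff H (X g) (ξ.comp (g.1 : L →ₗ[ℂ] L)) v).symm) p.1 p.2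
    rw [hDg g p.1 p.2] at h2
    exact h2

end InvariantDerivations

/-! ### From tangent vectors of `G/P` to derivations of the function field. -/

section Orbit

variable {L : Type u} [LieRing L] [LieAlgebra ℂ L] [FiniteDimensional ℂ L]
  {P : Subgroup (AdjointGroup L)} {x : AdjointGroup L ⧸ P} {g : AdjointGroup L}
  {f : AdjointGroup L ⧸ P → ℂ} {D : (AdjointGroup L ⧸ P → ℂ) → ℂ}

theorem orbit_mem_reg (hf : f ∈ (flagStr P).reg (g • x)) :
    (fun h : AdjointGroup L => f (h • x)) ∈ (groupStr L).reg g :=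
  (MorphAt.flag_smul (morphAt_id g) (morphAt_const x g)).comp_mem f hf

theorem smul_mem_reg (hf : f ∈ (flagStr P).reg (g • x)) :
    (fun z => f (g • z)) ∈ (flagStr P).reg x :=
  (MorphAt.flag_smul (morphAt_const g x) (morphAt_id x)).comp_mem f hf

theorem FunStr.PD.smul_mem_reg (hD : PD (flagStr P) x D) (hf : f ∈ (flagStr P).reg (g • x)) :
    (fun h : AdjointGroup L => D (fun z => f (h • z))) ∈ (groupStr L).reg g :=
  hD.partial_mem (F := fun z => f (z.1 • z.2))
    (((isMorphism_flag_smul P).morphAt (g, x)).comp_mem f hf)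

theorem eventually_smul {p : AdjointGroup L ⧸ P → Prop}
    (h : ∀ᶠ y in @nhds _ (flagStr P).top (g • x), p y) :
    ∀ᶠ h in @nhds _ (groupStr L).top g, p (h • x) :=
  (MorphAt.flag_smul (morphAt_id g) (morphAt_const x g)).tendsto h

theorem eventually_one_smul {p : AdjointGroup L ⧸ P → Prop}
    (h : ∀ᶠ y in @nhds _ (flagStr P).top x, p y) :
    ∀ᶠ h in @nhds _ (groupStr L).top 1, p (h • x) :=
  eventually_smul (by rwa [one_smul])

theorem orbit_mem_reg_one (hf : f ∈ (flagStr P).reg x) :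
    (fun h : AdjointGroup L => f (h • x)) ∈ (groupStr L).reg 1 :=
  orbit_mem_reg (by rwa [one_smul])

theorem FunStr.PD.smul_mem_reg_one (hD : PD (flagStr P) x D) (hf : f ∈ (flagStr P).reg x) :
    (fun h : AdjointGroup L => D (fun z => f (h • z))) ∈ (groupStr L).reg 1 :=
  hD.smul_mem_reg (by rwa [one_smul])

/-- The rational vector field on the group attached to a tangent vector of a homogeneous space. -/
theorem exists_extended_derivation (hD : PD (flagStr P) x D) :
    ∃ Δ : FunctionField L →+ FunctionField L, (∀ a b, Δ (a * b) = a * Δ b + b * Δ a) ∧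
      (∀ z : ℂ, Δ (algebraMap ℂ (FunctionField L) z) = 0) ∧
      ∀ f ∈ (flagStr P).reg x, ∀ k k', Represents (fun g => f (g • x)) k →
        Represents (fun g => D (fun z => f (g • z))) k' → Δ k = k' := by
  -- `ι f` represents `g ↦ f (g • x)`, and `δ f` represents `g ↦ D (f (g ·))`; the latter is a
  -- derivation over the former.
  choose ι hι using fun f : (flagStr P).reg x => exists_represents (orbit_mem_reg_one f.2)
  choose δ hδ using fun f : (flagStr P).reg x => exists_represents (hD.smul_mem_reg_one f.2)
  have hmem : ∀ f : (flagStr P).reg x, ∀ᶠ g in @nhds _ (groupStr L).top 1,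
      (fun z => f.1 (g • z)) ∈ (flagStr P).reg x := fun f =>
    (eventually_one_smul ((flagStr P).eventually_mem f.2)).mono fun g hg => MixingSpace.smul_mem_reg hg
  let ιr : (flagStr P).reg x →+* FunctionField L :=
    { toFun := ι
      map_one' := (hι 1).eq_of_eventuallyEq (map_one (algebraMap (coordRing L) (FunctionField L)) ▸ represents_of_mem (1 : coordRing L))
        (.of_forall fun _ => rfl)
      map_mul' := fun f f' => (hι _).eq_of_eventuallyEq ((hι f).mul (hι f'))
        (.of_forall fun _ => rfl)
      map_zero' := (hι 0).eq_of_eventuallyEq (map_zero (algebraMap (coordRing L) (FunctionField L)) ▸ represents_of_mem (0 : coordRing L))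
        (.of_forall fun _ => rfl)
      map_add' := fun f f' => (hι _).eq_of_eventuallyEq ((hι f).add (hι f'))
        (.of_forall fun _ => rfl) }
  let δa : (flagStr P).reg x →+ FunctionField L := AddMonoidHom.mk' δ fun f f' =>
    (hδ _).eq_of_eventuallyEq ((hδ f).add (hδ f')) (by
      filter_upwards [hmem f, hmem f'] with g hg hg'
      exact hD.add _ hg _ hg')
  obtain ⟨Δ, hΔ, hΔι⟩ := exists_extend_derivation ιr δa (fun f f' => by
      refine (hδ _).eq_of_eventuallyEq (((hι f).mul (hδ f')).add ((hι f').mul (hδ f))) ?_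
      filter_upwards [hmem f, hmem f'] with g hg hg'
      exact hD.mul _ hg _ hg') (fun f hf => by
      have h0 : Represents (L := L) 0 0 := by simpa using represents_of_mem (0 : coordRing L)
      refine (hδ f).eq_of_eventuallyEq h0 ?_
      -- The kernel condition: if `f` pulls back to zero, it vanishes near `x` because orbit maps
      -- are open, hence near `g • x` for `g` near `1`, and `D` only sees germs.
      have h1 : ∀ᶠ g in @nhds _ (groupStr L).top 1, f.1 (g • x) = 0 := by
        obtain ⟨p, s, hs, h2, h3⟩ := hι f
        have hf : ι f = 0 := hf
        rw [hf, mul_zero, eq_comm, map_eq_zero_iff _ (IsFractionRing.injective _ _)] at h3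
        filter_upwards [(groupStr L).eventually_ne (coordRing_le_reg 1 s.2) hs] with g hg
        have := h2 g
        rw [h3] at this
        exact (mul_eq_zero.1 this).resolve_left hg
      have h4 := eventually_of_orbit (p := fun y => f.1 y = 0) h1
      have h5 := eventually_one_smul ((flagStr P).eventually_mem f.2)
      have h6 : ∀ᶠ g in @nhds _ (groupStr L).top 1, ∀ᶠ y in @nhds _ (flagStr P).top (g • x), f.1 y = 0 := by
        refine eventually_one_smul (p := fun z => ∀ᶠ y in @nhds _ (flagStr P).top z, f.1 y = 0) ?_
        let _ := (flagStr P).top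
        exact eventually_eventually_nhds.2 h4
      filter_upwards [h6, hmem f] with g hg hg'
      refine (hD.congr hg' (g := fun _ => 0) ?_).trans (hD.const 0)
      exact (MorphAt.flag_smul (morphAt_const g x) (morphAt_id x)).tendsto hg)
  refine ⟨Δ, hΔ, fun z => ?_, fun f hf k k' hk hk' => ?_⟩
  · have h1 := hΔι (algebraMap ℂ _ z)
    have h2 : ιr (algebraMap ℂ _ z) = algebraMap ℂ (FunctionField L) z := by
      refine (hι _).eq_of_eventuallyEq (φ' := (algebraMap ℂ (coordRing L) z).1) ?_
        (.of_forall fun _ => rfl)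
      rw [IsScalarTower.algebraMap_apply ℂ (coordRing L) (FunctionField L)]
      exact represents_of_mem _
    have h3 : δa (algebraMap ℂ _ z) = 0 := by
      have h0 : Represents (L := L) 0 0 := by simpa using represents_of_mem (0 : coordRing L)
      exact (hδ _).eq_of_eventuallyEq h0 (.of_forall fun g => hD.const z)
    rw [← h2, h1, h3]
  · have h1 := hΔι ⟨f, hf⟩
    have h2 : ιr ⟨f, hf⟩ = k := (hι _).eq_of_eventuallyEq hk (.of_forall fun _ => rfl)
    have h3 : δa ⟨f, hf⟩ = k' := (hδ _).eq_of_eventuallyEq hk' (.of_forall fun _ => rfl)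
    rw [← h2, h1, h3]

end Orbit

-- Dividing by `X` as long as all members vanish at `0` must stop, since the degree of a nonzero
-- member drops. It removes the common zero of numerators and denominator along a curve.
open Polynomial in
theorem exists_factor_X {ι : Type*} {Y : ι → ℂ[X]} {i₀ : ι} (h : Y i₀ ≠ 0) :
    ∃ (k : ℕ) (Y' : ι → ℂ[X]), (∀ i, Y i = X ^ k * Y' i) ∧ ∃ i, (Y' i).eval 0 ≠ 0 := by
  induction hd : (Y i₀).natDegree using Nat.strong_induction_on generalizing Y with
  | _ d ih =>
    by_cases h0 : ∃ i, (Y i).eval 0 ≠ 0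
    · exact ⟨0, Y, fun i => by simp, h0⟩
    · push Not at h0
      choose Z hZ using fun i => X_dvd_iff.2 ((coeff_zero_eq_eval_zero (Y i)).trans (h0 i))
      have hne : Z i₀ ≠ 0 := fun hz => h (by rw [hZ, hz, mul_zero])
      obtain ⟨k, Y', h1, h2⟩ := ih (Z i₀).natDegree (by
        rw [← hd, hZ i₀, natDegree_X_mul hne]; omega) hne rfl
      exact ⟨k + 1, Y', fun i => by rw [hZ, h1, pow_succ']; ring, h2⟩

/-! ### Orbit maps are surjective on tangent spaces. -/

section Orbit

variable {L : Type u} [LieRing L] [LieAlgebra ℂ L] [FiniteDimensional ℂ L]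
  [LieAlgebra.IsKilling ℂ L] (H : LieSubalgebra ℂ L) [H.IsCartanSubalgebra]
  {P : Subgroup (AdjointGroup L)} {x : AdjointGroup L ⧸ P}
  {D : (AdjointGroup L ⧸ P → ℂ) → ℂ}

/-- The derivation of the function field, cleared of denominators, is the vector field `X`. At `g =
1` the relation would exhibit `D` as an orbit direction, but `s` may vanish there. The neighbourhood
depends on `f`, so one cannot just move to another `g` either. -/
theorem exists_orbit_vectorField (hD : PD (flagStr P) x D) :
    ∃ s ∈ coordRing L, (∃ g, s g ≠ 0) ∧ ∃ X : AdjointGroup L → L,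
      (∀ η : Module.Dual ℂ L, (fun g => η (X g)) ∈ coordRing L) ∧
      ∀ f ∈ (flagStr P).reg x, ∀ᶠ g in @nhds _ (groupStr L).top 1,
        s g * D (fun z => f (g • z)) = lieDer H (X g) (fun h => f ((g * h) • x)) := by
  obtain ⟨Δ, hΔ, hc, hΔι⟩ := exists_extended_derivation hD
  obtain ⟨s, E, hs, hE⟩ := exists_common_denominator Δ hΔ hc
  have hinj : Function.Injective (algebraMap (coordRing L) (FunctionField L)) :=
    IsFractionRing.injective _ _
  have hadd : ∀ p q, E (p + q) = E p + E q := fun p q => hinj (by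
    rw [map_add, hE, hE, hE, map_add, map_add, mul_add])
  have hmul : ∀ p q, E (p * q) = p * E q + q * E p := fun p q => hinj (by
    rw [map_add, map_mul, map_mul, hE, hE, hE, map_mul, hΔ]; ring)
  have hconst : ∀ z : ℂ, E (algebraMap ℂ _ z) = 0 := fun z => hinj (by
    rw [hE, ← IsScalarTower.algebraMap_apply, hc, mul_zero, map_zero])
  obtain ⟨X, hX, hEX⟩ := exists_vectorField H E hadd
    (fun z p => by rw [Algebra.smul_def, hmul, hconst, mul_zero, add_zero, ← Algebra.smul_def]) hmul
  refine ⟨s.1, s.2, ?_, X, hX, fun f hf => ?_⟩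
  · by_contra! h
    exact hs (Subtype.ext (funext h))
  obtain ⟨k, hk⟩ := exists_represents (orbit_mem_reg_one hf)
  obtain ⟨k', hk'⟩ := exists_represents (hD.smul_mem_reg_one hf)
  have hkk := hΔι f hf k k' hk hk'
  obtain ⟨p, t, h0, h1, h2⟩ := hk
  obtain ⟨p', t', h0', h1', h2'⟩ := hk'
  have key : E t * p * t' + t ^ 2 * s * p' = E p * t * t' := by
    have h3 := congrArg Δ h2
    rw [hΔ, hkk] at h3
    refine hinj ?_
    simp only [map_add, map_mul, map_pow, hE, ← h3, ← h2']
    rw [← h2]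
    ring
  filter_upwards [(groupStr L).eventually_ne (coordRing_le_reg 1 t.2) h0,
    (groupStr L).eventually_ne (coordRing_le_reg 1 t'.2) h0',
    eventually_one_smul ((flagStr P).eventually_mem hf)] with g hg hg' hfg
  have hF : (fun h : AdjointGroup L => f ((g * h) • x)) ∈ (groupStr L).reg 1 :=
    mul_left_mem_reg (f := fun h => f (h • x)) (orbit_mem_reg hfg)
  have h4 := (pd_lieDer H (X g)).mul _ (mul_left_mem_reg (coordRing_le_reg g t.2)) _ hF
  have h5 : ((fun h => t.1 (g * h)) * fun h : AdjointGroup L => f ((g * h) • x)) =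
      fun h => p.1 (g * h) := funext fun h => h1 (g * h)
  rw [h5, ← hEX, ← hEX] at h4
  simp only [mul_one] at h4
  have h6 := congrFun (congrArg Subtype.val key) g
  change (E t).1 g * p.1 g * t'.1 g + t.1 g ^ 2 * s.1 g * p'.1 g = (E p).1 g * t.1 g * t'.1 g at h6
  have h7 := h1 g
  have h8 := h1' g
  refine mul_left_cancel₀ (mul_ne_zero (pow_ne_zero 2 hg) hg') ?_
  linear_combination h6 + t.1 g ^ 2 * s.1 g * h8 + t.1 g * t'.1 g * h4 + t'.1 g * (E t).1 g * h7

/-- The tangent spaces of a homogeneous space are generated by the action of the group. -/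
theorem FunStr.PD.exists_lieDer (hD : PD (flagStr P) x D) :
    ∃ v : L, ∀ f ∈ (flagStr P).reg x, D f = lieDer H v (fun g => f (g • x)) := by
  obtain ⟨s, hs, ⟨g₀, hg₀⟩, X, hX, hsX⟩ := exists_orbit_vectorField H hD
  -- The elements of `L` that act trivially on `x` to first order. Working in a complement `C` makes
  -- coefficients unique, which the final division relies on.
  let N : Submodule ℂ L :=
    { carrier := {v | ∀ f ∈ (flagStr P).reg x, lieDer H v (fun g => f (g • x)) = 0}
      add_mem' := fun {v w} hv hw f hf => by
        rw [lieDer_add H v w (orbit_mem_reg_one hf), hv f hf, hw f hf, add_zero]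
      zero_mem' := fun f hf => (lieDerLin H (orbit_mem_reg_one hf)).map_zero
      smul_mem' := fun c v hv f hf => by
        rw [lieDer_smul H c v (orbit_mem_reg_one hf), hv f hf, mul_zero] }
  obtain ⟨C, hC⟩ := N.exists_isCompl
  let c := Module.finBasis ℂ C
  let π := C.projectionOnto N hC.symm
  let η : Fin (Module.finrank ℂ C) → Module.Dual ℂ L := fun i => (c.coord i).comp π
  have hη : ∀ v, ∀ f ∈ (flagStr P).reg x, lieDer H v (fun g => f (g • x)) =
      ∑ i, η i v * lieDer H (c i : L) (fun g => f (g • x)) := by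
    intro v f hf
    have h1 : v - (π v : L) ∈ N := by
      rw [← Submodule.projectionOnto_apply_eq_zero_iff hC.symm, map_sub, sub_eq_zero]
      exact (Submodule.projectionOnto_apply_left hC.symm _).symm
    have h2 := h1 f hf
    have h3 : (π v : L) = ∑ i, η i v • (c i : L) := by
      have := congrArg (Submodule.subtype C) (c.sum_repr (π v))
      rw [map_sum] at this
      exact this.symm
    let θ := lieDerLin H (orbit_mem_reg_one hf)
    have h4 : θ (v - (π v : L)) = 0 := h2
    rw [map_sub, h3, map_sum, sub_eq_zero] at h4
    simp only [map_smul, smul_eq_mul] at h4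
    exact h4
  -- Along a polynomial curve from `1` to a point where `s` is nonzero, `s` and the coordinates of
  -- `X` are polynomials in `t`, and `s` is not identically zero. Their common power of `t` is
  -- divided out.
  obtain ⟨γ, h0, h1, hγ⟩ := exists_polynomial_curve g₀
  have hγm : MorphAt line (groupStr L) γ 0 := morphAt_ofFunctions fun f hf => by
    obtain ⟨Q, hQ⟩ := hγ f (Algebra.subset_adjoin hf)
    rw [show f ∘ γ = fun t => Q.eval t from funext hQ]
    exact eval_mem_line Q 0
  obtain ⟨S, hS⟩ := hγ s hs
  choose Y hY using fun i => hγ _ (hX (η i))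
  have hS0 : S ≠ 0 := fun h => hg₀ (by rw [← h1, hS, h, Polynomial.eval_zero])
  obtain ⟨k, Z, hZ, hZ0⟩ := exists_factor_X (Y := fun o : Option _ => o.elim S Y) (i₀ := none) hS0
  have key : ∀ f ∈ (flagStr P).reg x, (Z none).eval 0 * D f =
      ∑ i, (Z (some i)).eval 0 * lieDer H (c i : L) (fun g => f (g • x)) := by
    intro f hf
    let A : ℂ → ℂ := fun t => D (fun z => f (γ t • z))
    let B : Fin (Module.finrank ℂ C) → ℂ → ℂ := fun i t =>
      lieDer H (c i : L) (fun h => f ((γ t * h) • x))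
    have hA : A ∈ line.reg 0 := hγm.comp_mem
      (fun g => D (fun z => f (g • z))) (by rw [h0]; exact hD.smul_mem_reg_one hf)
    have hB : ∀ i, B i ∈ line.reg 0 := fun i => hγm.comp_mem
      (fun g => lieDer H (c i : L) (fun h => f ((g * h) • x))) (by
        rw [h0]
        refine (pd_lieDer H (c i : L)).partial_mem (F := fun z => f ((z.1 * z.2) • x)) ?_
        refine (MorphAt.flag_smul (isMorphism_groupMul.morphAt (1, 1))
          (morphAt_const x _)).comp_mem f ?_
        simpa using hf)
    -- The divided relation holds for small `t ≠ 0`, and `W` is continuous at `0`, so it holds at `t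
    -- = 0`.
    let W : ℂ → ℂ := fun t => (Z none).eval t * A t - ∑ i, (Z (some i)).eval t * B i t
    have hW : ContinuousAt W 0 := by
      refine ContinuousAt.sub (ContinuousAt.mul (Polynomial.continuousAt _)
        (differentiableAt_of_mem_line hA).continuousAt) ?_
      exact tendsto_finsetSum _ fun i _ => ContinuousAt.mul (Polynomial.continuousAt _)
        (differentiableAt_of_mem_line (hB i)).continuousAt
    have hW0 : ∀ᶠ t in 𝓝[≠] (0 : ℂ), W t = 0 := by
      have h2 : ∀ᶠ t in @nhds _ line.top 0, s (γ t) * D (fun z => f (γ t • z)) =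
          lieDer H (X (γ t)) (fun h => f ((γ t * h) • x)) :=
        hγm.tendsto (by rw [h0]; exact hsX f hf)
      have h3 : ∀ᶠ t in @nhds _ line.top 0, f ∈ (flagStr P).reg (γ t • x) :=
        hγm.tendsto (by rw [h0]; exact eventually_one_smul ((flagStr P).eventually_mem hf))
      filter_upwards [nhdsWithin_le_nhds (nhds_line_le 0 h2), nhdsWithin_le_nhds (nhds_line_le 0 h3),
        self_mem_nhdsWithin] with t ht ht' ht0
      have h4 := hη (X (γ t)) _ (MixingSpace.smul_mem_reg ht')
      simp only [smul_smul] at h4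
      have ht : s (γ t) * A t = ∑ i, η i (X (γ t)) * B i t := ht.trans h4
      have hz : ∀ o, Polynomial.eval t (o.elim S Y) = t ^ k * (Z o).eval t := fun o => by
        rw [hZ o]; simp
      have e1 : s (γ t) = t ^ k * (Z none).eval t := (hS t).trans (hz none)
      have e2 : ∀ i, η i (X (γ t)) = t ^ k * (Z (some i)).eval t := fun i =>
        (hY i t).trans (hz (some i))
      simp only [e1, e2, mul_assoc] at ht
      rw [← Finset.mul_sum] at ht
      exact sub_eq_zero.2 (mul_left_cancel₀ (pow_ne_zero k ht0) ht)
    have h5 : W 0 = 0 := tendsto_nhds_unique (hW.tendsto.mono_left nhdsWithin_le_nhds)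
      (tendsto_const_nhds.congr' (hW0.mono fun t ht => ht.symm))
    simpa [W, A, B, h0, sub_eq_zero] using h5
  let v : C := ∑ i, (Z (some i)).eval 0 • c i
  have hv : ∀ f ∈ (flagStr P).reg x, (Z none).eval 0 * D f = lieDer H v (fun g => f (g • x)) := by
    intro f hf
    rw [key f hf]
    let θ := lieDerLin H (orbit_mem_reg_one hf)
    change _ = θ v
    simp only [v, AddSubmonoidClass.coe_finsetSum, SetLike.val_smul, map_sum, map_smul, smul_eq_mul]
    rfl
  -- If the coefficient of `D` were zero, `v` would lie in both `N` and `C`, so all coefficients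
  -- would vanish at `0`, against the choice of `Z`.
  by_cases hz : (Z none).eval 0 = 0
  · exfalso
    have hvN : (v : L) ∈ N := fun f hf => by rw [← hv f hf, hz, zero_mul]
    have hv0 : v = 0 := Subtype.ext (Submodule.disjoint_def.1 hC.disjoint _ hvN v.2)
    obtain ⟨o, ho⟩ := hZ0
    cases o with
    | none => exact ho hz
    | some i => exact ho (Fintype.linearIndependent_iff.1 c.linearIndependent _ hv0 i)
  · refine ⟨((Z none).eval 0)⁻¹ • (v : L), fun f hf => ?_⟩
    rw [lieDer_smul H _ _ (orbit_mem_reg_one hf), ← hv f hf, inv_mul_cancel_left₀ hz]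

include H in
/-- The tangent space at `h • x` of a homogeneous space is generated by the maps `g ↦ h • g • x`. -/
theorem FunStr.PD.exists_orbit {h : AdjointGroup L} {y : AdjointGroup L ⧸ P}
    (hD : PD (flagStr P) y D) (hy : h • x = y) : ∃ D', PD (groupStr L) 1 D' ∧
      ∀ f ∈ (flagStr P).reg y, D f = D' (fun g => f (h • g • x)) := by
  subst hy
  have h1 := hD.push (MorphAt.flag_smul (morphAt_const h⁻¹ _) (morphAt_id (h • x)))
  rw [inv_smul_smul] at h1
  obtain ⟨v, hv⟩ := h1.exists_lieDer H
  refine ⟨_, pd_lieDer H v, fun f hf => ?_⟩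
  rw [← hv _ (MixingSpace.smul_mem_reg hf)]
  congr 1
  funext z
  simp

end Orbit

/-! ### Bott–Samelson varieties: product map and left action. -/

section BottSamelson

variable {L : Type u} [LieRing L] [LieAlgebra ℂ L] [FiniteDimensional ℂ L] {q : ℕ}
  {K : Subgroup (AdjointGroup L)} {Q : Fin q → Subgroup (AdjointGroup L)}
  {X : Type*} {a : FunStr X} {x : X}

theorem morphAt_prod_ofFn : ∀ {q : ℕ} {f : Fin q → X → AdjointGroup L}
    (_ : ∀ j, MorphAt a (groupStr L) (f j) x),
    MorphAt a (groupStr L) (fun x => (List.ofFn fun j => f j x).prod) x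
  | 0, f, _ => by simpa using morphAt_const (1 : AdjointGroup L) x
  | q + 1, f, h => by
    simp only [List.ofFn_succ, List.prod_cons]
    exact (h 0).gmul (morphAt_prod_ofFn fun j => h j.succ)

omit [FiniteDimensional ℂ L] in
theorem FunStr.MorphAt.subgroup {f : X → K} (h : MorphAt a (groupStr L) (fun x => (f x).1) x) :
    MorphAt a (subgroupStr K) f x :=
  MorphAt.codRestrict h

omit [FiniteDimensional ℂ L] in
theorem FunStr.MorphAt.subgroup_val {f : X → K} (h : MorphAt a (subgroupStr K) f x) :
    MorphAt a (groupStr L) (fun x => (f x).1) x :=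
  ((isMorphism_subtype_val (K : Set (AdjointGroup L))).comp_at h :)

theorem isMorphism_bsToFlag (n : AdjointGroup L) (P : Subgroup (AdjointGroup L))
    (hn : ∀ k ∈ K, n⁻¹ * k * n ∈ P) :
    IsMorphism (bsStr K Q) (flagStr P) (bsToFlag n P hn) := by
  refine isMorphism_quot (IsMorphism.of_morphAt fun p => ?_)
  have h1 : MorphAt (FunStr.pi fun j => subgroupStr (Q j)) (groupStr L)
      (fun p => bsProd p * n) p :=
    (morphAt_prod_ofFn fun j =>
      MorphAt.subgroup_val ((isMorphism_pi_apply _ j).morphAt p)).gmul (morphAt_const n p)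
  exact (isMorphism_flag_mk.comp_at h1 :)

/-- The action on a Bott–Samelson variety is a morphism in the group variable. -/
theorem morphAt_bsAction (hQ : ∀ j, K ≤ Q j) {f : X → K} (h : MorphAt a (subgroupStr K) f x)
    (y : BottSamelson K Q) :
    MorphAt a (bsStr K Q) (fun x => (bsAction hQ).smul (f x) y) x := by
  induction y using Quotient.inductionOn with
  | h p =>
    have h1 : MorphAt a (FunStr.pi fun j => subgroupStr (Q j)) (fun x => bsMul hQ (f x) p) x := by
      refine morphAt_pi fun j => MorphAt.subgroup ?_
      refine MorphAt.gmul (f := fun x => ((if j.val = 0 then ⟨f x, hQ j (f x).2⟩ else 1 : Q j) : AdjointGroup L)) ?_ (morphAt_const _ _)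
      by_cases hj : j.val = 0
      · simpa only [hj, if_true] using h.subgroup_val
      · simpa only [hj, if_false] using morphAt_const _ _
    exact ((isMorphism_quot_mk _).comp_at h1 :)

end BottSamelson

/-! ### Smoothness of the multiplication map. -/

section Multiplication

variable {L : Type u} [LieRing L] [LieAlgebra ℂ L] [FiniteDimensional ℂ L]
  [LieAlgebra.IsKilling ℂ L] {H : LieSubalgebra ℂ L} [H.IsCartanSubalgebra]
  (b : (rootSystem H).Base) {q : ℕ} (w : Fin q → b.support)
  {P : Subgroup (AdjointGroup L)} (hP : IsParabolic b P)

/-- To reach all directions that come from the group, it suffices to reach those of the positive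
root subgroups and those of curves in the opposite Borel subgroup. -/
theorem reach_of_curves {Z : Type*} {W : Type*} {a : FunStr Z} {d : FunStr W} {φ : Z → W} {z : Z}
    {Ψ : AdjointGroup L → W} (hΨ : MorphAt (groupStr L) d Ψ 1) (hz : Ψ 1 = φ z)
    (hpos : ∀ (α : H.root), b.IsPos α → ∀ (x : L)
      (hx : x ∈ LieAlgebra.rootSpace H (α : LieModule.Weight ℂ H L)),
      Reach a d φ z (fun f => deriv (fun t => f (Ψ (expAd x (isNilpotent_ad_root α hx) t))) 0))
    (hopp : ∀ γ : ℂ → oppBorel b, γ 0 = 1 → MorphAt line (subgroupStr (oppBorel b)) γ 0 →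
      Reach a d φ z (fun f => deriv (fun t => f (Ψ (γ t))) 0))
    {D : (AdjointGroup L → ℂ) → ℂ} (hD : PD (groupStr L) 1 D) :
    Reach a d φ z (fun f => D (fun g => f (Ψ g))) := by
  refine pd_induction H (p := fun D => Reach a d φ z (fun f => D (fun g => f (Ψ g))))
    (fun _ _ h h' => h.add h') (fun c _ h => h.smul c)
    (fun D D' h h' => h.congr fun f hf => h' _ (hΨ.comp_mem f (by rwa [hz])))
    (fun α x hx => ?_) (fun γ hγ h0 hm => ?_) D hD
  · by_cases hα : b.IsPos α
    · exact hpos α hα x hx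
    · exact hopp (fun t => ⟨_, expAd_mem_oppBorel b hα hx t⟩)
        (Subtype.ext (expAd_zero (isNilpotent_ad_root α hx)))
        (MorphAt.subgroup ((isMorphism_expAd (isNilpotent_ad_root α hx)).morphAt 0))
  · exact hopp (fun t => ⟨γ t, torus_le_oppBorel b (hγ t)⟩) (Subtype.ext h0) (MorphAt.subgroup hm)

/-- Tangent vectors at `b₀ • x` are directions of `g ↦ b₀ • g • x`. For a positive root subgroup,
`g` is absorbed by the action of `B` on the Bott–Samelson factor; for `g` in `B⁻`, it is absorbed by
`b₀ * g`. -/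
theorem isSmooth_multMap : IsSmooth
    ((subgroupStr (oppBorel b)).prod (bsStr (borelSubgroup b) (wordParabolic b w)))
    (flagStr P) (multMap b w hP) := by
  have hm := isMorphism_bsToFlag (Q := wordParabolic b w) 1 P
    (fun k (hk : k ∈ borelSubgroup b) => hP.1 (by simpa using hk))
  refine isSmooth_of_reach (.of_morphAt fun z => ?_) ?_
  · exact MorphAt.flag_smul (isMorphism_fst.morphAt z).subgroup_val
      (hm.comp_at (isMorphism_snd.morphAt z) :)
  rintro ⟨b₀, y⟩ D hD
  obtain ⟨D', hD', hDD⟩ := hD.exists_orbit H (h := b₀) rfl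
  refine Reach.congr ?_ fun f hf => (hDD f hf).symm
  refine reach_of_curves b (Ψ := fun g => (b₀ : AdjointGroup L) • g • bsToFlag 1 P _ y)
    (MorphAt.flag_smul (morphAt_const _ _) (MorphAt.flag_smul (morphAt_id _) (morphAt_const _ _)))
    (by rw [one_smul]; rfl) (fun α hα x hx => ?_) (fun γ h0 hγ => ?_) hD'
  · have hn := isNilpotent_ad_root α hx
    refine Reach.congr (reach_curve (γ := fun t => (b₀, (bsAction (borel_le_wordParabolic b w)).smul
      ⟨expAd x hn t, expAd_mem_borel b hα hx t⟩ y)) ?_ ?_) fun f _ => ?_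
    · exact (morphAt_const _ _).prodMk
        (morphAt_bsAction _ (MorphAt.subgroup ((isMorphism_expAd hn).morphAt 0)) y)
    · refine Prod.ext rfl ?_
      have : (⟨expAd x hn 0, expAd_mem_borel b hα hx 0⟩ : borelSubgroup b) = 1 :=
        Subtype.ext (expAd_zero hn)
      change (bsAction (borel_le_wordParabolic b w)).smul _ y = y
      rw [this]
      exact (bsAction (borel_le_wordParabolic b w)).one_smul y
    · simp only [multMap, bsToFlag_smul]
  · refine Reach.congr (reach_curve (γ := fun t => (b₀ * γ t, y)) ?_ ?_) fun f _ => ?_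
    · exact (MorphAt.subgroup ((morphAt_const _ _).gmul hγ.subgroup_val)).prodMk (morphAt_const _ _)
    · simp only [h0, mul_one]
    · simp only [multMap, Subgroup.coe_mul, mul_smul]

end Multiplication

/-! ### Characters of the subtorus on root spaces. -/

section Characters

variable {L : Type u} [LieRing L] [LieAlgebra ℂ L] [FiniteDimensional ℂ L]
  [LieAlgebra.IsKilling ℂ L] {H : LieSubalgebra ℂ L} [H.IsCartanSubalgebra]

open LieAlgebra LieModule in
/-- The bracket of two root spaces whose sum is a root space does not vanish. -/
theorem exists_lie_ne_zero {α β γ : Weight ℂ H L} (hα : α.IsNonZero)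
    (h : (γ : H → ℂ) = α + β) :
    ∃ x ∈ rootSpace H α, ∃ y ∈ rootSpace H β, ⁅x, y⁆ ≠ 0 := by
  have hα' : (-α).IsNonZero := hα.neg
  -- In the `sl₂` of `-α`, with lowering operator `f` of weight `α`, start from a highest weight
  -- vector of the chain through `β` and lower it to weight `β`. As `α + β` is still in the chain,
  -- lowering once more gives a nonzero vector.
  obtain ⟨x, hx, x_ne0⟩ := (chainTop (-α) β).exists_ne_zero
  obtain ⟨h', e, f, isSl2, he, hf⟩ := exists_isSl2Triple_of_weight_isNonZero hα'
  obtain rfl := isSl2.h_eq_coroot hα' he hf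
  have prim : isSl2.HasPrimitiveVectorWith x (chainLength (-α) β : ℂ) :=
    have := lie_mem_genWeightSpace_of_mem_genWeightSpace he hx
    ⟨x_ne0, (chainLength_smul _ _ hx).symm, by rwa [genWeightSpace_add_chainTop _ _ hα'] at this⟩
  have hbot : 1 ≤ chainBotCoeff (-α) β := by
    have h1 : rootSpace H ((-1 : ℤ) • ((-α : Weight ℂ H L) : H → ℂ) + β) ≠ ⊥ := by
      have : ((-1 : ℤ) • ((-α : Weight ℂ H L) : H → ℂ) + β) = γ := by
        rw [h, Weight.coe_neg]; simp
      rw [this]; exact γ.genWeightSpace_ne_bot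
    have := (rootSpace_zsmul_add_ne_bot_iff (-α) β hα' (-1)).1 h1
    omega
  have hlen := chainBotCoeff_add_chainTopCoeff (-α) β
  refine ⟨f, by simpa using hf, (toEnd ℂ L L f ^ chainTopCoeff ((-α : Weight ℂ H L) : H → ℂ) β) x,
    ?_, ?_⟩
  · have h1 := toEnd_pow_apply_mem hf hx (chainTopCoeff (-α) β)
    have h2 : chainTopCoeff (-α) β • -((-α : Weight ℂ H L) : H → ℂ) +
        (chainTop (-α) β : H → ℂ) = β := by
      rw [coe_chainTop, Weight.coe_neg]
      simp
    rwa [h2] at h1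
  · have h3 := prim.pow_toEnd_f_ne_zero_of_eq_nat rfl
      (i := chainTopCoeff (-α) β + 1) (by omega)
    rwa [pow_succ', Module.End.mul_apply, toEnd_apply_apply] at h3

theorem torus_apply_mem {g : AdjointGroup L} (hg : g ∈ torus H) {χ : LieModule.Weight ℂ H L} {x : L}
    (hx : x ∈ LieAlgebra.rootSpace H χ) : g.1 x ∈ LieAlgebra.rootSpace H χ := by
  refine LieModule.weightSpace_le_genWeightSpace L _
    ((LieModule.mem_weightSpace _ _).2 fun h => ?_)
  have e : ⁅(h : L), x⁆ = χ h • x := lie_eq_smul_of_mem_rootSpace hx h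
  have e' := innerAut_lie g.2 (h : L) x
  rw [e, hg _ h.2, map_smul] at e'
  exact e'.symm

theorem exists_smul_of_mem_rootSpace (α : H.root) {x y : L}
    (hx : x ∈ LieAlgebra.rootSpace H (α : LieModule.Weight ℂ H L)) (h0 : x ≠ 0)
    (hy : y ∈ LieAlgebra.rootSpace H (α : LieModule.Weight ℂ H L)) : ∃ c : ℂ, c • x = y := by
  obtain ⟨c, hc⟩ := (finrank_eq_one_iff_of_nonzero' (⟨x, hx⟩ : LieAlgebra.rootSpace H (α : LieModule.Weight ℂ H L))
    (by simpa using h0)).1 (finrank_rootSpace_eq_one _ (H.isNonZero_coe_root α)) ⟨y, hy⟩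
  exact ⟨c, congrArg Subtype.val hc⟩

variable {b : (rootSystem H).Base} {r : ℕ} {σ : Subtorus H r}

/-- Induction on positive roots, adding one simple root at a time: torus elements preserve brackets,
and the one-dimensional space of the sum is spanned by a nonzero bracket, so characters multiply. -/
theorem exists_character_of_isPos (hσ : σ.IsPositive b) {α : H.root} (hα : b.IsPos α) :
    ∃ k : Fin r → ℕ, ∀ s : σ.S, ∀ x ∈ LieAlgebra.rootSpace H (α : LieModule.Weight ℂ H L),
      s.1.1 x = (∏ i, (σ.β s i : ℂ) ^ k i) • x := by
  refine RootPairing.Base.IsPos.induction_on_add hα (p := fun α : H.root => ∃ k : Fin r → ℕ,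
    ∀ s : σ.S, ∀ x ∈ LieAlgebra.rootSpace H (α : LieModule.Weight ℂ H L),
      s.1.1 x = (∏ i, (σ.β s i : ℂ) ^ k i) • x) hσ ?_
  rintro α β γ h ⟨k, hk⟩ hβ
  obtain ⟨l, hl⟩ := hσ β hβ
  have h' : ((γ : LieModule.Weight ℂ H L) : H → ℂ) =
      (α : LieModule.Weight ℂ H L) + (β : LieModule.Weight ℂ H L) := by
    funext x
    exact LinearMap.congr_fun h x
  obtain ⟨x, hx, y, hy, hxy⟩ := exists_lie_ne_zero (H.isNonZero_coe_root α) h'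
  have hm := LieAlgebra.lie_mem_genWeightSpace_of_mem_genWeightSpace hx hy
  rw [← h'] at hm
  refine ⟨k + l, fun s z hz => ?_⟩
  obtain ⟨c, rfl⟩ := exists_smul_of_mem_rootSpace γ hm hxy hz
  have := val_lie s.1 x y
  rw [hk s x hx, hl s y hy, smul_lie, lie_smul, smul_smul, ← Finset.prod_mul_distrib] at this
  rw [map_smul, this, smul_comm]
  simp only [Pi.add_apply, pow_add]

/-- The characters of the torus on the root spaces. -/
theorem exists_character (hσ : σ.IsPositive b) (α : H.root) :
    ∃ k : Fin r → ℤ, ∀ s : σ.S, ∀ x ∈ LieAlgebra.rootSpace H (α : LieModule.Weight ℂ H L),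
      s.1.1 x = (∏ i, (σ.β s i : ℂ) ^ k i) • x := by
  let := (rootSystem H).indexNeg
  rcases RootPairing.Base.IsPos.or_neg b α with hα | hα
  · obtain ⟨k, hk⟩ := exists_character_of_isPos hσ hα
    exact ⟨fun i => k i, by simpa using hk⟩
  · obtain ⟨k, hk⟩ := exists_character_of_isPos hσ hα
    refine ⟨fun i => -(k i), fun s x hx => ?_⟩
    -- The torus fixes `h = ⁅e, f⁆`, so its eigenvalues on `e` and `f` are inverse to each other.
    obtain ⟨h, e, f, t, he, hf⟩ :=
      exists_isSl2Triple_of_weight_isNonZero (H.isNonZero_coe_root α)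
    have heq := t.h_eq_coroot (H.isNonZero_coe_root α) he hf
    obtain ⟨c, hc⟩ := exists_smul_of_mem_rootSpace α he t.e_ne_zero
      (torus_apply_mem (σ.le_torus s.2) he)
    have hf' : s.1.1 f = (∏ i, (σ.β s i : ℂ) ^ k i) • f := by
      have h0 : (((-α : H.root) : LieModule.Weight ℂ H L) : H → ℂ) =
          -((α : LieModule.Weight ℂ H L) : H → ℂ) := by
        funext y
        have : (rootSystem H).root (-α) = -(rootSystem H).root α :=
          ((rootSystem H).root_reflectionPerm α α).trans ((rootSystem H).reflection_apply_self α)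
        exact LinearMap.congr_fun this y
      exact hk s f (by rwa [h0])
    have h1 := val_lie s.1 e f
    rw [t.lie_e_f, ← hc, hf', smul_lie, lie_smul, t.lie_e_f, smul_smul,
      σ.le_torus s.2 h (by rw [heq]; exact SetLike.coe_mem _)] at h1
    have h2 : c * ∏ i, (σ.β s i : ℂ) ^ k i = 1 := by
      have : (1 - c * ∏ i, (σ.β s i : ℂ) ^ k i) • h = 0 := by rw [sub_smul, one_smul, ← h1, sub_self]
      have := (smul_eq_zero.1 this).resolve_right t.h_ne_zero
      linear_combination -this
    obtain ⟨d, rfl⟩ := exists_smul_of_mem_rootSpace α he t.e_ne_zero hx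
    rw [map_smul, ← hc, smul_comm]
    simp only [zpow_neg, zpow_natCast, Finset.prod_inv_distrib]
    rw [eq_inv_of_mul_eq_one_left h2]

end Characters

/-! ### Regular functions on the line, degree bounds, grids. -/

section Polynomials

open Polynomial

/-- A function that is regular on the whole affine line is a polynomial. -/
theorem exists_polynomial_of_mem_line {f : ℂ → ℂ} (h : ∀ z, f ∈ line.reg z) :
    ∃ P : ℂ[X], ∀ t, f t = P.eval t := by
  suffices key : ∀ (n : ℕ) (P Q : ℂ[X]), Q.natDegree = n → Q ≠ 0 →
      (∀ t, Q.eval t * f t = P.eval t) → ∃ P : ℂ[X], ∀ t, f t = P.eval t by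
    obtain ⟨P, Q, hQ, hPQ⟩ := exists_fraction_line (h 0)
    exact key _ P Q rfl (fun h => hQ (by simp [h])) hPQ
  intro n
  induction n with
  | zero =>
    intro P Q hn hQ hPQ
    rw [eq_C_of_natDegree_eq_zero hn] at hQ hPQ
    have h0 : Q.coeff 0 ≠ 0 := fun h => hQ (by rw [h, C_0])
    refine ⟨C (Q.coeff 0)⁻¹ * P, fun t => ?_⟩
    rw [eval_mul, eval_C, ← hPQ t, eval_C, inv_mul_cancel_left₀ h0]
  | succ n ih =>
    intro P Q hn hQ hPQ
    -- At a root `z` of the denominator a second fraction, with denominator nonzero at `z`, recovers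
    -- the value of `f` at `z` after `X - z` has been cancelled.
    obtain ⟨z, hz⟩ := Complex.exists_root (f := Q) (natDegree_pos_iff_degree_pos.1 (by omega))
    obtain ⟨P₁, Q₁, hQ₁, hPQ₁⟩ := exists_fraction_line (h z)
    have hzP : P.IsRoot z := by rw [IsRoot, ← hPQ, hz, zero_mul]
    obtain ⟨Q', rfl⟩ := dvd_iff_isRoot.2 hz
    obtain ⟨P', rfl⟩ := dvd_iff_isRoot.2 hzP
    have hX : (X - C z : ℂ[X]) ≠ 0 := X_sub_C_ne_zero z
    have hQ' : Q' ≠ 0 := right_ne_zero_of_mul hQ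
    have hcross : Q₁ * P' = Q' * P₁ := by
      refine mul_left_cancel₀ hX (Polynomial.funext fun t => ?_)
      have e1 := hPQ t
      have e2 := hPQ₁ t
      simp only [eval_mul] at e1 ⊢
      linear_combination -(Q₁.eval t) * e1 + (X - C z).eval t * Q'.eval t * e2
    refine ih P' Q' ?_ hQ' fun t => ?_
    · rw [natDegree_mul hX hQ', natDegree_X_sub_C] at hn; omega
    · by_cases ht : t = z
      · subst ht
        have e := congrArg (eval t) hcross
        rw [eval_mul, eval_mul, ← hPQ₁ t] at e
        refine mul_left_cancel₀ hQ₁ ?_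
        linear_combination -e
      · have := hPQ t
        rw [eval_mul, eval_mul, mul_assoc] at this
        exact mul_left_cancel₀ (by simpa [sub_eq_zero] using ht) this

/-- The pole of `P` at infinity has order at most `d`. After multiplication by a power of `X`,
`Q(1/t)` becomes the reversed polynomial of `Q`, and degrees can be compared. -/
theorem natDegree_le_of_eval_inv {P Q : ℂ[X]} {d : ℤ}
    (h : ∀ t, t ≠ 0 → P.eval t = t ^ d * Q.eval t⁻¹) : P.natDegree ≤ d.toNat := by
  by_cases hP : P = 0
  · simp [hP]
  have key : X ^ (Q.natDegree + (-d).toNat) * P = X ^ d.toNat * Q.reverse := by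
    refine eq_of_infinite_eval_eq _ _ (Set.Infinite.mono (s := {0}ᶜ) (fun t (ht : t ≠ 0) => ?_)
      (Set.finite_singleton (0 : ℂ)).infinite_compl)
    have h1 : Q.reverse.eval t = t ^ Q.natDegree * Q.eval t⁻¹ := by
      let _ : Invertible t⁻¹ := invertibleOfNonzero (inv_ne_zero ht)
      have := eval₂_reverse_mul_pow (RingHom.id ℂ) t⁻¹ Q
      simp only [eval₂_id, invOf_eq_inv, inv_inv] at this
      rw [← this, inv_pow, mul_comm, mul_assoc, inv_mul_cancel₀ (pow_ne_zero _ ht), mul_one]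
    have h2 : t ^ (-d).toNat * t ^ d = t ^ d.toNat := by
      rw [← zpow_natCast t, ← zpow_natCast t, ← zpow_add₀ ht]
      congr 1; omega
    change eval t _ = eval t _
    rw [eval_mul, eval_mul, eval_pow, eval_pow, eval_X, h t ht, h1, pow_add, ← h2]
    ring
  have hd := congrArg natDegree key
  rw [natDegree_mul (pow_ne_zero _ X_ne_zero) hP, natDegree_X_pow] at hd
  have h3 := (natDegree_mul_le (p := X ^ d.toNat) (q := Q.reverse))
  have h4 := reverse_natDegree_le Q
  rw [natDegree_X_pow] at h3
  omega

/-- A function that is polynomial of degree at most `D` in every variable and vanishes on a grid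
with `D + 1` values for each variable vanishes. -/
theorem eq_zero_of_grid {ι : Type*} [Fintype ι] [DecidableEq ι] {g : (ι → ℂ) → ℂ} {D : ℕ}
    (hg : ∀ c j, ∃ P : ℂ[X], P.natDegree ≤ D ∧ ∀ t, g (Function.update c j t) = P.eval t)
    (h0 : ∀ c : ι → Fin (D + 1), g (fun j => ((c j : ℕ) : ℂ)) = 0) (c : ι → ℂ) : g c = 0 := by
  -- Induction on the set `T` of variables that are free, the others taking grid values.
  suffices key : ∀ (T : Finset ι) (c : ι → ℂ),
      (∀ j, j ∉ T → ∃ n : Fin (D + 1), c j = ((n : ℕ) : ℂ)) → g c = 0 from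
    key Finset.univ c fun j hj => absurd (Finset.mem_univ j) hj
  intro T
  induction T using Finset.induction_on with
  | empty =>
    intro c hc
    choose n hn using fun j => hc j (Finset.notMem_empty j)
    rw [show c = fun j => ((n j : ℕ) : ℂ) from funext hn]
    exact h0 n
  | insert j T hj ih =>
    intro c hc
    obtain ⟨P, hP, hPe⟩ := hg c j
    have hP0 : P = 0 := by
      refine eq_zero_of_natDegree_lt_card_of_eval_eq_zero P
        (f := fun n : Fin (D + 1) => ((n : ℕ) : ℂ))
        (fun a a' h => Fin.ext (Nat.cast_injective h)) (fun n => ?_) (by simpa using hP)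
      rw [← hPe]
      refine ih _ fun j' hj' => ?_
      by_cases hjj : j' = j
      · subst hjj; exact ⟨n, by simp⟩
      · rw [Function.update_of_ne hjj]
        exact hc j' (by simp [hjj, hj'])
    have := hPe (c j)
    rwa [Function.update_eq_self, hP0, eval_zero] at this

end Polynomials

/-! ### Finite-dimensionality of spaces of homogeneous functions. -/

section Homogeneous

variable {r m : ℕ}

/-- The regular functions on `(ℂ^(m+1) ∖ 0)^r` that are homogeneous of a given multidegree. -/
def homogeneous (r m : ℕ) (d : Fin r → ℤ) : Submodule ℂ (ETotal r m → ℂ) where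
  carrier := {F | (∀ e, F ∈ (eStr r m).reg e) ∧
    ∀ (t : Fin r → ℂˣ) (e : ETotal r m), F (t • e) = (∏ i, (t i : ℂ) ^ d i) * F e}
  add_mem' h h' := ⟨fun e => add_mem (h.1 e) (h'.1 e), fun t e => by
    simp only [Pi.add_apply, h.2, h'.2, mul_add]⟩
  zero_mem' := ⟨fun _ => zero_mem _, fun _ _ => by simp⟩
  smul_mem' z F h := ⟨fun e => Subalgebra.smul_mem _ (h.1 e) z, fun t e => by
    simp only [Pi.smul_apply, h.2, smul_eq_mul]; ring⟩

/-- The point of `(ℂ^(m+1) ∖ 0)^r` with given affine coordinates. -/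
def chartPt (k : Fin r → Fin (m + 1)) (c : Fin r × Fin (m + 1) → ℂ) : ETotal r m where
  vec i l := if l = k i then 1 else c (i, l)
  vec_ne i h := by simpa using congrFun h (k i)

theorem exists_smul_chartPt (e : ETotal r m) :
    ∃ (t : Fin r → ℂˣ) (k : Fin r → Fin (m + 1)) (c : Fin r × Fin (m + 1) → ℂ),
      e = t • chartPt k c := by
  choose k hk using fun i => Function.ne_iff.1 (e.vec_ne i)
  refine ⟨fun i => Units.mk0 _ (hk i), k, fun j => e.vec j.1 j.2 / e.vec j.1 (k j.1),
    ETotal.ext' fun i => funext fun l => ?_⟩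
  rw [torus_smul_vec]
  by_cases hl : l = k i
  · simp [chartPt, hl]
  · simp only [Units.val_mk0, chartPt, Pi.smul_apply, hl, if_false, smul_eq_mul]
    exact (mul_div_cancel₀ _ (hk i)).symm

theorem morphAt_eStr {X : Type*} {a : FunStr X} {φ : X → ETotal r m} {x : X}
    (h : ∀ i l, (fun x => (φ x).vec i l) ∈ a.reg x) : MorphAt a (eStr r m) φ x :=
  morphAt_ofFunctions fun _ hf => by
    obtain ⟨i, l, rfl⟩ := hf
    exact h i l

theorem ite_mem_line {p : Prop} [Decidable p] {f g : ℂ → ℂ} {z : ℂ} (hf : f ∈ line.reg z)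
    (hg : g ∈ line.reg z) : (fun t => if p then f t else g t) ∈ line.reg z := by
  by_cases hp : p
  · simpa only [hp, if_true] using hf
  · simpa only [hp, if_false] using hg

/-- On a line parallel to an axis in an affine chart, a homogeneous function is a section of `O(d
i)` on a projective line: it is polynomial in `t`, and polynomial in `t⁻¹` up to the factor `t ^ d
i`. The sum bounds all degrees at once. -/
theorem exists_polynomial_chartPt {d : Fin r → ℤ} {F : ETotal r m → ℂ} (hF : F ∈ homogeneous r m d)
    (k : Fin r → Fin (m + 1)) (c : Fin r × Fin (m + 1) → ℂ) (j : Fin r × Fin (m + 1)) :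
    ∃ P : Polynomial ℂ, P.natDegree ≤ ∑ i, (d i).toNat ∧
      ∀ t, F (chartPt k (Function.update c j t)) = P.eval t := by
  obtain ⟨i, l⟩ := j
  by_cases hl : l = k i
  · refine ⟨Polynomial.C (F (chartPt k c)), by simp, fun t => ?_⟩
    rw [Polynomial.eval_C]
    refine congrArg F (ETotal.ext' fun i' => funext fun l' => ?_)
    simp only [chartPt]
    by_cases h : l' = k i'
    · simp [h]
    · simp only [h, if_false]
      rw [Function.update_of_ne]
      rintro ⟨⟩
      exact h hl
  -- The same line in the chart at infinity: the `i`-th vector divided by `t`, with `s = t⁻¹`.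
  let G : ℂ → ETotal r m := fun s =>
    { vec := fun i' l' => if i' = i then (if l' = l then 1 else if l' = k i then s else s * c (i, l'))
        else (if l' = k i' then 1 else c (i', l'))
      vec_ne := fun i' h => by
        by_cases hi : i' = i
        · simpa [hi] using congrFun h l
        · simpa [hi] using congrFun h (k i') }
  obtain ⟨P, hP⟩ := exists_polynomial_of_mem_line
    (f := fun t => F (chartPt k (Function.update c (i, l) t))) fun z => by
      refine MorphAt.comp_mem (b := eStr r m) (φ := fun t => chartPt k (Function.update c (i, l) t))
        (morphAt_eStr fun i' l' => ?_) F (hF.1 _)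
      refine ite_mem_line (const_mem _ _) ?_
      by_cases h : (i', l') = (i, l)
      · simpa only [h, Function.update_self] using id_mem_line z
      · simpa only [Function.update_of_ne h] using const_mem _ _
  obtain ⟨Q, hQ⟩ := exists_polynomial_of_mem_line (f := fun s => F (G s)) fun z => by
      refine MorphAt.comp_mem (b := eStr r m) (φ := G) (morphAt_eStr fun i' l' => ?_) F (hF.1 _)
      refine ite_mem_line (ite_mem_line (const_mem _ _) (ite_mem_line (id_mem_line z) ?_))
        (const_mem _ _)
      exact mul_mem (id_mem_line z) (const_mem z (c (i, l')))
  refine ⟨P, ?_, hP⟩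
  refine (natDegree_le_of_eval_inv (d := d i) (Q := Q) fun t ht => ?_).trans
    (Finset.single_le_sum (f := fun i => (d i).toNat) (fun _ _ => Nat.zero_le _)
      (Finset.mem_univ i))
  rw [← hP, ← hQ]
  have h1 := hF.2 (Function.update 1 i (Units.mk0 t ht)) (G t⁻¹)
  have h2 : ∏ i', ((Function.update 1 i (Units.mk0 t ht) : Fin r → ℂˣ) i' : ℂ) ^ d i' = t ^ d i := by
    rw [Finset.prod_eq_single i]
    · simp
    · intro i' _ hi; simp [Function.update_of_ne hi]
    · simp
  rw [h2] at h1
  rw [← h1]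
  refine congrArg F (ETotal.ext' fun i' => funext fun l' => ?_)
  rw [torus_smul_vec, Pi.smul_apply, smul_eq_mul]
  simp only [chartPt, G]
  by_cases hi : i' = i
  · subst hi
    simp only [Function.update_self, Units.val_mk0, if_true]
    by_cases h1 : l' = l
    · subst h1; simp [hl]
    · by_cases h2 : l' = k i'
      · simp [h2, ht, Ne.symm hl]
      · simp [h1, h2, mul_inv_cancel_left₀ ht]
  · simp [hi]

/-- The charts cover everything up to the torus, and bounded degree in each coordinate makes
evaluation on a finite grid in every chart injective. -/
theorem homogeneous_fg (d : Fin r → ℤ) : (homogeneous r m d).FG := by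
  let D := ∑ i, (d i).toNat
  let ev : homogeneous r m d →ₗ[ℂ]
      ((Fin r → Fin (m + 1)) × (Fin r × Fin (m + 1) → Fin (D + 1)) → ℂ) :=
    { toFun := fun F z => F.1 (chartPt z.1 fun j => ((z.2 j : ℕ) : ℂ))
      map_add' := fun _ _ => rfl
      map_smul' := fun _ _ => rfl }
  have hev : Function.Injective ev := by
    rw [← LinearMap.ker_eq_bot]
    refine LinearMap.ker_eq_bot'.2 fun F hF => Subtype.ext (funext fun e => ?_)
    obtain ⟨t, k, c, rfl⟩ := exists_smul_chartPt e
    rw [F.2.2]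
    have : F.1 (chartPt k c) = 0 := eq_zero_of_grid (g := fun c => F.1 (chartPt k c)) (D := D)
      (fun c j => exists_polynomial_chartPt F.2 k c j) (fun c => congrFun hF (k, c)) c
    rw [this, mul_zero]; rfl
  exact Module.Finite.iff_fg.1 (Module.Finite.of_injective ev hev)

end Homogeneous

/-! ### Sections of the group scheme and their evaluation. -/

section Sections

variable {L : Type u} [LieRing L] [LieAlgebra ℂ L] [FiniteDimensional ℂ L]
  [LieAlgebra.IsKilling ℂ L] {H : LieSubalgebra ℂ L} [H.IsCartanSubalgebra]
  {b : (rootSystem H).Base} {r : ℕ} {σ : Subtorus H r}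

/-- The Lie algebra has a basis of eigenvectors of the torus. -/
theorem exists_eigenbasis (hσ : σ.IsPositive b) :
    ∃ (ι : Type u) (_ : Fintype ι) (c : Module.Basis ι ℂ L) (κ : ι → Fin r → ℤ),
      ∀ (s : σ.S) j, s.1.1 (c j) = (∏ i, (σ.β s i : ℂ) ^ κ j i) • c j := by
  let E : Set L := {x | ∃ k : Fin r → ℤ, ∀ s : σ.S, s.1.1 x = (∏ i, (σ.β s i : ℂ) ^ k i) • x}
  have hE : ⊤ ≤ Submodule.span ℂ E := by
    have h1 := congrArg LieSubmodule.toSubmodule (LieModule.iSup_genWeightSpace_eq_top' ℂ H L)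
    rw [LieSubmodule.iSup_toSubmodule, LieSubmodule.top_toSubmodule] at h1
    rw [← h1]
    refine iSup_le fun χ y hy => Submodule.subset_span ?_
    by_cases hχ : χ.IsZero
    · have hy : y ∈ LieModule.genWeightSpace L (χ : H → ℂ) := hy
      rw [hχ] at hy
      have hy := SetLike.ext_iff.1 (LieAlgebra.rootSpace_zero_eq ℂ L H) _ |>.1 hy
      exact ⟨0, fun s => by simpa using σ.le_torus s.2 y hy⟩
    · obtain ⟨k, hk⟩ := exists_character hσ (⟨χ, by simpa using hχ⟩ : H.root)
      exact ⟨k, fun s => hk s y hy⟩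
  let c := Module.Basis.ofSpan hE
  have hc : ∀ j, c j ∈ E := fun j => Module.Basis.ofSpan_subset hE ⟨j, rfl⟩
  choose κ hκ using hc
  exact ⟨_, FiniteDimensional.fintypeBasisIndex c, c, κ, fun s j => hκ j s⟩

variable {m : ℕ} {K : Subgroup (AdjointGroup L)}

/-- The matrix coefficients of a section can be interpolated from finitely many of its values. -/
theorem exists_section_interpolation (hσ : σ.IsPositive b) (ξ : Module.Dual ℂ L) (v : L) :
    ∃ (ι : Type u) (_ : Fintype ι) (z : ι → ETotal r m) (η : ι → Module.Dual ℂ L) (y : ι → L)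
      (p : ι → ETotal r m → ℂ), (∀ i e, p i ∈ (eStr r m).reg e) ∧
      ∀ f ∈ sectionGroup σ m K, ∀ e, ξ ((f e).1 v) = ∑ i, η i ((f (z i)).1 (y i)) * p i e := by
  obtain ⟨ι, _, c, κ, hκ⟩ := exists_eigenbasis hσ
  have hco : ∀ (s : σ.S) j x, c.coord j (s.1.1 x) = (∏ i, (σ.β s i : ℂ) ^ κ j i) * c.coord j x := by
    intro s j x
    have : (c.coord j).comp (s.1.1 : L →ₗ[ℂ] L) = (∏ i, (σ.β s i : ℂ) ^ κ j i) • c.coord j := by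
      refine c.ext fun l => ?_
      change c.coord j (s.1.1 (c l)) = (∏ i, (σ.β s i : ℂ) ^ κ j i) * c.coord j (c l)
      rw [hκ, map_smul, smul_eq_mul]
      by_cases h : l = j
      · rw [h]
      · simp [h]
    exact LinearMap.congr_fun this x
  have hinv : ∀ (s : σ.S) j, (s.1⁻¹).1 (c j) = (∏ i, (σ.β s i : ℂ) ^ (-κ j i)) • c j := by
    intro s j
    have h1 := hκ s⁻¹ j
    simpa only [map_inv, Pi.inv_apply, Units.val_inv_eq_inv_val, inv_zpow', InvMemClass.coe_inv]
      using h1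
  -- In an eigenbasis, equivariance under conjugation says that each matrix entry of a section is
  -- homogeneous, of multidegree the difference of two weights. These degrees do not depend on the
  -- section.
  have hhom : ∀ f ∈ sectionGroup σ m K, ∀ j l, (fun e => c.coord j ((f e).1 (c l))) ∈
      homogeneous r m (κ j - κ l) := by
    intro f hf j l
    refine ⟨fun e => IsMorphism.coeff_mem hf.2.2 _ _ e, fun t e => ?_⟩
    obtain ⟨s, rfl⟩ := σ.β.surjective t
    change c.coord j ((f (σ.β s • e)).1 (c l)) = _ * c.coord j ((f e).1 (c l))
    rw [hf.2.1 s e, val_mul, val_mul, hinv, map_smul, map_smul, map_smul, smul_eq_mul, hco,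
      ← mul_assoc, ← Finset.prod_mul_distrib]
    congr 1
    refine Finset.prod_congr rfl fun i _ => ?_
    rw [← zpow_add₀ (Units.ne_zero _), Pi.sub_apply, neg_add_eq_sub]
  choose n z p hp _ hz using fun j l =>
    exists_interpolation _ (homogeneous_fg (r := r) (m := m) (κ j - κ l))
  refine ⟨Σ j : ι, Σ l : ι, Fin (n j l), inferInstance, fun i => z i.1 i.2.1 i.2.2,
    fun i => (ξ (c i.1) * c.coord i.2.1 v) • c.coord i.1, fun i => c i.2.1,
    fun i => p i.1 i.2.1 i.2.2, fun i e => (hp i.1 i.2.1 i.2.2).1 e, fun f hf e => ?_⟩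
  rw [Fintype.sum_sigma, dual_eq_sum c ξ]
  refine Finset.sum_congr rfl fun j _ => ?_
  rw [Fintype.sum_sigma]
  have h1 := dual_eq_sum c ((c.coord j).comp ((f e).1 : L →ₗ[ℂ] L)) v
  have h2 : ((c.coord j).comp ((f e).1 : L →ₗ[ℂ] L)) v = c.coord j ((f e).1 v) := rfl
  rw [← h2, h1, Finset.sum_mul]
  refine Finset.sum_congr rfl fun l _ => ?_
  have h3 := hz j l _ (hhom f hf j l) e
  have h4 : ((c.coord j).comp ((f e).1 : L →ₗ[ℂ] L)) (c l) = c.coord j ((f e).1 (c l)) := rfl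
  rw [h4, h3, Finset.mul_sum, Finset.sum_mul]
  refine Finset.sum_congr rfl fun i _ => ?_
  simp only [LinearMap.smul_apply, smul_eq_mul]
  ring

omit [LieAlgebra.IsKilling ℂ L] [H.IsCartanSubalgebra] in
theorem isMorphism_eval (e : ETotal r m) :
    IsMorphism (sectionStr σ m K) (groupStr L) (fun f => f.1 e) :=
  isMorphism_induced (fun _ : ETotal r m => groupStr L)
    (fun e (f : sectionGroup σ m K) => f.1 e) e

omit [LieAlgebra.IsKilling ℂ L] [H.IsCartanSubalgebra] in
theorem morphAt_section {X : Type*} {a : FunStr X} {φ : X → sectionGroup σ m K} {x : X}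
    (h : ∀ e, MorphAt a (groupStr L) (fun x => (φ x).1 e) x) :
    MorphAt a (sectionStr σ m K) φ x :=
  morphAt_induced h

/-- Evaluation of sections is a morphism. -/
theorem FunStr.MorphAt.section_eval (hσ : σ.IsPositive b) {X : Type*} {a : FunStr X}
    {φ : X → sectionGroup σ m K} {ψ : X → ETotal r m} {x : X}
    (hφ : MorphAt a (sectionStr σ m K) φ x) (hψ : MorphAt a (eStr r m) ψ x) :
    MorphAt a (groupStr L) (fun x => (φ x).1 (ψ x)) x := by
  have hev : ∀ e, MorphAt a (groupStr L) (fun x => (φ x).1 e) x := fun e =>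
    ((isMorphism_eval e).comp_at hφ :)
  -- The structure on sections only knows evaluations at fixed points. Interpolation expresses the
  -- value at a moving point through finitely many of these; inverse coefficients are those of the
  -- inverse section.
  refine morphAt_ofFunctions fun f hf => ?_
  rcases hf with ⟨ξ, v, rfl⟩ | ⟨ξ, v, rfl⟩
  · obtain ⟨ι, _, z, η, y, p, hp, h⟩ := exists_section_interpolation (m := m) (K := K) hσ ξ v
    have : (fun g : AdjointGroup L => ξ (g.1 v)) ∘ (fun x => (φ x).1 (ψ x)) =
        ∑ i, (fun x => η i (((φ x).1 (z i)).1 (y i))) * fun x => p i (ψ x) := by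
      funext x
      simp only [Function.comp_apply, h _ (φ x).2, Finset.sum_apply, Pi.mul_apply]
    rw [this]
    refine sum_mem fun i _ => mul_mem ?_ (hψ.comp_mem _ (hp i _))
    exact (hev (z i)).comp_mem _ (coordRing_le_reg _ (coeff_mem_coordRing (η i) (y i)))
  · obtain ⟨ι, _, z, η, y, p, hp, h⟩ := exists_section_interpolation (m := m) (K := K) hσ ξ v
    have : (fun g : AdjointGroup L => ξ ((g⁻¹).1 v)) ∘ (fun x => (φ x).1 (ψ x)) =
        ∑ i, (fun x => η i ((((φ x).1 (z i))⁻¹).1 (y i))) * fun x => p i (ψ x) := by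
      funext x
      simp only [Function.comp_apply, Finset.sum_apply, Pi.mul_apply]
      exact h _ (φ x)⁻¹.2 (ψ x)
    rw [this]
    refine sum_mem fun i _ => mul_mem ?_ (hψ.comp_mem _ (hp i _))
    exact (hev (z i)).comp_mem _ (coordRing_le_reg _ (inv_coeff_mem_coordRing (η i) (y i)))

end Sections

/-! ### Local sections of the mixing bundle. -/

section Mix

variable {L : Type u} [LieRing L] [LieAlgebra ℂ L] {H : LieSubalgebra ℂ L} {r : ℕ}
  (σ : Subtorus H r) (m : ℕ) {Y : Type v} {ρ : σ.S →* Equiv.Perm Y} {a : FunStr Y}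

theorem isMorphism_mix_mk :
    IsMorphism ((eStr r m).prod a) (mixStr σ m ρ a) (Quotient.mk (mixSetoid σ m ρ)) :=
  isMorphism_quot_mk _

theorem coord_mem_reg {m : ℕ} (i : Fin r) (l : Fin (m + 1)) (e : ETotal r m) :
    (fun e : ETotal r m => e.vec i l) ∈ (eStr r m).reg e :=
  mem_reg_ofFunctions (F := {f | ∃ i k, f = fun e : ETotal r m => e.vec i k}) ⟨i, l, rfl⟩ e

/-- The bundle `(ℂ^(m+1) ∖ 0)^r × Y` over the mixing space has local sections. -/
theorem exists_mix_section (ha : IsMorphism ((subgroupStr σ.S).prod a) a (fun z => ρ z.1 z.2))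
    (e : ETotal r m) (y : Y) :
    ∃ τ : Mix σ m ρ → ETotal r m × Y,
      MorphAt (mixStr σ m ρ a) ((eStr r m).prod a) τ (Mix.mk σ m ρ e y) ∧
      τ (Mix.mk σ m ρ e y) = (e, y) ∧ ∀ z, Quotient.mk (mixSetoid σ m ρ) (τ z) = z := by
  classical
  choose k hk using fun i => Function.ne_iff.1 (e.vec_ne i)
  -- The torus element that rescales the `k i`-th coordinate of `e'` to that of `e`; aiming at `e`
  -- makes the section pass through `(e, y)`. The default `1` matters only outside the open set `U`.
  let u : ETotal r m → Fin r → ℂˣ := fun e' i => if h : e'.vec i (k i) = 0 then 1 else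
    Units.mk0 (e.vec i (k i) / e'.vec i (k i)) (div_ne_zero (hk i) h)
  have hu : ∀ {e' : ETotal r m} {i}, e'.vec i (k i) ≠ 0 →
      (u e' i : ℂ) = e.vec i (k i) / e'.vec i (k i) := fun {e' i} h => by simp [u, h]
  let N : ETotal r m × Y → ETotal r m × Y := fun z => (u z.1 • z.1, ρ (σ.β.symm (u z.1)) z.2)
  have hN : ∀ z, mixSetoid σ m ρ z (N z) := fun z => ⟨σ.β.symm (u z.1), by simp [N]⟩
  let U : Set (Mix σ m ρ) := {z | ∀ i, z.out.1.vec i (k i) ≠ 0}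
  have hU : ∀ z : ETotal r m × Y, Quotient.mk (mixSetoid σ m ρ) z ∈ U ↔
      ∀ i, z.1.vec i (k i) ≠ 0 := by
    intro z
    obtain ⟨s, hs⟩ : mixSetoid σ m ρ z (Quotient.mk (mixSetoid σ m ρ) z).out :=
      (mixSetoid σ m ρ).symm (Quotient.mk_out (s := mixSetoid σ m ρ) z)
    change (∀ i, (Quotient.mk (mixSetoid σ m ρ) z).out.1.vec i (k i) ≠ 0) ↔ _
    rw [hs]
    simp [torus_smul_vec]
  have hUo : IsOpen[(mixStr σ m ρ a).top] U := by
    refine quot_isOpen_iff.2 ?_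
    let _ := ((eStr r m).prod a).top
    refine isOpen_iff_mem_nhds.2 fun z hz => ?_
    have hz := (hU z).1 hz
    have h1 : ∀ᶠ z' in 𝓝 z, ∀ i, z'.1.vec i (k i) ≠ 0 := eventually_all.2 fun i =>
      (isMorphism_fst.morphAt z).tendsto ((eStr r m).eventually_ne (coord_mem_reg i (k i) z.1) (hz i))
    exact Filter.mem_of_superset h1 fun z' hz' => (hU z').2 hz'
  have hconst : ∀ z z', Quotient.mk (mixSetoid σ m ρ) z ∈ U → mixSetoid σ m ρ z z' → N z = N z' := by
    rintro z _ hz ⟨s, rfl⟩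
    have hz := (hU z).1 hz
    have h1 : u (σ.β s • z.1) = u z.1 * (σ.β s)⁻¹ := by
      funext i
      have h2 : (σ.β s • z.1).vec i (k i) ≠ 0 := by
        simpa [torus_smul_vec] using hz i
      refine Units.ext ?_
      rw [hu h2, Pi.mul_apply, Units.val_mul, hu (hz i), Pi.inv_apply, Units.val_inv_eq_inv_val,
        torus_smul_vec, Pi.smul_apply, smul_eq_mul]
      have := (σ.β s i).ne_zero
      have := hz i
      field_simp
    refine Prod.ext ?_ ?_
    · simp only [N, h1, mul_smul, inv_smul_smul]
    · simp only [N, h1, map_mul, map_inv, MulEquiv.symm_apply_apply]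
      simp
  refine ⟨fun z => N z.out, morphAt_comp_out hUo ((hU _).2 hk) hconst ?_, ?_, fun z => ?_⟩
  · intro z hz
    have hz := (hU z).1 hz
    have hmem : ∀ i, (fun e' : ETotal r m => (u e' i : ℂ)) ∈ (eStr r m).reg z.1 := fun i => by
      refine (eStr r m).congr_mem (mul_mem (const_mem _ (e.vec i (k i)))
        ((eStr r m).inv_mem (coord_mem_reg i (k i) z.1) (hz i))) ?_
      filter_upwards [(eStr r m).eventually_ne (coord_mem_reg i (k i) z.1) (hz i)] with e' he'
      rw [hu he', div_eq_mul_inv]; rfl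
    have h1 : MorphAt (eStr r m) (torusStr r) u z.1 := morphAt_ofFunctions fun f hf => by
      obtain ⟨i, rfl⟩ := hf
      exact hmem i
    have h2 : MorphAt (eStr r m) (eStr r m) (fun e' => u e' • e') z.1 :=
      morphAt_eStr fun i l => mul_mem (hmem i) (coord_mem_reg i l z.1)
    have h3 : MorphAt ((eStr r m).prod a) (subgroupStr σ.S) (fun z => σ.β.symm (u z.1)) z :=
      (σ.isMorphism_symm.comp_at (h1.comp (isMorphism_fst.morphAt z)) :)
    exact (h2.comp (isMorphism_fst.morphAt z)).prodMk
      (ha.comp_at (h3.prodMk (isMorphism_snd.morphAt z)) :)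
  · have h1 : N (e, y) = N (Mix.mk σ m ρ e y).out := hconst _ _ ((hU (e, y)).2 hk)
      ((mixSetoid σ m ρ).symm (Quotient.mk_out (s := mixSetoid σ m ρ) (e, y)))
    have h2 : u e = 1 := funext fun i => Units.ext (by
      rw [hu (hk i), div_self (hk i), Pi.one_apply, Units.val_one])
    refine h1.symm.trans ?_
    simp only [N, h2, map_one, one_smul, Equiv.Perm.one_apply]
  · exact (Quotient.sound ((mixSetoid σ m ρ).symm (hN z.out))).trans (Quotient.out_eq z)

end Mix

/-! ### The semidirect product acts on the mixing space by a morphism. -/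

section LinMix

variable {L : Type u} [LieRing L] [LieAlgebra ℂ L] [FiniteDimensional ℂ L]
  {H : LieSubalgebra ℂ L} {r : ℕ}
  {σ : Subtorus H r} {m : ℕ} {K P : Subgroup (AdjointGroup L)}
  {X : Type*} {a : FunStr X} {x : X}

theorem isMorphism_flagRep : IsMorphism ((subgroupStr σ.S).prod (flagStr P)) (flagStr P)
    (fun z => flagRep σ P z.1 z.2) :=
  .of_morphAt fun z => MorphAt.flag_smul (isMorphism_fst.morphAt z).subgroup_val
    (isMorphism_snd.morphAt z)

omit [FiniteDimensional ℂ L] in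
theorem gl_entry_mem {φ : X → GLPow r m} (h : MorphAt a (glStr r m) φ x) (i : Fin r)
    (k l : Fin (m + 1)) : (fun x => (φ x i).1 k l) ∈ a.reg x :=
  h.comp_mem (fun φ => (φ i).1 k l) (mem_reg_ofFunctions (Or.inl ⟨i, k, l, rfl⟩) _)

omit [FiniteDimensional ℂ L] in
theorem gl_inv_entry_mem {φ : X → GLPow r m} (h : MorphAt a (glStr r m) φ x) (i : Fin r)
    (k l : Fin (m + 1)) : (fun x => ((φ x i)⁻¹).1 k l) ∈ a.reg x :=
  h.comp_mem (fun φ => ((φ i)⁻¹).1 k l) (mem_reg_ofFunctions (Or.inr ⟨i, k, l, rfl⟩) _)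

theorem morphAt_glStr {φ : X → GLPow r m} (h : ∀ i k l, (fun x => (φ x i).1 k l) ∈ a.reg x)
    (h' : ∀ i k l, (fun x => ((φ x i)⁻¹).1 k l) ∈ a.reg x) : MorphAt a (glStr r m) φ x :=
  morphAt_ofFunctions fun _ hf => by
    rcases hf with ⟨i, k, l, rfl⟩ | ⟨i, k, l, rfl⟩
    · exact h i k l
    · exact h' i k l

theorem sum_mul_mem {A B : X → Matrix (Fin (m + 1)) (Fin (m + 1)) ℂ} {k l : Fin (m + 1)}
    (hA : ∀ j, (fun x => A x k j) ∈ a.reg x) (hB : ∀ j, (fun x => B x j l) ∈ a.reg x) :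
    (fun x => (A x * B x) k l) ∈ a.reg x := by
  have : (fun x => (A x * B x) k l) = ∑ j, (fun x => A x k j) * fun x => B x j l := by
    funext x
    simp [Matrix.mul_apply]
  rw [this]
  exact sum_mem fun j _ => mul_mem (hA j) (hB j)

theorem FunStr.MorphAt.gl_mul {φ ψ : X → GLPow r m} (h : MorphAt a (glStr r m) φ x)
    (h' : MorphAt a (glStr r m) ψ x) : MorphAt a (glStr r m) (fun x => φ x * ψ x) x :=
  morphAt_glStr (fun i k l => sum_mul_mem (fun j => gl_entry_mem h i k j)
      fun j => gl_entry_mem h' i j l)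
    (fun i k l => by
      simp only [Pi.mul_apply, mul_inv_rev]
      exact sum_mul_mem (fun j => gl_inv_entry_mem h' i k j) fun j => gl_inv_entry_mem h i j l)

theorem FunStr.MorphAt.gl_inv {φ : X → GLPow r m} (h : MorphAt a (glStr r m) φ x) :
    MorphAt a (glStr r m) (fun x => (φ x)⁻¹) x :=
  morphAt_glStr (fun i k l => gl_inv_entry_mem h i k l)
    (fun i k l => by simpa only [Pi.inv_apply, inv_inv] using gl_entry_mem h i k l)

theorem FunStr.MorphAt.gl_smul {φ : X → GLPow r m} {ψ : X → ETotal r m}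
    (h : MorphAt a (glStr r m) φ x) (h' : MorphAt a (eStr r m) ψ x) :
    MorphAt a (eStr r m) (fun x => φ x • ψ x) x := by
  refine morphAt_eStr fun i k => ?_
  have : (fun x => (φ x • ψ x).vec i k) =
      ∑ l, (fun x => (φ x i).1 k l) * fun x => (ψ x).vec i l := by
    funext x
    simp [gl_smul_vec, Matrix.mulVec, dotProduct]
  rw [this]
  exact sum_mem fun l _ => mul_mem (gl_entry_mem h i k l) (h'.comp_mem _ (coord_mem_reg i l _))

theorem isMorphism_left : IsMorphism (linMixStr σ m K) (sectionStr σ m K) SemidirectProduct.left :=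
  isMorphism_of_pull_subset Set.subset_union_left

theorem isMorphism_right : IsMorphism (linMixStr σ m K) (glStr r m) SemidirectProduct.right :=
  isMorphism_of_pull_subset Set.subset_union_right

theorem morphAt_linMix {γ : X → LinMixGroup σ m K}
    (h : ∀ e, MorphAt a (groupStr L) (fun x => (γ x).left.1 e) x)
    (h' : MorphAt a (glStr r m) (fun x => (γ x).right) x) :
    MorphAt a (linMixStr σ m K) γ x := by
  refine morphAt_generate ?_
  rintro U f (hU | hU) hx
  · exact MorphAt.of_mem_pull (φ := SemidirectProduct.left) (ψ := γ) (morphAt_section h) hU hx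
  · exact MorphAt.of_mem_pull (φ := SemidirectProduct.right) (ψ := γ) h' hU hx

theorem morphAt_left_apply {γ : X → LinMixGroup σ m K} (h : MorphAt a (linMixStr σ m K) γ x)
    (e : ETotal r m) : MorphAt a (groupStr L) (fun x => (γ x).left.1 e) x :=
  ((isMorphism_eval e).comp_at (isMorphism_left.comp_at h :) :)

theorem morphAt_right {γ : X → LinMixGroup σ m K} (h : MorphAt a (linMixStr σ m K) γ x) :
    MorphAt a (glStr r m) (fun x => (γ x).right) x :=
  (isMorphism_right.comp_at h :)

theorem linMix_smul_mk (γ : LinMixGroup σ m K) (e : ETotal r m) (y : AdjointGroup L ⧸ P) :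
    γ • Mix.mk σ m (flagRep σ P) e y =
      Mix.mk σ m (flagRep σ P) (γ.right • e) (γ.left.1 (γ.right • e) • y) := rfl

variable [LieAlgebra.IsKilling ℂ L] [H.IsCartanSubalgebra] {b : (rootSystem H).Base}

/-- The action on the mixing space of `G/P` is a morphism. -/
theorem isMorphism_linMix_smul (hσ : σ.IsPositive b) :
    IsMorphism ((linMixStr σ m K).prod (mixStr σ m (flagRep σ P) (flagStr P)))
      (mixStr σ m (flagRep σ P) (flagStr P)) (fun z => z.1 • z.2) := by
  refine .of_morphAt fun ⟨γ, z⟩ => ?_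
  induction z using Quotient.inductionOn with
  | h z =>
    obtain ⟨e, y⟩ := z
    obtain ⟨τ, hτ, -, hmk⟩ := exists_mix_section σ m (isMorphism_flagRep (P := P)) e y
    let z₀ : LinMixGroup σ m K × Mix σ m (flagRep σ P) := (γ, Mix.mk σ m (flagRep σ P) e y)
    have h1 : MorphAt ((linMixStr σ m K).prod (mixStr σ m (flagRep σ P) (flagStr P)))
        ((eStr r m).prod (flagStr P)) (fun z => τ z.2) z₀ :=
      MorphAt.comp hτ (isMorphism_snd.morphAt z₀)
    have h2 : MorphAt ((linMixStr σ m K).prod (mixStr σ m (flagRep σ P) (flagStr P)))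
        (linMixStr σ m K) (fun z => z.1) z₀ := isMorphism_fst.morphAt z₀
    have h3 := (morphAt_right h2).gl_smul (isMorphism_fst.comp_at h1 :)
    have h4 := (FunStr.MorphAt.section_eval hσ (isMorphism_left.comp_at h2 :) h3).flag_smul
      (isMorphism_snd.comp_at h1 :)
    have h5 := ((isMorphism_mix_mk σ m (ρ := flagRep σ P)).comp_at (h3.prodMk h4) :)
    refine h5.congr (.of_forall fun z => ?_)
    exact congrArg (fun y : Mix σ m (flagRep σ P) => z.1 • y) (hmk z.2)

end LinMix

/-! ### Curves in `GL` that move a point in any direction. -/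

section Directions

variable {r m : ℕ}

/-- The curve `1 + t a ⊗ u` of invertible matrices. -/
def rankOneCurve (a u : Fin (m + 1) → ℂ) (t : ℂ) : GL (Fin (m + 1)) ℂ :=
  if h : 1 + t * u ⬝ᵥ a = 0 then 1 else
    -- The inverse is the Sherman–Morrison formula, from `(a ⊗ u)² = (u ⬝ a) (a ⊗ u)`.
    ⟨1 + t • Matrix.vecMulVec a u, 1 - (t / (1 + t * u ⬝ᵥ a)) • Matrix.vecMulVec a u, by
      have h1 : Matrix.vecMulVec a u * Matrix.vecMulVec a u = (u ⬝ᵥ a) • Matrix.vecMulVec a u := by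
        rw [Matrix.vecMulVec_mul_vecMulVec, Matrix.vecMulVec_smul]
      rw [mul_sub, add_mul, add_mul, smul_mul_smul_comm, h1]
      simp only [mul_one, one_mul, smul_smul]
      rw [add_sub_assoc, ← add_smul, ← sub_smul]
      convert add_zero _
      rw [smul_eq_zero]
      left
      field_simp
      ring, by
      have h1 : Matrix.vecMulVec a u * Matrix.vecMulVec a u = (u ⬝ᵥ a) • Matrix.vecMulVec a u := by
        rw [Matrix.vecMulVec_mul_vecMulVec, Matrix.vecMulVec_smul]
      rw [mul_add, sub_mul, sub_mul, smul_mul_smul_comm, h1]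
      simp only [mul_one, one_mul, smul_smul]
      rw [sub_add, ← sub_smul, ← sub_smul]
      convert sub_zero _
      rw [smul_eq_zero]
      left
      field_simp
      ring⟩

theorem eventually_rankOneCurve (a u : Fin (m + 1) → ℂ) :
    ∀ᶠ t in @nhds _ line.top 0, 1 + t * u ⬝ᵥ a ≠ 0 :=
  line.eventually_ne (add_mem (const_mem _ 1) (mul_mem (id_mem_line 0) (const_mem _ (u ⬝ᵥ a))))
    (by simp)

theorem rankOneCurve_val {a u : Fin (m + 1) → ℂ} {t : ℂ} (h : 1 + t * u ⬝ᵥ a ≠ 0) :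
    (rankOneCurve a u t).1 = 1 + t • Matrix.vecMulVec a u := by
  rw [rankOneCurve, dif_neg h]

theorem rankOneCurve_inv_val {a u : Fin (m + 1) → ℂ} {t : ℂ} (h : 1 + t * u ⬝ᵥ a ≠ 0) :
    ((rankOneCurve a u t)⁻¹).1 = 1 - (t / (1 + t * u ⬝ᵥ a)) • Matrix.vecMulVec a u := by
  rw [rankOneCurve, dif_neg h]; rfl

theorem rankOneCurve_zero (a u : Fin (m + 1) → ℂ) : rankOneCurve a u 0 = 1 :=
  Units.ext (by rw [rankOneCurve_val (by simp), zero_smul, add_zero]; rfl)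

theorem morphAt_rankOneCurve (a u : Fin r → Fin (m + 1) → ℂ) :
    MorphAt line (glStr r m) (fun t i => rankOneCurve (a i) (u i) t) 0 := by
  refine morphAt_glStr (fun i k l => ?_) (fun i k l => ?_)
  · refine line.congr_mem (add_mem (const_mem _ ((1 : Matrix (Fin (m + 1)) (Fin (m + 1)) ℂ) k l))
      (mul_mem (id_mem_line 0) (const_mem _ (a i k * u i l)))) ?_
    filter_upwards [eventually_rankOneCurve (a i) (u i)] with t ht
    rw [rankOneCurve_val ht]; rfl
  · refine line.congr_mem (sub_mem (const_mem _ ((1 : Matrix (Fin (m + 1)) (Fin (m + 1)) ℂ) k l))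
      (mul_mem (mul_mem (id_mem_line 0) (line.inv_mem (add_mem (const_mem _ 1)
        (mul_mem (id_mem_line 0) (const_mem _ (u i ⬝ᵥ a i)))) (by simp)))
        (const_mem _ (a i k * u i l)))) ?_
    filter_upwards [eventually_rankOneCurve (a i) (u i)] with t ht
    rw [rankOneCurve_inv_val ht]; rfl

/-- Every tangent vector of `(ℂ^(m+1) ∖ 0)^r` is the velocity of a curve `t ↦ φ t • e`. -/
theorem exists_gl_curve {e : ETotal r m} {D : (ETotal r m → ℂ) → ℂ} (hD : PD (eStr r m) e D) :
    ∃ φ : ℂ → GLPow r m, φ 0 = 1 ∧ MorphAt line (glStr r m) φ 0 ∧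
      ∀ f ∈ (eStr r m).reg e, D f = deriv (fun t => f (φ t • e)) 0 := by
  choose k hk using fun i => Function.ne_iff.1 (e.vec_ne i)
  let a : Fin r → Fin (m + 1) → ℂ := fun i l => D fun e => e.vec i l
  -- Since `u i ⬝ᵥ e.vec i = 1`, the matrix `1 + t a ⊗ u` moves `e` to `e + t a`, where `a` holds
  -- the coordinates of `D`.
  let u : Fin r → Fin (m + 1) → ℂ := fun i => Pi.single (k i) (e.vec i (k i))⁻¹
  have hu : ∀ i, u i ⬝ᵥ e.vec i = 1 := fun i => by
    rw [single_dotProduct]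
    exact inv_mul_cancel₀ (hk i)
  have h0 : (fun i => rankOneCurve (a i) (u i) 0) = (1 : GLPow r m) :=
    funext fun i => rankOneCurve_zero _ _
  have hm := morphAt_rankOneCurve a u
  refine ⟨fun t i => rankOneCurve (a i) (u i) t, h0, hm, ?_⟩
  have hc : MorphAt line (eStr r m) (fun t => (fun i => rankOneCurve (a i) (u i) t : GLPow r m) • e)
      0 := hm.gl_smul (morphAt_const e 0)
  have hp := pd_curve hc
  simp only [h0, one_smul] at hp
  refine PD.ext_ofFunctions hD hp ?_
  rintro _ ⟨i, l, rfl⟩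
  have h1 : HasDerivAt (fun t : ℂ => e.vec i l + t * a i l) (a i l) 0 := by
    simpa using ((hasDerivAt_id (0 : ℂ)).mul_const (a i l)).const_add (e.vec i l)
  refine (h1.congr_of_eventuallyEq ?_).deriv.symm
  filter_upwards [nhds_line_le 0 (eventually_rankOneCurve (a i) (u i))] with t ht
  rw [gl_smul_vec, rankOneCurve_val ht, Matrix.add_mulVec, Matrix.one_mulVec, Matrix.smul_mulVec,
    Matrix.vecMulVec_mulVec, hu]
  simp

end Directions

/-! ### Smoothness for the semidirect product. -/

section Surjectivity

variable {L : Type u} [LieRing L] [LieAlgebra ℂ L] [FiniteDimensional ℂ L]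
  {H : LieSubalgebra ℂ L} {r : ℕ}
  {σ : Subtorus H r} {m : ℕ} {P : Subgroup (AdjointGroup L)}

omit [FiniteDimensional ℂ L] in
/-- A tangent vector of the mixing space is the sum of a tangent vector of the total space of the
projective spaces and of a tangent vector of the fibre. -/
theorem FunStr.PD.exists_mix {Y : Type v} {ρ : σ.S →* Equiv.Perm Y} {a : FunStr Y}
    (ha : IsMorphism ((subgroupStr σ.S).prod a) a (fun z => ρ z.1 z.2)) {e : ETotal r m} {y : Y}
    {D : (Mix σ m ρ → ℂ) → ℂ} (hD : PD (mixStr σ m ρ a) (Mix.mk σ m ρ e y) D) :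
    ∃ D₁ D₂, PD (eStr r m) e D₁ ∧ PD a y D₂ ∧ ∀ f ∈ (mixStr σ m ρ a).reg (Mix.mk σ m ρ e y),
      D f = D₁ (fun e' => f (Mix.mk σ m ρ e' y)) + D₂ (fun y' => f (Mix.mk σ m ρ e y')) := by
  obtain ⟨τ, hτ, h0, hmk⟩ := exists_mix_section σ m ha e y
  have h1 := hD.push hτ
  rw [h0] at h1
  refine ⟨_, _, h1.push (isMorphism_fst.morphAt (e, y)), h1.push (isMorphism_snd.morphAt (e, y)),
    fun f hf => ?_⟩
  have h2 := h1.prod_eq _ ((isMorphism_mix_mk σ m).comp_mem (e, y) f hf)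
  refine Eq.trans ?_ h2
  congr 1
  funext z
  exact congrArg f (hmk z).symm

variable [LieAlgebra.IsKilling ℂ L] [H.IsCartanSubalgebra] {b : (rootSystem H).Base}
  {q : ℕ} {w : Fin q → b.support} (hP : IsParabolic b P) {n : AdjointGroup L}
  (hn : IsLongest b n) {V : Fin r → Submodule ℂ (Fin (m + 1) → ℂ)}

theorem isMorphism_oppBsMix : IsMorphism
    (mixStr σ m (oppBsRep σ w) (bsStr (oppBorel b) (oppWordParabolic b w)))
    (mixStr σ m (flagRep σ P) (flagStr P)) (oppBsMix σ m w hP hn) := by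
  refine isMorphism_quot (.of_morphAt fun z => ?_)
  exact ((isMorphism_mix_mk σ m (ρ := flagRep σ P)).comp_at ((isMorphism_fst.morphAt z).prodMk
    ((isMorphism_bsToFlag n P _).comp_at (isMorphism_snd.morphAt z) :)) :)

theorem isMorphism_oppBsBundle : IsMorphism (oppBsBundleStr σ m w V)
    (mixStr σ m (flagRep σ P) (flagStr P)) (fun z => oppBsMix σ m w hP hn z.1) :=
  (isMorphism_oppBsMix hP hn).comp (isMorphism_subtype_val _)

/-- The monomials of given multidegree do not all vanish at a point of `(ℂ^(m+1) ∖ 0)^r`. -/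
theorem exists_homogeneous_eq_one (d : Fin r → ℕ) (e : ETotal r m) :
    ∃ F ∈ homogeneous r m (fun i => (d i : ℤ)), F e = 1 := by
  choose k hk using fun i => Function.ne_iff.1 (e.vec_ne i)
  have h : (fun e : ETotal r m => ∏ i, (e.vec i (k i)) ^ d i) ∈
      homogeneous r m (fun i => (d i : ℤ)) := by
    refine ⟨fun e => ?_, fun t e => ?_⟩
    · have : (fun e : ETotal r m => ∏ i, (e.vec i (k i)) ^ d i) =
          ∏ i, (fun e : ETotal r m => e.vec i (k i)) ^ d i := by
        funext e
        simp
      rw [this]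
      exact prod_mem fun i _ => pow_mem (coord_mem_reg i (k i) e) _
    · simp [torus_smul_vec, mul_pow, Finset.prod_mul_distrib]
  refine ⟨_, Submodule.smul_mem _ (∏ i, (e.vec i (k i)) ^ d i)⁻¹ h, ?_⟩
  exact inv_mul_cancel₀ (Finset.prod_ne_zero_iff.2 fun i _ => pow_ne_zero _ (hk i))

/-- The one-parameter groups of sections of the Borel group scheme in a positive root group. -/
theorem exists_section_curve (hσ : σ.IsPositive b) {α : H.root} (hα : b.IsPos α) {x : L}
    (hx : x ∈ LieAlgebra.rootSpace H (α : LieModule.Weight ℂ H L)) (e : ETotal r m) :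
    ∃ γ : ℂ → sectionGroup σ m (borelSubgroup b), γ 0 = 1 ∧
      (∀ e', MorphAt line (groupStr L) (fun t => (γ t).1 e') 0) ∧
      ∀ t, (γ t).1 e = expAd x (isNilpotent_ad_root α hx) t := by
  obtain ⟨k, hk⟩ := exists_character_of_isPos hσ hα
  -- Positivity of the basis enters here: a homogeneous `F` of multidegree the character of `α` with
  -- `F e = 1` exists because the exponents are nonnegative. As conjugation by `s` scales `x` by the
  -- same character, `exp(t F x)` is equivariant.
  obtain ⟨F, ⟨hF, hF'⟩, h1⟩ := exists_homogeneous_eq_one k e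
  have hN := isNilpotent_ad_root α hx
  have hm : ∀ {X : Type} {a : FunStr X} {f : X → ℂ} {z : X}, f ∈ a.reg z →
      MorphAt a (groupStr L) (fun z => expAd x hN (f z)) z := by
    intro X a f z hf
    have : MorphAt a line f z := morphAt_ofFunctions fun g hg => by
      cases hg
      exact hf
    exact ((isMorphism_expAd hN).comp_at this :)
  refine ⟨fun t => ⟨fun e' => expAd x hN (t * F e'), fun e' => expAd_mem_borel b hα hx _,
    fun s e' => ?_, .of_morphAt fun e' => hm (mul_mem (const_mem e' t) (hF e'))⟩, ?_, ?_, ?_⟩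
  · beta_reduce
    rw [hF', conj_expAd s.1 hN (hk s x hx)]
    simp only [zpow_natCast]
    congr 1
    ring
  · exact Subtype.ext (funext fun e' => by
      change expAd x hN (0 * F e') = 1
      rw [zero_mul, expAd_zero])
  · exact fun e' => hm (mul_mem (id_mem_line 0) (const_mem 0 (F e')))
  · intro t
    change expAd x hN (t * F e) = _
    rw [h1, mul_one]

/-- Base directions come from left multiplication of `γ` by a curve in `GL`, positive root
directions in the fibre from right multiplication by a curve of sections, and directions of `B⁻`
from its action on the Bott–Samelson variety. None of these changes `e`, so the curves stay over the
chosen linear subspaces. -/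
theorem isSmooth_linMix_smul (hσ : σ.IsPositive b) : IsSmooth
    ((linMixStr σ m (borelSubgroup b)).prod (oppBsBundleStr σ m w V))
    (mixStr σ m (flagRep σ P) (flagStr P))
    (fun z => z.1 • oppBsMix σ m w hP hn z.2.1) := by
  refine isSmooth_of_reach (.of_morphAt fun z => ?_) ?_
  · exact ((isMorphism_linMix_smul hσ).comp_at ((isMorphism_fst.morphAt z).prodMk
      ((isMorphism_oppBsBundle hP hn).comp_at (isMorphism_snd.morphAt z) :)) :)
  rintro ⟨γ, z, e, y, he, rfl⟩ D hD
  let x := oppBsToFlag w hP hn y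
  let g := γ.left.1 (γ.right • e)
  have hz : γ • oppBsMix σ m w hP hn (Mix.mk σ m (oppBsRep σ w) e y) =
    Mix.mk σ m (flagRep σ P) (γ.right • e) (g • x) := rfl
  obtain ⟨D₁, D₂, hD₁, hD₂, hDD⟩ :=
    FunStr.PD.exists_mix (e := γ.right • e) (y := g • x) isMorphism_flagRep hD
  refine Reach.congr (Reach.add (D := fun f => D₁ (fun e' => f (Mix.mk σ m (flagRep σ P) e' (g • x))))
    (D' := fun f => D₂ fun y' => f (Mix.mk σ m (flagRep σ P) (γ.right • e) y')) ?_ ?_)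
    fun f hf => (hDD f hf).symm
  · obtain ⟨φ, hφ0, hφ, hd⟩ := exists_gl_curve hD₁
    refine Reach.congr (reach_curve (γ := fun t => ((⟨1, φ t⟩ * γ : LinMixGroup σ m (borelSubgroup b)),
      ⟨Mix.mk σ m (oppBsRep σ w) e y, e, y, he, rfl⟩)) ?_ ?_) fun f hf => ?_
    · refine MorphAt.prodMk (morphAt_linMix (fun e' => ?_) (hφ.gl_mul (morphAt_const γ.right 0)))
        (morphAt_const _ _)
      simp only [SemidirectProduct.mul_left, one_mul]
      exact (IsMorphism.comp_at γ.left.2.2.2 (hφ.gl_inv.gl_smul (morphAt_const e' 0)) :)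
    · rw [hφ0]
      exact Prod.ext (one_mul γ) rfl
    · have h : ∀ t, (⟨1, φ t⟩ * γ : LinMixGroup σ m (borelSubgroup b)) •
          oppBsMix σ m w hP hn (Mix.mk σ m (oppBsRep σ w) e y) =
            Mix.mk σ m (flagRep σ P) (φ t • γ.right • e) (g • x) := fun t => by
        rw [mul_smul, hz, linMix_smul_mk]
        exact congrArg _ (one_smul _ _)
      simp only [h]
      refine (hd (fun e' => f (Mix.mk σ m (flagRep σ P) e' (g • x))) ?_).symm
      exact MorphAt.comp_mem (φ := fun e' => Mix.mk σ m (flagRep σ P) e' (g • x))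
        ((isMorphism_mix_mk σ m).comp_at ((morphAt_id _).prodMk (morphAt_const _ _)) :) f hf
  · obtain ⟨D', hD', hDD'⟩ := hD₂.exists_orbit H (h := g) rfl
    have hfib : ∀ y', MorphAt (flagStr P) (mixStr σ m (flagRep σ P) (flagStr P))
        (fun y' => Mix.mk σ m (flagRep σ P) (γ.right • e) y') y' := fun y' =>
      ((isMorphism_mix_mk σ m).comp_at ((morphAt_const _ _).prodMk (morphAt_id _)) :)
    refine Reach.congr ?_ fun f hf => (hDD' _ ((hfib _).comp_mem f hf)).symm
    refine reach_of_curves b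
      (Ψ := fun g' => Mix.mk σ m (flagRep σ P) (γ.right • e) (g • g' • x))
      ((hfib _).comp ((morphAt_const _ _).flag_smul ((morphAt_id _).flag_smul (morphAt_const _ _))))
      (by rw [one_smul]; rfl) (fun α hα v hv => ?_) (fun c h0 hc => ?_) hD'
    · obtain ⟨c, hc0, hc, hce⟩ := exists_section_curve hσ hα hv e
      refine Reach.congr (reach_curve (γ := fun t => (γ * ⟨c t, 1⟩,
        ⟨Mix.mk σ m (oppBsRep σ w) e y, e, y, he, rfl⟩)) ?_ ?_) fun f hf => ?_
      · refine MorphAt.prodMk (morphAt_linMix (fun e' => ?_) ?_) (morphAt_const _ _)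
        · exact (morphAt_const _ _).gmul (hc (γ.right⁻¹ • e'))
        · simp only [SemidirectProduct.mul_right]
          exact morphAt_const _ _
      · rw [hc0]
        exact Prod.ext (mul_one γ) rfl
      · have h : ∀ t, (γ * ⟨c t, 1⟩ : LinMixGroup σ m (borelSubgroup b)) •
            oppBsMix σ m w hP hn (Mix.mk σ m (oppBsRep σ w) e y) = Mix.mk σ m (flagRep σ P)
              (γ.right • e) (g • expAd v (isNilpotent_ad_root α hv) t • x) := fun t => by
          have h1 : (⟨c t, 1⟩ : LinMixGroup σ m (borelSubgroup b)) •
              oppBsMix σ m w hP hn (Mix.mk σ m (oppBsRep σ w) e y) = Mix.mk σ m (flagRep σ P)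
                ((1 : GLPow r m) • e) ((c t).1 ((1 : GLPow r m) • e) • x) := rfl
          rw [mul_smul, h1, one_smul, hce]
          rfl
        simp only [h]
    · refine Reach.congr (reach_curve (γ := fun t => (γ, ⟨Mix.mk σ m (oppBsRep σ w) e
        ((bsAction (oppBorel_le_oppWordParabolic b w)).smul (c t) y), e, _, he, rfl⟩)) ?_ ?_)
        fun f hf => ?_
      · refine (morphAt_const _ _).prodMk (MorphAt.codRestrict ?_)
        exact ((isMorphism_mix_mk σ m).comp_at ((morphAt_const e 0).prodMk
          (morphAt_bsAction (oppBorel_le_oppWordParabolic b w) hc y)) :)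
      · refine Prod.ext rfl (Subtype.ext ?_)
        have : (bsAction (oppBorel_le_oppWordParabolic b w)).smul (c 0) y = y := by
          rw [h0]
          exact (bsAction (oppBorel_le_oppWordParabolic b w)).one_smul y
        exact congrArg (Mix.mk σ m (oppBsRep σ w) e) this
      · have h : ∀ t, γ • oppBsMix σ m w hP hn (Mix.mk σ m (oppBsRep σ w) e
            ((bsAction (oppBorel_le_oppWordParabolic b w)).smul (c t) y)) =
              Mix.mk σ m (flagRep σ P) (γ.right • e) (g • (c t : AdjointGroup L) • x) := fun t =>
          congrArg (fun x' => Mix.mk σ m (flagRep σ P) (γ.right • e) (g • x'))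
            (bsToFlag_smul (oppBorel_le_oppWordParabolic b w) n P _ (c t) y)
        simp only [h]

end Surjectivity

/-! ### Passage to the mixing group. -/

section MixingGroup

variable {L : Type u} [LieRing L] [LieAlgebra ℂ L] [FiniteDimensional ℂ L]
  {H : LieSubalgebra ℂ L} {r : ℕ}
  {σ : Subtorus H r} {m : ℕ} {K P : Subgroup (AdjointGroup L)} (hS : σ.S ≤ K)

theorem FunStr.MorphAt.linMix_mul_central {X : Type*} {a : FunStr X} {x : X}
    {γ : X → LinMixGroup σ m K} {t : X → Fin r → ℂˣ} (hγ : MorphAt a (linMixStr σ m K) γ x)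
    (ht : MorphAt a (torusStr r) t x) :
    MorphAt a (linMixStr σ m K) (fun x => γ x * centralTorus σ m K hS (σ.β.symm (t x))) x := by
  have hu : ∀ i, (fun x => (t x i : ℂ)) ∈ a.reg x := fun i =>
    ht.comp_mem (fun t => (t i : ℂ)) (mem_reg_ofFunctions (F := {f | ∃ i, f = fun t : Fin r → ℂˣ => (t i : ℂ)}) ⟨i, rfl⟩ _)
  have hui : ∀ i, (fun x => (((t x i)⁻¹ : ℂˣ) : ℂ)) ∈ a.reg x := fun i => by
    simpa only [Units.val_inv_eq_inv_val] using a.inv_mem (hu i) (Units.ne_zero _)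
  have hd : ∀ {f : X → ℂ} (k l : Fin (m + 1)), f ∈ a.reg x →
      (fun x => Matrix.scalar (Fin (m + 1)) (f x) k l) ∈ a.reg x := by
    intro f k l hf
    by_cases hkl : k = l
    · subst hkl
      simpa [Matrix.scalar_apply] using hf
    · simpa [Matrix.scalar_apply, hkl] using const_mem x 0
  refine morphAt_linMix (fun e => ?_) ?_
  · exact (morphAt_left_apply hγ e).gmul (MorphAt.subgroup_val (σ.isMorphism_symm.comp_at ht :))
  · have h1 : MorphAt a (glStr r m) (fun x => scalarGL r m (t x)) x :=
      morphAt_glStr (fun i k l => hd k l (hu i)) (fun i k l => hd k l (hui i))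
    refine ((morphAt_right hγ).gl_mul h1).congr (.of_forall fun x => ?_)
    change _ = (γ x).right * scalarGL r m (σ.β (σ.β.symm (t x)))
    rw [MulEquiv.apply_symm_apply]

/-- The linear group over the mixing group has local sections. -/
theorem exists_linMix_section (γ : LinMixGroup σ m K) :
    ∃ τ : MixGroup σ m K hS → LinMixGroup σ m K,
      MorphAt (mixGroupStr σ m K hS) (linMixStr σ m K) τ γ ∧
      ∀ z, (τ z : MixGroup σ m K hS) = z := by
  classical
  have hne : ∀ i, ∃ p : Fin (m + 1) × Fin (m + 1), (γ.right i).1 p.1 p.2 ≠ 0 := by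
    intro i
    by_contra! h
    exact (γ.right i).ne_zero (Matrix.ext fun k l => h (k, l))
  -- In each factor pick a matrix entry that is nonzero at `γ`. The central torus scales it, and
  -- scaling it to `1` singles out one element of each nearby class.
  choose k hk using hne
  let c : LinMixGroup σ m K → Fin r → ℂ := fun γ i => (γ.right i).1 (k i).1 (k i).2
  let u : LinMixGroup σ m K → Fin r → ℂˣ := fun γ i =>
    if h : c γ i = 0 then 1 else (Units.mk0 (c γ i) h)⁻¹
  have hu : ∀ {γ i}, c γ i ≠ 0 → (u γ i : ℂ) = (c γ i)⁻¹ := fun {γ i} h => by simp [u, h]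
  let N : LinMixGroup σ m K → LinMixGroup σ m K := fun γ =>
    γ * centralTorus σ m K hS (σ.β.symm (u γ))
  have hc : ∀ γ s i, c (γ * centralTorus σ m K hS s) i = c γ i * σ.β s i := by
    intro γ s i
    change ((γ.right i).1 * Matrix.scalar (Fin (m + 1)) (σ.β s i : ℂ)) (k i).1 (k i).2 = _
    simp [Matrix.scalar_apply, Matrix.mul_diagonal, c]
  have hcm : ∀ γ i, (fun γ => c γ i) ∈ (linMixStr σ m K).reg γ := fun γ i =>
    gl_entry_mem (isMorphism_right.morphAt γ) i _ _
  let U : Set (MixGroup σ m K hS) := {z | ∀ i, c z.out i ≠ 0}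
  have hU : ∀ γ : LinMixGroup σ m K, (γ : MixGroup σ m K hS) ∈ U ↔ ∀ i, c γ i ≠ 0 := by
    intro γ
    obtain ⟨⟨_, s, rfl⟩, hs⟩ := QuotientGroup.mk_out_eq_mul (centralTorus σ m K hS).range γ
    change (∀ i, c (γ : MixGroup σ m K hS).out i ≠ 0) ↔ _
    rw [hs]
    simp [hc]
  have hUo : IsOpen[(mixGroupStr σ m K hS).top] U := by
    refine quot_isOpen_iff.2 ?_
    let _ := (linMixStr σ m K).top
    refine isOpen_iff_mem_nhds.2 fun γ hγ => ?_
    have h1 : ∀ᶠ γ' in 𝓝 γ, ∀ i, c γ' i ≠ 0 := eventually_all.2 fun i =>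
      (linMixStr σ m K).eventually_ne (hcm γ i) ((hU γ).1 hγ i)
    exact Filter.mem_of_superset h1 fun γ' hγ' => (hU γ').2 hγ'
  refine ⟨fun z => N z.out, morphAt_comp_out hUo ((hU γ).2 hk) ?_ fun γ hγ => ?_, fun z => ?_⟩
  · intro γ γ' hγ hr
    obtain ⟨s, hs⟩ := QuotientGroup.leftRel_apply.1 hr
    obtain rfl : γ' = γ * centralTorus σ m K hS s := by rw [hs, mul_inv_cancel_left]
    have hγ := (hU γ).1 hγ
    have h1 : u (γ * centralTorus σ m K hS s) = (σ.β s)⁻¹ * u γ := by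
      funext i
      have h2 : c (γ * centralTorus σ m K hS s) i ≠ 0 := by
        rw [hc]
        exact mul_ne_zero (hγ i) (Units.ne_zero _)
      refine Units.ext ?_
      rw [hu h2, Pi.mul_apply, Units.val_mul, hu (hγ i), Pi.inv_apply, Units.val_inv_eq_inv_val,
        hc, mul_inv_rev]
    simp only [N, h1, map_mul, map_inv, MulEquiv.symm_apply_apply]
    group
  · have hγ := (hU γ).1 hγ
    refine MorphAt.linMix_mul_central hS (morphAt_id γ) (morphAt_ofFunctions fun f hf => ?_)
    obtain ⟨i, rfl⟩ := hf
    refine (linMixStr σ m K).congr_mem ((linMixStr σ m K).inv_mem (hcm γ i) (hγ i)) ?_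
    filter_upwards [(linMixStr σ m K).eventually_ne (hcm γ i) (hγ i)] with γ' hγ'
    exact (hu hγ').symm
  · refine (QuotientGroup.mk_mul_of_mem z.out (MonoidHom.mem_range.2 ⟨_, rfl⟩)).trans ?_
    exact Quotient.out_eq z

variable [LieAlgebra.IsKilling ℂ L] [H.IsCartanSubalgebra] {b : (rootSystem H).Base}

theorem isMorphism_mixGroupAction (hσ : σ.IsPositive b) :
    IsMorphism ((mixGroupStr σ m K hS).prod (mixStr σ m (flagRep σ P) (flagStr P)))
      (mixStr σ m (flagRep σ P) (flagStr P)) (fun z => mixGroupAction σ m K hS P z.1 z.2) := by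
  refine .of_morphAt fun ⟨γ, y⟩ => ?_
  induction γ using QuotientGroup.induction_on with
  | H γ =>
    obtain ⟨τ, hτ, hmk⟩ := exists_linMix_section hS γ
    have h1 : MorphAt ((mixGroupStr σ m K hS).prod (mixStr σ m (flagRep σ P) (flagStr P)))
        (linMixStr σ m K) (fun z => τ z.1) (γ, y) :=
      MorphAt.comp hτ (isMorphism_fst.morphAt ((γ : MixGroup σ m K hS), y))
    have h2 := ((isMorphism_linMix_smul (P := P) hσ).comp_at
      (h1.prodMk (isMorphism_snd.morphAt ((γ : MixGroup σ m K hS), y))) :)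
    refine h2.congr (.of_forall fun z => ?_)
    change mixGroupAction σ m K hS P (τ z.1) z.2 = _
    rw [hmk]

variable {q : ℕ} {w : Fin q → b.support} (hP : IsParabolic b P) {n : AdjointGroup L}
  (hn : IsLongest b n) {V : Fin r → Submodule ℂ (Fin (m + 1) → ℂ)}

/-- The map from the semidirect product factors through the quotient group, so a tangent vector
found upstairs can be pushed forward along the quotient map. -/
theorem isSmooth_mixGroupAction (hσ : σ.IsPositive b) (hS : σ.S ≤ borelSubgroup b) : IsSmooth
    ((mixGroupStr σ m (borelSubgroup b) hS).prod (oppBsBundleStr σ m w V))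
    (mixStr σ m (flagRep σ P) (flagStr P))
    (fun z => mixGroupAction σ m (borelSubgroup b) hS P z.1 (oppBsMix σ m w hP hn z.2.1)) := by
  refine isSmooth_of_reach (.of_morphAt fun z => ?_) ?_
  · exact ((isMorphism_mixGroupAction hS hσ).comp_at ((isMorphism_fst.morphAt z).prodMk
      ((isMorphism_oppBsBundle hP hn).comp_at (isMorphism_snd.morphAt z) :)) :)
  rintro ⟨γ, z⟩ D hD
  induction γ using QuotientGroup.induction_on with
  | H γ =>
    obtain ⟨E, hE, h⟩ := reach_of_isSmooth (isSmooth_linMix_smul hP hn (V := V) hσ) (γ, z) D hD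
    have hm : MorphAt ((linMixStr σ m (borelSubgroup b)).prod (oppBsBundleStr σ m w V))
        ((mixGroupStr σ m (borelSubgroup b) hS).prod (oppBsBundleStr σ m w V))
        (fun z => ((z.1 : MixGroup σ m (borelSubgroup b) hS), z.2)) (γ, z) :=
      ((isMorphism_quot_mk _).comp_at (isMorphism_fst.morphAt (γ, z)) :).prodMk
        (isMorphism_snd.morphAt (γ, z))
    exact ⟨_, hE.push hm, h⟩

end MixingGroup
end MixingSpace
end

theorem propositionp {L : Type*} [LieRing L] [LieAlgebra ℂ L] [FiniteDimensional ℂ L]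
    [LieAlgebra.IsKilling ℂ L] (H : LieSubalgebra ℂ L) [H.IsCartanSubalgebra]
    (b : (rootSystem H).Base)
    (P : Subgroup (AdjointGroup L)) (hP : IsParabolic b P) :
    (∀ (q : ℕ) (w : Fin q → b.support),
      FunStr.IsSmooth
        ((subgroupStr (oppBorel b)).prod
          (bsStr (borelSubgroup b) (wordParabolic b w)))
        (flagStr P)
        (multMap b w hP)) ∧
    (∀ (r : ℕ) (σ : Subtorus H r) (_ : σ.IsPositive b) (m : ℕ)
      (V : Fin r → Submodule ℂ (Fin (m + 1) → ℂ)) (_ : ∀ i, V i ≠ ⊥)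
      (n : AdjointGroup L) (hn : IsLongest b n)
      (q : ℕ) (w : Fin q → b.support),
      FunStr.IsSmooth
        ((linMixStr σ m (borelSubgroup b)).prod
          (oppBsBundleStr σ m w V))
        (mixStr σ m (flagRep σ P) (flagStr P))
        (fun z => z.1 • oppBsMix σ m w hP hn z.2.1) ∧
      FunStr.IsSmooth
        ((mixGroupStr σ m (borelSubgroup b)
            (σ.le_torus.trans (torus_le_borel b))).prod
          (oppBsBundleStr σ m w V))
        (mixStr σ m (flagRep σ P) (flagStr P))
        (fun z => mixGroupAction σ m (borelSubgroup b)
          (σ.le_torus.trans (torus_le_borel b)) P z.1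
          (oppBsMix σ m w hP hn z.2.1))) :=
  ⟨fun q w => isSmooth_multMap b w hP, fun r σ hσ m V _ n hn q w =>
    ⟨isSmooth_linMix_smul hP hn hσ, isSmooth_mixGroupAction hP hn hσ _⟩⟩
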